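/- **Conventions.** An *r-discrete groupoid* is a locally compact Hausdorff topological groupoid $G$ with unit space $G^0$ whose range and source maps $r,s$ are local homeomorphisms; $G^x=r^{-1}(x)$. $C_c(G)$ carries the convolution $(f\star g)(t)=\sum_{r(h)=r(t)}f(h)g(h^{-1}t)$ and the involution $f^*(t)=\overline{f(t^{-1})}$; $C^*(G)$ is its completion for the largest C*-seminorm dominated by the $I$-norm, and $C^*_r(G)$ is the C*-algebra generated by its image under the regular representation on $\ell^2(G)$, $f\delta_u=\sum_{s(t)=s(u)}f(tu^{-1})\delta_t$. A *multiply generated dynamical system* (MGDS) on a space $Y$ is a finite commuting family of partial local homeomorphisms with open domains, viewed as an action $n\mapsto T^n$ of $\mathbb N^k$; it satisfies (DC) if $\mathrm{dom}\,T^m\cap\mathrm{dom}\,T^n\subset\mathrm{dom}\,T^{m\vee n}$. Then $G(Y,T)=\{(x,m-n,y):T^mx=T^ny\}$ is the semidirect product groupoid, with $r(x,k,y)=x$, $s(x,k,y)=y$ and $(x,k,y)(y,l,z)=(x,k+l,z)$, topologized by the basic open sets $\{(x,m-n,y):x\in U,\,y\in V,\,T^mx=T^ny\}$, where $U\subset\mathrm{dom}\,T^m$,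 $V\subset\mathrm{dom}\,T^n$ are open and $T^m|_U$, $T^n|_V$ are injective; $C^*(Y,T)=C^*(G(Y,T))$. **Lemma.** Let $\varphi:G_1\to G_2$ be a (continuous) morphism of r-discrete groupoids such that $\varphi:G_1^x\to G_2^{\varphi(x)}$ is a bijection for each $x\in G_1^0$ and $\varphi_0=\varphi|_{G_1^0}:G_1^0\to G_2^0$ is proper. Then $\varphi$ is proper, and the map $C_c(G_2)\ni f\mapsto f\circ\varphi\in C_c(G_1)$ extends (uniquely) to a $*$-homomorphism $C^*(G_2)\to C^*_r(G_1)$. **Setting of the Proposition.** Let $(\Lambda,\sigma)$ be a rank $r$ graph (a small category with source $s$, terminal $t$, shape functor $\sigma$ to $\mathbb N^r$ and unique factorization) such that for each $n\in\mathbb N^r$ the set $\{\lambda:\sigma(\lambda)=n\}$ is finite and nonempty, and each object is the source, and the terminal, of some morphism of shape $n$. Let $\Lambda^\infty$ be its infinite path space with the cylinder topology and the shifts $W_k$, and let $S_k(n)=n-k$ on $\{n\ge k\}\subset\overline{\mathbb N}^r$, where $\overline{\mathbb N}=\mathbb N\cup\{\infty\}$. Let $\overline\Lambda=\{\Omega\}\cup\{\lambda:\sigma(\lambda)\neq0\}$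 with $\lambda\Omega=\Omega\lambda=\lambda$, $\sigma(\Omega)=0$; let $L_\lambda,R_\lambda$ be the left and right creation operators on $\ell^2(\overline\Lambda)$, $\delta_\mu\mapsto\delta_{\lambda\mu}$, resp. $\delta_\mu\mapsto\delta_{\mu\lambda}$ (and $0$ if the product is not defined), $\mathcal E=C^*(L_\lambda,R_\lambda)$, and $X$ the Gelfand spectrum of $\mathcal E\cap\ell^\infty(\overline\Lambda)$, so that $\overline\Lambda\subset X$, and $L_\lambda,R_\lambda$ induce partial homeomorphisms $x\mapsto\lambda x$, $x\mapsto x\lambda$ of $X$. Let $Z=\{(x,y)\in X\times\Lambda^\infty:s(x)=t(y)\}$, with $\Omega$ composable with every $y$; let $T_m(x,y)=(x',\lambda y)$ where $x=x'\lambda$, $\sigma(\lambda)=m$ (defined when $x$ has such a factorization), and $V_m(x,y)=(x',W_m(y))$ where $x\,y(0,m)=\lambda x'$, $\sigma(\lambda)=m$. Let $C^*(\Lambda)$ be the universal C*-algebra of the Cuntz–Krieger relations of $\Lambda$, with generators $s_\lambda$, and $\mathcal T$ the Toeplitz algebra, the universal C*-algebra generated by an isometry; $S_j\in\mathcal T^{\otimes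 r}$ is the isometry of the $j$-th factor. The tensor products are the maximal ones (these algebras are nuclear). **Proposition.** $(Z,(T,V))$ and $(\overline{\mathbb N}^r\times\Lambda^\infty,S\times W)$ are MGDS of rank $2r$ with (DC), and $G_1=G(Z,(T,V))$ and $G_2=G(\overline{\mathbb N}^r\times\Lambda^\infty,S\times W)$ are r-discrete groupoids. The map $(\mu,y)\mapsto(\sigma(\mu),\mu y)$ on $(\overline\Lambda\times\Lambda^\infty)\cap Z$ (with $\Omega y=y$) extends to a continuous map $\phi:Z\to\overline{\mathbb N}^r\times\Lambda^\infty$, and $\hat\phi(x,k,y)=(\phi(x),k,\phi(y))$ defines a morphism $\hat\phi:G_1\to G_2$ which satisfies the hypotheses of the Lemma. Hence $\hat\phi$ is proper and $f\mapsto f\circ\hat\phi$ extends to a $*$-homomorphism $C^*(G_2)\to C^*_r(G_1)$; it also extends to $\Phi:C^*(G_2)\to C^*(G_1)=C^*(Z,(T,V))$. There is a $*$-homomorphism $\Theta:\mathcal T^{\otimes r}\otimes C^*(\Lambda)\to C^*(G_2)$ sending $S_j\otimes1$ to the characteristic function of $\{((n+e_j,x),(e_j,0),(n,x))\}$ and $1\otimes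 s_\lambda$ to that of $\{((n,\lambda x),(0,\sigma(\lambda)),(n,x))\}$, and so one obtains the $*$-homomorphism $\Psi=\Phi\circ\Theta:\mathcal T^{\otimes r}\otimes C^*(\Lambda)\to C^*(Z,(T,V))$. -/

import Mathlib

open scoped NNReal CompactlySupported ComplexConjugate

noncomputable section

/-! ### Universal C⋆-algebras given by generators, relations and norm bounds -/

/-- The free unital complex ⋆-algebra on `X`: the free algebra on two copies of `X`, the second one
consisting of the adjoints of the first. -/
def FreeStarAlg (X : Type*) : Type _ := FreeAlgebra ℂ (X ⊕ X)

namespace FreeStarAlg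

variable {X : Type*}

instance : Ring (FreeStarAlg X) := inferInstanceAs (Ring (FreeAlgebra ℂ (X ⊕ X)))
instance : Algebra ℂ (FreeStarAlg X) := inferInstanceAs (Algebra ℂ (FreeAlgebra ℂ (X ⊕ X)))

/-- All letters: `Sum.inl x` is the generator `x`, `Sum.inr x` is its adjoint. -/
def letter (y : X ⊕ X) : FreeStarAlg X := FreeAlgebra.ι ℂ y

/-- The generator belonging to `x`. -/
def gen (x : X) : FreeStarAlg X := letter (Sum.inl x)

theorem induction {p : FreeStarAlg X → Prop} (hc : ∀ c : ℂ, p (algebraMap ℂ _ c))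
    (hl : ∀ y, p (letter y)) (hm : ∀ a b, p a → p b → p (a * b))
    (ha : ∀ a b, p a → p b → p (a + b)) (a : FreeStarAlg X) : p a :=
  FreeAlgebra.induction ℂ (X ⊕ X) hc hl hm ha a

/-- The ring homomorphism `c ↦ conj c` into the opposite algebra. -/
def conjOp : ℂ →+* (FreeStarAlg X)ᵐᵒᵖ :=
  (algebraMap ℂ (FreeStarAlg X)ᵐᵒᵖ).comp (starRingEnd ℂ)

/-- The involution as a ring homomorphism into the opposite algebra; it is conjugate-linear and
exchanges the two copies of `X`. -/
def starHom : FreeStarAlg X →+* (FreeStarAlg X)ᵐᵒᵖ :=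
  letI : Algebra ℂ (FreeStarAlg X)ᵐᵒᵖ :=
    conjOp.toAlgebra' fun c x => Algebra.commutes (starRingEnd ℂ c) x
  (FreeAlgebra.lift ℂ (A := (FreeStarAlg X)ᵐᵒᵖ)
    fun y : X ⊕ X => MulOpposite.op (letter y.swap)).toRingHom

theorem starHom_letter (y : X ⊕ X) : starHom (letter y) = MulOpposite.op (letter y.swap) := by
  let _ : Algebra ℂ (FreeStarAlg X)ᵐᵒᵖ :=
    conjOp.toAlgebra' fun c x => Algebra.commutes (starRingEnd ℂ c) x
  exact FreeAlgebra.lift_ι_apply (R := ℂ) (A := (FreeStarAlg X)ᵐᵒᵖ)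
    (fun y : X ⊕ X => MulOpposite.op (letter y.swap)) y

theorem starHom_algebraMap (c : ℂ) : starHom (algebraMap ℂ (FreeStarAlg X) c) =
    MulOpposite.op (algebraMap ℂ (FreeStarAlg X) (conj c)) := by
  let _ : Algebra ℂ (FreeStarAlg X)ᵐᵒᵖ :=
    conjOp.toAlgebra' fun c x => Algebra.commutes (starRingEnd ℂ c) x
  exact (FreeAlgebra.lift ℂ (A := (FreeStarAlg X)ᵐᵒᵖ)
    fun y : X ⊕ X => MulOpposite.op (letter y.swap)).commutes c

instance : StarRing (FreeStarAlg X) where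
  star a := (starHom a).unop
  star_involutive a := by
    refine induction (p := fun a => (starHom (starHom a).unop).unop = a) ?_ ?_ ?_ ?_ a
    · intro c; simp [starHom_algebraMap]
    · intro y; simp [starHom_letter]
    · intro a b h1 h2; simp [h1, h2]
    · intro a b h1 h2; simp [h1, h2]
  star_mul a b := by simp
  star_add a b := by simp

instance : StarModule ℂ (FreeStarAlg X) where
  star_smul c a := by
    change (starHom (c • a)).unop = conj c • (starHom a).unop
    rw [Algebra.smul_def, map_mul, starHom_algebraMap, MulOpposite.unop_mul,
      MulOpposite.unop_op, ← Algebra.commutes, ← Algebra.smul_def]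

theorem star_letter (y : X ⊕ X) : star (letter y) = letter y.swap := by
  change (starHom (letter y)).unop = _
  rw [starHom_letter]; rfl

end FreeStarAlg

/-- Generators `X`, a set of ⋆-polynomials to be set equal to `0`, and a bound for the norm of each
generator. -/
structure CStarPresentation (X : Type*) where
  rels : Set (FreeStarAlg X)
  bound : X → ℝ≥0

namespace CStarPresentation

variable {X : Type*} (P : CStarPresentation X)

/-- The C⋆-seminorms on the free ⋆-algebra which kill the relations and respect the bounds. -/
structure Admissible (p : Seminorm ℂ (FreeStarAlg X)) : Prop where
  mul_le : ∀ a b, p (a * b) ≤ p a * p b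
  star_mul_self : ∀ a, p (star a * a) = p a * p a
  rel : ∀ a ∈ P.rels, p a = 0
  gen_le : ∀ x, p (FreeStarAlg.gen x) ≤ P.bound x

variable {P}

theorem Admissible.le_star {p : Seminorm ℂ (FreeStarAlg X)} (hp : P.Admissible p)
    (a : FreeStarAlg X) : p a ≤ p (star a) := by
  by_contra! h
  have h0 : 0 < p a := lt_of_le_of_lt (apply_nonneg p _) h
  have h1 := hp.star_mul_self a
  have h2 := hp.mul_le (star a) a
  nlinarith

theorem Admissible.star_eq {p : Seminorm ℂ (FreeStarAlg X)} (hp : P.Admissible p)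
    (a : FreeStarAlg X) : p (star a) = p a :=
  le_antisymm (by simpa using hp.le_star (star a)) (hp.le_star a)

theorem Admissible.one_le {p : Seminorm ℂ (FreeStarAlg X)} (hp : P.Admissible p) :
    p (1 : FreeStarAlg X) ≤ 1 := by
  by_contra! h
  have h1 := hp.star_mul_self 1
  simp only [star_one, mul_one] at h1
  nlinarith

theorem admissible_zero : P.Admissible (0 : Seminorm ℂ (FreeStarAlg X)) where
  mul_le a b := by simp
  star_mul_self a := by simp
  rel a _ := by simp
  gen_le x := by simp

instance : Nonempty {p : Seminorm ℂ (FreeStarAlg X) // P.Admissible p} := ⟨⟨0, admissible_zero⟩⟩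

theorem bddAbove (a : FreeStarAlg X) :
    BddAbove (Set.range fun p : {p : Seminorm ℂ (FreeStarAlg X) // P.Admissible p} => p.1 a) := by
  suffices h : ∃ C, ∀ p : Seminorm ℂ (FreeStarAlg X), P.Admissible p → p a ≤ C by
    obtain ⟨C, hC⟩ := h
    exact ⟨C, by rintro _ ⟨p, rfl⟩; exact hC p.1 p.2⟩
  refine FreeStarAlg.induction
    (p := fun a => ∃ C, ∀ p : Seminorm ℂ (FreeStarAlg X), P.Admissible p → p a ≤ C) ?_ ?_ ?_ ?_ a
  · intro c
    refine ⟨‖c‖, fun p hp => ?_⟩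
    rw [Algebra.algebraMap_eq_smul_one, map_smul_eq_mul]
    exact mul_le_of_le_one_right (norm_nonneg _) hp.one_le
  · rintro (x | x)
    · exact ⟨P.bound x, fun p hp => hp.gen_le x⟩
    · refine ⟨P.bound x, fun p hp => ?_⟩
      have h := hp.star_eq (FreeStarAlg.gen x)
      rw [FreeStarAlg.gen, FreeStarAlg.star_letter] at h
      exact h.trans_le (hp.gen_le x)
  · rintro a b ⟨C, hC⟩ ⟨D, hD⟩
    refine ⟨C * D, fun p hp => (hp.mul_le a b).trans ?_⟩
    exact mul_le_mul (hC p hp) (hD p hp) (apply_nonneg _ _)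
      ((apply_nonneg _ _).trans (hC p hp))
  · rintro a b ⟨C, hC⟩ ⟨D, hD⟩
    exact ⟨C + D, fun p hp => (map_add_le_add p a b).trans (add_le_add (hC p hp) (hD p hp))⟩

variable (P)

/-- The largest admissible C⋆-seminorm. -/
def norm (a : FreeStarAlg X) : ℝ :=
  ⨆ p : {p : Seminorm ℂ (FreeStarAlg X) // P.Admissible p}, p.1 a

variable {P}

theorem le_norm {p : Seminorm ℂ (FreeStarAlg X)} (hp : P.Admissible p) (a : FreeStarAlg X) :
    p a ≤ P.norm a :=
  le_ciSup (f := fun p : {p : Seminorm ℂ (FreeStarAlg X) // P.Admissible p} => p.1 a)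
    (bddAbove a) ⟨p, hp⟩

theorem norm_le {a : FreeStarAlg X} {C : ℝ}
    (h : ∀ p : Seminorm ℂ (FreeStarAlg X), P.Admissible p → p a ≤ C) : P.norm a ≤ C :=
  ciSup_le fun p => h p.1 p.2

theorem norm_nonneg' (a : FreeStarAlg X) : 0 ≤ P.norm a :=
  (apply_nonneg _ a).trans (le_norm admissible_zero a)

variable (P)

/-- The free ⋆-algebra equipped with the largest admissible C⋆-seminorm. -/
def Pre (_ : CStarPresentation X) : Type _ := FreeStarAlg X

instance : Ring P.Pre := inferInstanceAs (Ring (FreeStarAlg X))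
instance : Algebra ℂ P.Pre := inferInstanceAs (Algebra ℂ (FreeStarAlg X))
instance : StarRing P.Pre := inferInstanceAs (StarRing (FreeStarAlg X))
instance : StarModule ℂ P.Pre := inferInstanceAs (StarModule ℂ (FreeStarAlg X))

/-- The norm of the universal C⋆-algebra as a ring seminorm. -/
def ringSeminorm : RingSeminorm P.Pre where
  toFun := P.norm
  map_zero' := le_antisymm (norm_le fun p _ => (map_zero p).le) (norm_nonneg' _)
  add_le' a b := norm_le fun p hp => (map_add_le_add p a b).trans
    (add_le_add (le_norm hp a) (le_norm hp b))
  neg' a := by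
    refine le_antisymm (norm_le fun p hp => ?_) (norm_le fun p hp => ?_)
    · exact (map_neg_eq_map p a).trans_le (le_norm hp a)
    · exact (map_neg_eq_map p a).symm.trans_le (le_norm hp _)
  mul_le' a b := norm_le fun p hp => (hp.mul_le a b).trans
    (mul_le_mul (le_norm hp a) (le_norm hp b) (apply_nonneg _ _) (norm_nonneg' a))

instance : SeminormedRing P.Pre := P.ringSeminorm.toSeminormedRing

theorem pre_norm_def (a : P.Pre) : ‖a‖ = P.norm a := rfl

instance : NormedAlgebra ℂ P.Pre where
  norm_smul_le c a := norm_le fun p hp =>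
    (map_smul_eq_mul p c _).trans_le
      (mul_le_mul_of_nonneg_left (le_norm hp a) (norm_nonneg c))

theorem pre_norm_star (a : P.Pre) : ‖star a‖ = ‖a‖ :=
  le_antisymm (norm_le fun _ hp => (hp.star_eq a).trans_le (le_norm hp a))
    (norm_le fun _ hp => (hp.star_eq a).symm.trans_le (le_norm hp _))

theorem pre_norm_mul_self_le (a : P.Pre) : ‖a‖ * ‖a‖ ≤ ‖star a * a‖ := by
  have h : ‖a‖ ≤ Real.sqrt ‖star a * a‖ := norm_le fun p hp =>
    Real.le_sqrt_of_sq_le ((sq (p a)).trans_le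
      ((hp.star_mul_self a).symm.trans_le (le_norm hp (star a * a))))
  calc ‖a‖ * ‖a‖ ≤ Real.sqrt ‖star a * a‖ * Real.sqrt ‖star a * a‖ :=
        mul_le_mul h h (norm_nonneg _) (Real.sqrt_nonneg _)
    _ = ‖star a * a‖ := Real.mul_self_sqrt (norm_nonneg _)

theorem pre_isometry_star : Isometry (star : P.Pre → P.Pre) := by
  refine Isometry.of_dist_eq fun a b => ?_
  rw [dist_eq_norm, dist_eq_norm, ← star_sub, pre_norm_star]

/-- The universal C⋆-algebra of the presentation `P`. -/
abbrev Universal : Type _ := UniformSpace.Completion P.Pre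

open UniformSpace in
instance : CStarAlgebra P.Universal where
  __ := (inferInstance : NormedRing (Completion P.Pre))
  __ := (inferInstance : Algebra ℂ (Completion P.Pre))
  __ := (inferInstance : CompleteSpace (Completion P.Pre))
  star := Completion.map star
  star_involutive a := by
    have hc : Continuous (Completion.map (star : P.Pre → P.Pre)) := Completion.continuous_map
    induction a using Completion.induction_on with
    | hp => exact isClosed_eq (hc.comp hc) continuous_id
    | ih a => simp only [Completion.map_coe P.pre_isometry_star.uniformContinuous, star_star]
  star_mul a b := by
    have hc : Continuous (Completion.map (star : P.Pre → P.Pre)) := Completion.continuous_map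
    induction a, b using Completion.induction_on₂ with
    | hp => exact isClosed_eq (by fun_prop) (by fun_prop)
    | ih a b =>
      rw [← Completion.coe_mul]
      simp only [Completion.map_coe P.pre_isometry_star.uniformContinuous]
      rw [star_mul, Completion.coe_mul]
  star_add a b := by
    have hc : Continuous (Completion.map (star : P.Pre → P.Pre)) := Completion.continuous_map
    induction a, b using Completion.induction_on₂ with
    | hp => exact isClosed_eq (by fun_prop) (by fun_prop)
    | ih a b =>
      rw [← Completion.coe_add]
      simp only [Completion.map_coe P.pre_isometry_star.uniformContinuous]
      rw [star_add, Completion.coe_add]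
  norm_mul_self_le a := by
    change ‖a‖ * ‖a‖ ≤ ‖Completion.map star a * a‖
    have hc : Continuous (Completion.map (star : P.Pre → P.Pre)) := Completion.continuous_map
    induction a using Completion.induction_on with
    | hp => exact isClosed_le (by fun_prop) (by fun_prop)
    | ih a =>
      rw [Completion.map_coe P.pre_isometry_star.uniformContinuous, ← Completion.coe_mul]
      simp only [Completion.norm_coe]
      exact P.pre_norm_mul_self_le a
  norm_smul_le c a := norm_smul_le c a
  star_smul c a := by
    change Completion.map star (c • a) = star c • Completion.map star a
    have hc : Continuous (Completion.map (star : P.Pre → P.Pre)) := Completion.continuous_map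
    induction a using Completion.induction_on with
    | hp => exact isClosed_eq (hc.comp (continuous_const_smul c))
              ((continuous_const_smul (star c)).comp hc)
    | ih a =>
      rw [← Completion.coe_smul]
      simp only [Completion.map_coe P.pre_isometry_star.uniformContinuous]
      rw [star_smul, Completion.coe_smul]

/-- The image in the universal C⋆-algebra of a ⋆-polynomial in the generators. -/
def eval (a : FreeStarAlg X) : P.Universal :=
  UniformSpace.Completion.coe' (α := P.Pre) a

/-- The generators of the universal C⋆-algebra. -/
def ι (x : X) : P.Universal := P.eval (FreeStarAlg.gen x)

end CStarPresentation

/-! ### Topological groupoids -/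

/-- A groupoid with arrow set `G` and unit space `X`; `g h` is defined when `s g = r h`. -/
structure GroupoidStr (G X : Type*) where
  r : G → X
  s : G → X
  unit : X → G
  inv : G → G
  mul : (g h : G) → s g = r h → G
  r_unit : ∀ x, r (unit x) = x
  s_unit : ∀ x, s (unit x) = x
  r_inv : ∀ g, r (inv g) = s g
  s_inv : ∀ g, s (inv g) = r g
  r_mul : ∀ g h (p : s g = r h), r (mul g h p) = r g
  s_mul : ∀ g h (p : s g = r h), s (mul g h p) = s h
  mul_assoc : ∀ g h k (p : s g = r h) (q : s h = r k),
    mul (mul g h p) k ((s_mul g h p).trans q) = mul g (mul h k q) (p.trans (r_mul h k q).symm)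
  unit_mul : ∀ g, mul (unit (r g)) g (s_unit _) = g
  mul_unit : ∀ g, mul g (unit (s g)) (r_unit _).symm = g
  inv_mul : ∀ g, mul (inv g) g (s_inv g) = unit (s g)
  mul_inv : ∀ g, mul g (inv g) (r_inv g).symm = unit (r g)

namespace GroupoidStr

section Algebras

variable {G X : Type*} [TopologicalSpace G] (𝒢 : GroupoidStr G X)

/-- A locally compact Hausdorff r-discrete (étale) topological groupoid. -/
structure IsEtale [TopologicalSpace X] : Prop where
  t2 : T2Space G
  locallyCompact : LocallyCompactSpace G
  continuous_unit : Continuous 𝒢.unit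
  continuous_inv : Continuous 𝒢.inv
  continuous_mul : Continuous fun p : {p : G × G // 𝒢.s p.1 = 𝒢.r p.2} => 𝒢.mul p.1.1 p.1.2 p.2
  isLocalHomeomorph_r : IsLocalHomeomorph 𝒢.r
  isLocalHomeomorph_s : IsLocalHomeomorph 𝒢.s

/-- Convolution, `(f ⋆ g)(t) = ∑_{r(h) = r(t)} f(h) g(h⁻¹ t)`. -/
def conv (f g : G → ℂ) (t : G) : ℂ :=
  ∑ᶠ h : {h : G // 𝒢.r h = 𝒢.r t}, f h * g (𝒢.mul (𝒢.inv h) t ((𝒢.s_inv h).trans h.2))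

/-- Involution, `f^*(t) = conj (f(t⁻¹))`. -/
def invol (f : G → ℂ) (t : G) : ℂ := conj (f (𝒢.inv t))

/-- The I-norm, the larger one of `sup_x ∑_{r(g) = x} |f(g)|` and `sup_x ∑_{s(g) = x} |f(g)|`. -/
def INorm (f : G → ℂ) : ℝ≥0 :=
  max (⨆ x : X, ∑ᶠ g : {g : G // 𝒢.r g = x}, ‖f g‖₊) (⨆ x : X, ∑ᶠ g : {g : G // 𝒢.s g = x}, ‖f g‖₊)

open FreeStarAlg in
/-- The relations satisfied by a ⋆-representation of the convolution algebra `C_c(G)` bounded by the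
I-norm. -/
def presentation : CStarPresentation C_c(G, ℂ) where
  rels := {a | (∃ f g : C_c(G, ℂ), a = gen (f + g) - (gen f + gen g)) ∨
    (∃ (c : ℂ) (f : C_c(G, ℂ)), a = gen (c • f) - c • gen f) ∨
    (∃ f g h : C_c(G, ℂ), ⇑h = 𝒢.conv f g ∧ a = gen h - gen f * gen g) ∨
    (∃ f h : C_c(G, ℂ), ⇑h = 𝒢.invol f ∧ a = gen h - star (gen f))}
  bound f := 𝒢.INorm f

/-- The full groupoid C⋆-algebra `C*(G)`: the (possibly non-unital) C⋆-algebra generated by the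
universal I-norm bounded ⋆-representation of `C_c(G)`. -/
def FullCStar : Type _ :=
  (NonUnitalStarAlgebra.adjoin ℂ (Set.range 𝒢.presentation.ι)).topologicalClosure

instance : NonUnitalCStarAlgebra 𝒢.FullCStar :=
  NonUnitalStarSubalgebra.nonUnitalCStarAlgebra
    (NonUnitalStarAlgebra.adjoin ℂ (Set.range 𝒢.presentation.ι)).topologicalClosure
    (h_closed := NonUnitalStarSubalgebra.isClosed_topologicalClosure _)

/-- The canonical map `C_c(G) → C*(G)`. -/
def toFull (f : C_c(G, ℂ)) : 𝒢.FullCStar :=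
  ⟨𝒢.presentation.ι f, NonUnitalStarSubalgebra.le_topologicalClosure _
    (NonUnitalStarAlgebra.subset_adjoin ℂ _ ⟨f, rfl⟩)⟩

end Algebras

end GroupoidStr

/-- The Hilbert space `ℓ²(I)`. -/
abbrev HilbertL2 (I : Type*) : Type _ := lp (fun _ : I => ℂ) 2

/-- The basis vector `δ_i` of `ℓ²(I)`. -/
def basisVec {I : Type*} (i : I) : HilbertL2 I :=
  open Classical in lp.single 2 i 1

namespace GroupoidStr

section Reduced

variable {G X : Type*} [TopologicalSpace G] (𝒢 : GroupoidStr G X)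

open Classical in
/-- `A` is the image of `f` under the regular representation of `C_c(G)` on
`ℓ²(G) = ⨁_x ℓ²(s⁻¹(x))`: `A δ_u = ∑_{s(t) = s(u)} f(t u⁻¹) δ_t`. -/
def IsRegular (f : G → ℂ) (A : HilbertL2 G →L[ℂ] HilbertL2 G) : Prop :=
  ∀ u t : G, (A (basisVec u) : G → ℂ) t =
    if h : 𝒢.s t = 𝒢.s u then f (𝒢.mul t (𝒢.inv u) (h.trans (𝒢.r_inv u).symm)) else 0

/-- The reduced groupoid C⋆-algebra `C*_r(G)`, generated by the image of `C_c(G)` under the regular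
representation. -/
def ReducedCStar : Type _ :=
  (NonUnitalStarAlgebra.adjoin ℂ
    {A : HilbertL2 G →L[ℂ] HilbertL2 G | ∃ f : C_c(G, ℂ), 𝒢.IsRegular f A}).topologicalClosure

instance : NonUnitalCStarAlgebra 𝒢.ReducedCStar :=
  NonUnitalStarSubalgebra.nonUnitalCStarAlgebra
    (NonUnitalStarAlgebra.adjoin ℂ
      {A : HilbertL2 G →L[ℂ] HilbertL2 G | ∃ f : C_c(G, ℂ), 𝒢.IsRegular f A}).topologicalClosure
    (h_closed := NonUnitalStarSubalgebra.isClosed_topologicalClosure _)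

/-- The element `a` of `C*_r(G)` is the canonical image of `f`. -/
def ReducedCStar.IsImage {𝒢 : GroupoidStr G X} (a : 𝒢.ReducedCStar) (f : C_c(G, ℂ)) : Prop :=
  𝒢.IsRegular f a.1

end Reduced

/-- Morphisms of topological groupoids; `φ₀` is the map of unit spaces. -/
structure IsMorphism {G₁ X₁ G₂ X₂ : Type*} [TopologicalSpace G₁] [TopologicalSpace G₂]
    (𝒢₁ : GroupoidStr G₁ X₁) (𝒢₂ : GroupoidStr G₂ X₂) (φ : G₁ → G₂) (φ₀ : X₁ → X₂) : Prop where
  continuous : Continuous φ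
  r_map : ∀ g, 𝒢₂.r (φ g) = φ₀ (𝒢₁.r g)
  s_map : ∀ g, 𝒢₂.s (φ g) = φ₀ (𝒢₁.s g)
  map_mul : ∀ g h (p : 𝒢₁.s g = 𝒢₁.r h),
    φ (𝒢₁.mul g h p) = 𝒢₂.mul (φ g) (φ h) ((s_map g).trans ((congrArg φ₀ p).trans (r_map h).symm))

/-- Each range fibre `r⁻¹(x)` is mapped bijectively onto the range fibre `r⁻¹(φ₀(x))`. -/
def IsRangeFibreBijective {G₁ X₁ G₂ X₂ : Type*}
    (𝒢₁ : GroupoidStr G₁ X₁) (𝒢₂ : GroupoidStr G₂ X₂) (φ : G₁ → G₂) (φ₀ : X₁ → X₂) : Prop :=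
  ∀ x : X₁, Set.BijOn φ {g | 𝒢₁.r g = x} {g | 𝒢₂.r g = φ₀ x}

end GroupoidStr

/-! ### Multiply generated dynamical systems -/

section MGDS

variable {J X : Type*} [TopologicalSpace X]

/-- A partial local homeomorphism with open domain. -/
def IsPartialLocalHomeo (f : X →. X) : Prop :=
  IsOpen f.Dom ∧ ∀ x ∈ f.Dom, ∃ e : OpenPartialHomeomorph X X,
    x ∈ e.source ∧ ∀ y ∈ e.source, e y ∈ f y

/-- A multiply generated dynamical system: an action `n ↦ T^n` of the semigroup `ℕ^J` by partial
local homeomorphisms; equivalently, a family `(T_j)_{j ∈ J}` of commuting ones. -/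
structure IsMGDS (T : (J → ℕ) → (X →. X)) : Prop where
  zero : T 0 = PFun.id X
  add : ∀ m n, T (m + n) = (T m).comp (T n)
  localHomeo : ∀ n, IsPartialLocalHomeo (T n)

/-- The domain condition (DC). -/
def DomainCondition (T : (J → ℕ) → (X →. X)) : Prop :=
  ∀ m n, (T m).Dom ∩ (T n).Dom ⊆ (T (m ⊔ n)).Dom

/-- The elements `(x, m - n, y)`, `T^m x = T^n y`, of the semidirect product groupoid `G(X,T)`. -/
def SemidirectGroupoid (T : (J → ℕ) → (X →. X)) : Type _ :=
  {p : X × (J → ℤ) × X // ∃ m n : J → ℕ, (∀ j, p.2.1 j = (m j : ℤ) - n j) ∧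
    ∃ w, w ∈ T m p.1 ∧ w ∈ T n p.2.2}

/-- The basic open set `𝒰(U; m, n; V)`. -/
def semidirectBasic (T : (J → ℕ) → (X →. X)) (U : Set X) (m n : J → ℕ) (V : Set X) :
    Set (SemidirectGroupoid T) :=
  {g | g.1.1 ∈ U ∧ g.1.2.2 ∈ V ∧ (∀ j, g.1.2.1 j = (m j : ℤ) - n j) ∧
    ∃ w, w ∈ T m g.1.1 ∧ w ∈ T n g.1.2.2}

/-- `U` is an open subset of the domain of `f` on which `f` is injective. -/
def IsOpenInjective (f : X →. X) (U : Set X) : Prop :=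
  IsOpen U ∧ U ⊆ f.Dom ∧ ∀ x ∈ U, ∀ y ∈ U, ∀ w, w ∈ f x → w ∈ f y → x = y

instance (T : (J → ℕ) → (X →. X)) : TopologicalSpace (SemidirectGroupoid T) :=
  TopologicalSpace.generateFrom {A | ∃ U m n V,
    IsOpenInjective (T m) U ∧ IsOpenInjective (T n) V ∧ A = semidirectBasic T U m n V}

theorem semidirect_mul_mem {T : (J → ℕ) → (X →. X)} (hT : IsMGDS T) (hDC : DomainCondition T)
    (g h : SemidirectGroupoid T) (p : g.1.2.2 = h.1.1) :
    ∃ m n : J → ℕ, (∀ j, (g.1.2.1 + h.1.2.1) j = (m j : ℤ) - n j) ∧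
      ∃ w, w ∈ T m g.1.1 ∧ w ∈ T n h.1.2.2 := by
  obtain ⟨⟨x, k, y⟩, m, n, hk, w, hx, hy⟩ := g
  obtain ⟨⟨y', k', z⟩, m', n', hk', w', hy', hz⟩ := h
  simp only at p hk hk' hx hy hy' hz ⊢
  subst p
  have hdom : y ∈ (T (n ⊔ m')).Dom :=
    hDC n m' ⟨(PFun.mem_dom _ _).2 ⟨w, hy⟩, (PFun.mem_dom _ _).2 ⟨w', hy'⟩⟩
  obtain ⟨v, hv⟩ := (PFun.mem_dom _ _).1 hdom
  have key : ∀ (a b : J → ℕ) (u u₁ : X), u₁ ∈ T b u → (v ∈ T (a + b) u ↔ v ∈ T a u₁) := by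
    intro a b u u₁ h1
    rw [hT.add, PFun.comp_apply]
    refine Part.mem_bind_iff.trans ?_
    constructor
    · rintro ⟨u₂, h2, h3⟩
      rwa [Part.mem_unique h1 h2]
    · exact fun h3 => ⟨u₁, h1, h3⟩
  have e1 : (n ⊔ m' - n) + n = n ⊔ m' := tsub_add_cancel_of_le le_sup_left
  have e2 : (n ⊔ m' - m') + m' = n ⊔ m' := tsub_add_cancel_of_le le_sup_right
  refine ⟨(n ⊔ m' - n) + m, (n ⊔ m' - m') + n', fun j => ?_, v, ?_, ?_⟩
  · have h1 := congrFun e1 j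
    have h2 := congrFun e2 j
    simp only [Pi.add_apply, hk, hk'] at h1 h2 ⊢
    omega
  · exact (key _ _ _ _ hx).2 ((key _ _ _ _ hy).1 (by rwa [e1]))
  · exact (key _ _ _ _ hz).2 ((key _ _ _ _ hy').1 (by rwa [e2]))

/-- The semidirect product groupoid `G(X,T)` of a system with (DC). -/
def semidirectGroupoid {T : (J → ℕ) → (X →. X)} (hT : IsMGDS T) (hDC : DomainCondition T) :
    GroupoidStr (SemidirectGroupoid T) X where
  r g := g.1.1
  s g := g.1.2.2
  unit x := ⟨(x, 0, x), 0, 0, by simp, x, by simp [hT.zero], by simp [hT.zero]⟩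
  inv g := ⟨(g.1.2.2, -g.1.2.1, g.1.1), by
    obtain ⟨m, n, hk, w, h1, h2⟩ := g.2
    exact ⟨n, m, fun j => by simp [hk], w, h2, h1⟩⟩
  mul g h p := ⟨(g.1.1, g.1.2.1 + h.1.2.1, h.1.2.2), semidirect_mul_mem hT hDC g h p⟩
  r_unit _ := rfl
  s_unit _ := rfl
  r_inv _ := rfl
  s_inv _ := rfl
  r_mul _ _ _ := rfl
  s_mul _ _ _ := rfl
  mul_assoc g h k p q := Subtype.ext (by simp [add_assoc])
  unit_mul g := Subtype.ext (by simp)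
  mul_unit g := Subtype.ext (by simp)
  inv_mul g := Subtype.ext (by simp)
  mul_inv g := Subtype.ext (by simp)

end MGDS

/-! ### Higher rank graphs and their infinite paths -/

/-- A rank `r` graph with object set `V` and morphism set `Λ`: a small category with source `s`,
terminal `t`, product `λμ` for `s λ = t μ`, and a shape functor `σ` to `ℕ^r` having the unique
factorization property. -/
structure HigherRankGraph (r : ℕ) (V Λ : Type*) where
  t : Λ → V
  s : Λ → V
  id : V → Λ
  comp : (l m : Λ) → s l = t m → Λ
  σ : Λ → (Fin r → ℕ)
  t_id : ∀ v, t (id v) = v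
  s_id : ∀ v, s (id v) = v
  t_comp : ∀ l m (h : s l = t m), t (comp l m h) = t l
  s_comp : ∀ l m (h : s l = t m), s (comp l m h) = s m
  assoc : ∀ l m n (h : s l = t m) (k : s m = t n),
    comp (comp l m h) n ((s_comp l m h).trans k) = comp l (comp m n k) (h.trans (t_comp m n k).symm)
  id_comp : ∀ l, comp (id (t l)) l (s_id _) = l
  comp_id : ∀ l, comp l (id (s l)) (t_id _).symm = l
  σ_id : ∀ v, σ (id v) = 0
  σ_comp : ∀ l m (h : s l = t m), σ (comp l m h) = σ l + σ m
  factorization : ∀ (l : Λ) (a b : Fin r → ℕ), σ l = a + b →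
    ∃! p : Λ × Λ, σ p.1 = a ∧ σ p.2 = b ∧ ∃ h : s p.1 = t p.2, comp p.1 p.2 h = l

namespace HigherRankGraph

variable {r : ℕ} {V Λ : Type*} (Γ : HigherRankGraph r V Λ)

/-- The finiteness condition (F): for each shape there are finitely many, and at least one,
morphisms of that shape, and each object is the terminal and the source of some of them. -/
structure FinitenessCondition : Prop where
  finite : ∀ n, {l | Γ.σ l = n}.Finite
  nonempty : ∀ n, {l | Γ.σ l = n}.Nonempty
  exists_t : ∀ n v, ∃ l, Γ.σ l = n ∧ Γ.t l = v
  exists_s : ∀ n v, ∃ l, Γ.σ l = n ∧ Γ.s l = v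

/-- Infinite paths: shape preserving functors from `{(n, m) : n ≤ m}` to `Λ`. -/
@[ext]
structure InfPath where
  seg : (n m : Fin r → ℕ) → n ≤ m → Λ
  σ_seg : ∀ n m h, n + Γ.σ (seg n m h) = m
  seg_comp : ∀ n m k (h : n ≤ m) (h' : m ≤ k),
    ∃ e : Γ.s (seg n m h) = Γ.t (seg m k h'), Γ.comp (seg n m h) (seg m k h') e = seg n k (h.trans h')

namespace InfPath

variable {Γ}

/-- The initial segment `x(0, k)`. -/
def init (x : Γ.InfPath) (k : Fin r → ℕ) : Λ := x.seg 0 k zero_le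

/-- The terminal object of an infinite path. -/
def t (x : Γ.InfPath) : V := Γ.t (x.init 0)

/-- The shift `W_k`. -/
def shift (k : Fin r → ℕ) (x : Γ.InfPath) : Γ.InfPath where
  seg n m h := x.seg (n + k) (m + k) (add_le_add_left h k)
  σ_seg n m h := by
    have e := x.σ_seg (n + k) (m + k) (add_le_add_left h k)
    rw [add_right_comm] at e
    exact add_right_cancel e
  seg_comp n m p h h' := x.seg_comp _ _ _ _ _

/-- `z = l y`. -/
def IsPrepend (l : Λ) (y z : Γ.InfPath) : Prop := z.init (Γ.σ l) = l ∧ z.shift (Γ.σ l) = y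

instance : TopologicalSpace Γ.InfPath :=
  TopologicalSpace.generateFrom {A | ∃ (k : Fin r → ℕ) (l : Λ), A = {x | x.init k = l}}

end InfPath

/-! ### The C⋆-algebra of a higher rank graph -/

open FreeStarAlg in
/-- The Cuntz–Krieger relations; the object set is finite, and the sum of the vertex projections is
the unit. -/
def presentation : CStarPresentation Λ where
  rels := {a |
    (∃ v, a = gen (Γ.id v) - star (gen (Γ.id v))) ∨
    (∃ v, a = gen (Γ.id v) - gen (Γ.id v) * gen (Γ.id v)) ∨
    (∃ v w, v ≠ w ∧ a = gen (Γ.id v) * gen (Γ.id w)) ∨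
    (∃ l m h, a = gen (Γ.comp l m h) - gen l * gen m) ∨
    (∃ l, a = gen (Γ.id (Γ.s l)) - star (gen l) * gen l) ∨
    (∃ v n, a = gen (Γ.id v) -
      ∑ᶠ l : {l : Λ // Γ.t l = v ∧ Γ.σ l = n}, gen (l : Λ) * star (gen (l : Λ))) ∨
    a = 1 - ∑ᶠ v, gen (Γ.id v)}
  bound _ := 1

/-- The universal C⋆-algebra `C*(Λ)`. -/
abbrev CStar : Type _ := Γ.presentation.Universal

/-- The generators `s_λ` of `C*(Λ)`. -/
def gen (l : Λ) : Γ.CStar := Γ.presentation.ι l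

end HigherRankGraph

/-! ### The Toeplitz algebra and tensor products -/

/-- A single generator `S` with `S^* S = 1`. -/
def toeplitzPresentation : CStarPresentation PUnit where
  rels := {star (FreeStarAlg.gen PUnit.unit) * FreeStarAlg.gen PUnit.unit - 1}
  bound _ := 1

/-- The Toeplitz algebra `𝒯`, the universal C⋆-algebra generated by an isometry. -/
abbrev Toeplitz : Type _ := toeplitzPresentation.Universal

/-- The generating isometry of the Toeplitz algebra. -/
def Toeplitz.S : Toeplitz := toeplitzPresentation.ι PUnit.unit

section Tensor

variable {I : Type*} (A : I → Type*) [∀ i, CStarAlgebra (A i)]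

open FreeStarAlg in
/-- The relations satisfied by a family of commuting unital ⋆-homomorphisms on the `A i`. -/
def tensorPresentation : CStarPresentation (Σ i, A i) where
  rels := {x |
    (∃ i a b, x = gen ⟨i, a + b⟩ - (gen ⟨i, a⟩ + gen ⟨i, b⟩)) ∨
    (∃ i a, ∃ c : ℂ, x = gen ⟨i, c • a⟩ - c • gen ⟨i, a⟩) ∨
    (∃ i a b, x = gen ⟨i, a * b⟩ - gen ⟨i, a⟩ * gen ⟨i, b⟩) ∨
    (∃ i a, x = gen ⟨i, star a⟩ - star (gen ⟨i, a⟩)) ∨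
    (∃ i, x = gen ⟨i, 1⟩ - 1) ∨
    (∃ i j a b, i ≠ j ∧ x = gen ⟨i, a⟩ * gen ⟨j, b⟩ - gen ⟨j, b⟩ * gen ⟨i, a⟩)}
  bound a := ‖a.2‖₊

/-- The (maximal) tensor product of the unital C⋆-algebras `A i`, which is the only C⋆-tensor
product if the `A i` are nuclear. -/
abbrev CStarTensor : Type _ := (tensorPresentation A).Universal

/-- The elementary tensor with the entry `a` at `i` and `1` everywhere else. -/
def CStarTensor.incl (i : I) (a : A i) : CStarTensor A := (tensorPresentation A).ι ⟨i, a⟩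

end Tensor

namespace HigherRankGraph

universe u v

variable {r : ℕ} {V : Type v} {Λ : Type u} (Γ : HigherRankGraph r V Λ)

/-- The factors of `𝒯^{⊗r} ⊗ C*(Λ)`: a copy of `𝒯` for each `some j`, and `C*(Λ)` for `none`. -/
def tensorFactor : Option (Fin r) → Type u
  | none => Γ.CStar
  | some _ => Toeplitz.{u}

instance : ∀ i, CStarAlgebra (Γ.tensorFactor i)
  | none => inferInstanceAs (CStarAlgebra Γ.CStar)
  | some _ => inferInstanceAs (CStarAlgebra Toeplitz.{u})

/-- `𝒯^{⊗r} ⊗ C*(Λ)`. -/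
abbrev ToeplitzTensor : Type _ := CStarTensor Γ.tensorFactor

/-- `S_j ⊗ 1`. -/
def tensorS (j : Fin r) : Γ.ToeplitzTensor :=
  CStarTensor.incl Γ.tensorFactor (some j) (Toeplitz.S.{u})

/-- `1 ⊗ s_λ`. -/
def tensorGen (l : Λ) : Γ.ToeplitzTensor := CStarTensor.incl Γ.tensorFactor none (Γ.gen l)

end HigherRankGraph

/-! ### Partial permutation operators and diagonal operators on `ℓ²` -/

section Operators

variable {I : Type*}

open Classical in
/-- The coordinates of `∑_i ξ_i δ_{f(i)}` for a partially defined injective map `f` on `I`; the sum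
runs over the domain of `f`. -/
def partialIsometryFun (f : I → Option I) (ξ : I → ℂ) (k : I) : ℂ :=
  if h : ∃ i, f i = some k then ξ h.choose else 0

theorem partialIsometry_summable (f : I → Option I) (ξ : HilbertL2 I) :
    Summable (fun k => ‖partialIsometryFun f ξ k‖ ^ 2) ∧
      ∑' k, ‖partialIsometryFun f ξ k‖ ^ 2 ≤ ‖ξ‖ ^ 2 := by
  classical
  have hs : HasSum (fun i => ‖ξ i‖ ^ 2) (‖ξ‖ ^ 2) := by
    have h := lp.hasSum_norm (p := 2) (by norm_num) ξ
    simpa using h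
  have hle : ∀ u : Finset I, ∑ k ∈ u, ‖partialIsometryFun f ξ k‖ ^ 2 ≤ ‖ξ‖ ^ 2 := by
    intro u
    let g : I → I := fun k => if h : ∃ i, f i = some k then h.choose else k
    have hg : ∀ k, (∃ i, f i = some k) → f (g k) = some k := by
      intro k h
      simp only [g, dif_pos h]
      exact h.choose_spec
    let w := u.filter fun k => ∃ i, f i = some k
    have h1 : ∑ k ∈ u, ‖partialIsometryFun f ξ k‖ ^ 2 = ∑ k ∈ w, ‖ξ (g k)‖ ^ 2 := by
      rw [Finset.sum_filter]
      refine Finset.sum_congr rfl fun k _ => ?_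
      by_cases h : ∃ i, f i = some k
      · simp only [partialIsometryFun, g, dif_pos h, if_pos h]
      · simp only [partialIsometryFun, dif_neg h, if_neg h]; simp
    have hinj : Set.InjOn g w := by
      intro k hk k' hk' h
      have e1 := hg k (Finset.mem_filter.1 hk).2
      have e2 := hg k' (Finset.mem_filter.1 hk').2
      rw [h, e2] at e1
      exact (Option.some.inj e1).symm
    rw [h1, ← Finset.sum_image (f := fun i => ‖ξ i‖ ^ 2) hinj, ← hs.tsum_eq]
    exact hs.summable.sum_le_tsum _ fun i _ => by positivity
  have hsum := summable_of_sum_le (fun k => by positivity) hle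
  exact ⟨hsum, hsum.tsum_le_of_sum_le hle⟩

/-- The partial isometry of `ℓ²(I)` with `δ_i ↦ δ_{f(i)}`, and `δ_i ↦ 0` if `f` is not defined at
`i`, for a partially defined injective map `f` on `I`. -/
def partialIsometry (f : I → Option I) : HilbertL2 I →L[ℂ] HilbertL2 I :=
  LinearMap.mkContinuous
    { toFun := fun ξ => ⟨partialIsometryFun f ξ, by
        have h := (partialIsometry_summable f ξ).1
        refine memℓp_gen ?_
        simpa using h⟩
      map_add' := fun ξ η => by
        ext k
        change partialIsometryFun f _ k = partialIsometryFun f _ k + partialIsometryFun f _ k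
        by_cases h : ∃ i, f i = some k <;> simp [partialIsometryFun, h]
      map_smul' := fun c ξ => by
        ext k
        by_cases h : ∃ i, f i = some k <;> simp [partialIsometryFun, h] }
    1 fun ξ => by
      rw [one_mul]
      refine (sq_le_sq₀ (norm_nonneg _) (norm_nonneg _)).1 ?_
      refine le_trans (le_of_eq ?_) (partialIsometry_summable f ξ).2
      have h := lp.norm_rpow_eq_tsum (p := 2) (by norm_num)
        (⟨partialIsometryFun f ξ, by
          have h := (partialIsometry_summable f ξ).1
          refine memℓp_gen ?_
          simpa using h⟩ : HilbertL2 I)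
      simpa using h

theorem basisVec_apply_ne {i j : I} (h : i ≠ j) : (basisVec j : I → ℂ) i = 0 :=
  open Classical in lp.single_apply_ne 2 j _ h

theorem basisVec_apply_self (i : I) : (basisVec i : I → ℂ) i = 1 :=
  open Classical in lp.single_apply_self 2 i _

theorem inner_basisVec (i : I) (ξ : HilbertL2 I) : inner ℂ (basisVec i) ξ = ξ i := by
  classical
  unfold basisVec
  rw [lp.inner_single_left]
  simp

/-- A bounded operator on `ℓ²(I)` is diagonal. -/
def IsDiagonal (A : HilbertL2 I →L[ℂ] HilbertL2 I) : Prop :=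
  ∀ i j, i ≠ j → (A (basisVec j) : I → ℂ) i = 0

theorem IsDiagonal.apply_basisVec {A : HilbertL2 I →L[ℂ] HilbertL2 I} (hA : IsDiagonal A) (j : I) :
    A (basisVec j) = (A (basisVec j) : I → ℂ) j • basisVec j := by
  ext i
  by_cases h : i = j
  · subst h
    simp [basisVec_apply_self]
  · simp [hA i j h, basisVec_apply_ne h]

variable (I) in
/-- The algebra `ℓ^∞(I)` of diagonal operators on `ℓ²(I)`. -/
def diagonalOperators : StarSubalgebra ℂ (HilbertL2 I →L[ℂ] HilbertL2 I) where
  carrier := {A | IsDiagonal A}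
  mul_mem' {A B} hA hB i j h := by
    change (A (B (basisVec j)) : I → ℂ) i = 0
    rw [hB.apply_basisVec, map_smul]
    simp [hA i j h]
  add_mem' {A B} hA hB i j h := by
    simp [hA i j h, hB i j h]
  algebraMap_mem' c i j h := by
    simp [Algebra.algebraMap_eq_smul_one, basisVec_apply_ne h]
  star_mem' {A} hA i j h := by
    rw [← inner_basisVec, ContinuousLinearMap.star_eq_adjoint,
      ContinuousLinearMap.adjoint_inner_right, ← inner_conj_symm, inner_basisVec, hA j i h.symm]
    simp

end Operators

/-- The partial map whose value at `z` is the unique `w` with `Q z w`. -/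
def pfunOfGraph {Z : Type*} (Q : Z → Z → Prop) : Z →. Z :=
  fun z => ⟨∃! w, Q z w, fun h => h.choose⟩

/-! ### The Fock space of a higher rank graph and the space `X` -/

namespace HigherRankGraph

variable {r : ℕ} {V Λ : Type*} (Γ : HigherRankGraph r V Λ)

/-- The index set of the Fock space: the vacuum `Ω = none` and the morphisms of nonzero shape. -/
abbrev FockIndex : Type _ := Option {l : Λ // Γ.σ l ≠ 0}

open Classical in
/-- A morphism of nonzero shape as an element of the index set; the objects are sent to `Ω`. -/
def toFock (l : Λ) : Γ.FockIndex := if h : Γ.σ l ≠ 0 then some ⟨l, h⟩ else none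

open Classical in
/-- The partial map `μ ↦ λ μ`, with `λ Ω = λ`, and `v Ω = Ω` for an object `v`. -/
def leftMul (l : Λ) : Γ.FockIndex → Option Γ.FockIndex
  | none => some (Γ.toFock l)
  | some m => if h : Γ.s l = Γ.t m then some (Γ.toFock (Γ.comp l m h)) else none

open Classical in
/-- The partial map `μ ↦ μ λ`, with `Ω λ = λ`, and `Ω v = Ω` for an object `v`. -/
def rightMul (l : Λ) : Γ.FockIndex → Option Γ.FockIndex
  | none => some (Γ.toFock l)
  | some m => if h : Γ.s m = Γ.t l then some (Γ.toFock (Γ.comp m l h)) else none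

/-- The left creation operator `L_λ`. -/
def L (l : Λ) : HilbertL2 Γ.FockIndex →L[ℂ] HilbertL2 Γ.FockIndex := partialIsometry (Γ.leftMul l)

/-- The right creation operator `R_λ`. -/
def R (l : Λ) : HilbertL2 Γ.FockIndex →L[ℂ] HilbertL2 Γ.FockIndex := partialIsometry (Γ.rightMul l)

/-- The two-sided Toeplitz algebra `ℰ`. The projections `L_v`, `R_v` of the objects `v` may be
included among the generators: `L_v = L_λ^* L_λ` if `s(λ) = v`, and `R_v = R_λ^* R_λ` if
`t(λ) = v`. -/
def toeplitzTwoSided : StarSubalgebra ℂ (HilbertL2 Γ.FockIndex →L[ℂ] HilbertL2 Γ.FockIndex) :=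
  (StarAlgebra.adjoin ℂ (Set.range Γ.L ∪ Set.range Γ.R)).topologicalClosure

/-- The commutative algebra `ℰ ∩ ℓ^∞`. -/
def diagonalAlgebra : StarSubalgebra ℂ (HilbertL2 Γ.FockIndex →L[ℂ] HilbertL2 Γ.FockIndex) :=
  Γ.toeplitzTwoSided ⊓ diagonalOperators Γ.FockIndex

/-- The Gelfand spectrum `X` of `ℰ ∩ ℓ^∞`. -/
abbrev SpectrumX : Type _ := WeakDual.characterSpace ℂ Γ.diagonalAlgebra

/-- An element of the index set as a point of `X`: evaluation of diagonal operators at that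
element. -/
def point (m : Γ.FockIndex) : Γ.SpectrumX :=
  ⟨(innerSL ℂ (basisVec m)).comp
      ((ContinuousLinearMap.apply ℂ (HilbertL2 Γ.FockIndex) (basisVec m)).comp
        Γ.diagonalAlgebra.toSubalgebra.toSubmodule.subtypeL), by
    constructor
    · intro h
      have h1 := congrArg (fun F : WeakDual ℂ Γ.diagonalAlgebra => F 1) h
      change inner ℂ (basisVec m) (basisVec m) = (0 : ℂ) at h1
      rw [inner_basisVec, basisVec_apply_self] at h1
      exact one_ne_zero h1
    · intro A B
      change inner ℂ (basisVec m) (A.1 (B.1 (basisVec m))) =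
        inner ℂ (basisVec m) (A.1 (basisVec m)) * inner ℂ (basisVec m) (B.1 (basisVec m))
      have hB : IsDiagonal B.1 := B.2.2
      rw [hB.apply_basisVec m]
      simp only [map_smul, inner_smul_right, inner_basisVec, basisVec_apply_self]
      ring⟩

variable {Γ}

/-- `x` is in the domain of the partial homeomorphism of `X` induced by the partial isometry `A`:
the projection `A^* A` of `ℰ ∩ ℓ^∞` takes the value `1` at `x`. -/
def InDom (A : HilbertL2 Γ.FockIndex →L[ℂ] HilbertL2 Γ.FockIndex) (x : Γ.SpectrumX) : Prop :=
  ∃ p : Γ.diagonalAlgebra, (p : HilbertL2 Γ.FockIndex →L[ℂ] HilbertL2 Γ.FockIndex) = star A * A ∧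
    x p = 1

/-- The partial homeomorphism of `X` induced by the partial isometry `A` sends `x` to `z`:
`f(z) = (A^* f A)(x)` for all `f` in `C(X) = ℰ ∩ ℓ^∞`. -/
def Sends (A : HilbertL2 Γ.FockIndex →L[ℂ] HilbertL2 Γ.FockIndex) (x z : Γ.SpectrumX) : Prop :=
  InDom A x ∧ ∀ f : Γ.diagonalAlgebra, ∃ g : Γ.diagonalAlgebra,
    (g : HilbertL2 Γ.FockIndex →L[ℂ] HilbertL2 Γ.FockIndex) = star A * f * A ∧ z f = x g

variable (Γ)

/-- `Z`, the set of the pairs `(x, y)` in `X × Λ^∞` with `s(x) = t(y)`; here `Ω` is composable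
with every `y`. -/
def SpaceZ : Type _ := {p : Γ.SpectrumX × Γ.InfPath // InDom (Γ.R (Γ.id p.2.t)) p.1}

instance : TopologicalSpace Γ.SpaceZ :=
  inferInstanceAs (TopologicalSpace {p : Γ.SpectrumX × Γ.InfPath // InDom (Γ.R (Γ.id p.2.t)) p.1})

/-- `T_m(x, y) = (x', λ y)` where `x = x' λ` with `σ(λ) = m`. -/
def shiftT (m : Fin r → ℕ) : Γ.SpaceZ →. Γ.SpaceZ :=
  pfunOfGraph fun z w => ∃ l, Γ.σ l = m ∧ Sends (Γ.R l) w.1.1 z.1.1 ∧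
    InfPath.IsPrepend l z.1.2 w.1.2

/-- `V_m(x, y) = (x', W_m(y))` where `x y(0, m) = λ x'` with `σ(λ) = m`. -/
def shiftV (m : Fin r → ℕ) : Γ.SpaceZ →. Γ.SpaceZ :=
  pfunOfGraph fun z w => w.1.2 = z.1.2.shift m ∧ ∃ u : Γ.SpectrumX,
    Sends (Γ.R (z.1.2.init m)) z.1.1 u ∧ ∃ l, Γ.σ l = m ∧ Sends (Γ.L l) w.1.1 u

/-- The system `(T, V)` of rank `r + r` on `Z`. -/
def systemZ (n : Fin r ⊕ Fin r → ℕ) : Γ.SpaceZ →. Γ.SpaceZ :=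
  (Γ.shiftT fun j => n (Sum.inl j)).comp (Γ.shiftV fun j => n (Sum.inr j))

/-- The space `ℕ̄^r × Λ^∞`. -/
abbrev SpaceNL : Type _ := (Fin r → ℕ∞) × Γ.InfPath

/-- The system `S × W` of rank `r + r` on `ℕ̄^r × Λ^∞`. -/
def systemNL (n : Fin r ⊕ Fin r → ℕ) : Γ.SpaceNL →. Γ.SpaceNL := fun p =>
  ⟨∀ j, (n (Sum.inl j) : ℕ∞) ≤ p.1 j, fun _ =>
    (fun j => p.1 j - (n (Sum.inl j) : ℕ∞), p.2.shift fun j => n (Sum.inr j))⟩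

/-- `φ` extends the map `(μ, y) ↦ (σ(μ), μ y)`, with `σ(Ω) = 0` and `Ω y = y`, continuously from the
pairs in `Z` with `μ = Ω` or `μ` a morphism of nonzero shape to all of `Z`. -/
structure IsPhi (φ : Γ.SpaceZ → Γ.SpaceNL) : Prop where
  continuous : Continuous φ
  vacuum : ∀ (y : Γ.InfPath) (h : InDom (Γ.R (Γ.id y.t)) (Γ.point none)),
    φ ⟨(Γ.point none, y), h⟩ = (0, y)
  morphism : ∀ (m : {l : Λ // Γ.σ l ≠ 0}) (y : Γ.InfPath)
    (h : InDom (Γ.R (Γ.id y.t)) (Γ.point (some m))),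
    (∀ j, (φ ⟨(Γ.point (some m), y), h⟩).1 j = (Γ.σ m j : ℕ∞)) ∧
      InfPath.IsPrepend (m : Λ) y (φ ⟨(Γ.point (some m), y), h⟩).2

/-- The bisection `{((n + e_j, x), (e_j, 0), (n, x))}` of `G(ℕ̄^r × Λ^∞, S × W)`, whose
characteristic function is `S_j ⊗ 1`. -/
def bisectionS (j : Fin r) : Set (SemidirectGroupoid Γ.systemNL) :=
  {g | g.1.1.1 = g.1.2.2.1 + Pi.single j 1 ∧ g.1.1.2 = g.1.2.2.2 ∧
    g.1.2.1 = Pi.single (Sum.inl j) 1}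

/-- The bisection `{((n, λ x), (0, σ(λ)), (n, x))}` of `G(ℕ̄^r × Λ^∞, S × W)`, whose
characteristic function is `1 ⊗ s_λ`. -/
def bisectionGen (l : Λ) : Set (SemidirectGroupoid Γ.systemNL) :=
  {g | g.1.1.1 = g.1.2.2.1 ∧ InfPath.IsPrepend l g.1.2.2.2 g.1.1.2 ∧
    g.1.2.1 = Sum.elim (fun _ => 0) fun j => (Γ.σ l j : ℤ)}

end HigherRankGraph

end

/-! The Lemma. Bijectivity on range fibres turns the sum defining a convolution at `t` into the sum
at `φ t`, so `f ↦ f ∘ φ` is multiplicative (`IsMorphism.conv_comp`). Inversion exchanges range and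
source fibres, so `φ` is bijective on source fibres too and the I-norm does not increase
(`IsMorphism.INorm_comp_le`). The universal property then gives `C*(G₂) → C*(G₁)`, which is followed
by the regular representation of `G₁`; the latter is bounded by the I-norm because its matrix
satisfies the Schur test (`exists_regular`). For properness, let an ultrafilter have an image
converging to `y`. Properness of `φ₀` makes its ranges converge to some `x` over `r(y)`, and the
unique element over `y` with range `x` is the limit, since both range maps are local homeomorphisms
(`IsMorphism.isProperMap`).

The Proposition. A pair `(μ, y)` in `Z` is determined by `n = σ(μ)` and `z = μ y`, namely as `(z(0,
n), W_n z)`; this is `SpaceZ.ofPath`, and its range is dense in `Z`. In the coordinates `(n, z)` the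
map `φ` is an inclusion, `T_m` is the inverse of `n ↦ n + m`, and `V_m` is `z ↦ W_m z`. Once there
are continuous maps `phi`, `tau`, `nu` on `Z` with these values, all identities among them hold by
density. The map `phi` exists because the points of the compact space `ℕ̄^r × Λ^∞` are separated by
the conditions `k ≤ n_j` and `z(0, k) = l`, and each of these is the trace of a clopen subset of `Z`
(`exists_phi`). The clopen sets come from the domain and range projections of the creation
operators, which lie in `ℰ ∩ ℓ^∞`; finiteness of the set of morphisms of each shape is what keeps
the unions finite.

The structure `ShiftModel` records the properties of `τ` and `ν` over `φ` that both `Z` and `ℕ̄^r ×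
Λ^∞` share. They imply that `τ⁻¹ ν` is an MGDS with (DC), and that the map of semidirect product
groupoids over `φ` is bijective on range fibres (`isRangeFibreBijective_mapGroupoid`). These
groupoids are étale because (DC) forces their topology to be induced from `X × X` on each set of
elements with fixed exponents `m`, `n` (`semidirect_nhds_eq`). Properness of `φ` is automatic since
`Z` is compact.

For `Θ`, the elements `S^a S^{*b} s_p s_q^*` correspond to compact open bisections (`word`).
Convolution of characteristic functions of bisections is the product of the sets (`conv_indicator`),
so the Toeplitz, commutation and Cuntz–Krieger relations all become statements about composing
relations between points of `ℕ̄^r × Λ^∞`. -/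

noncomputable section

/-! ### The universal property -/

namespace FreeStarAlg

variable {X B : Type*} [CStarAlgebra B]

/-- The evaluation of ⋆-polynomials at the family `g` as a homomorphism of algebras. -/
def liftAlg (g : X → B) : FreeStarAlg X →ₐ[ℂ] B :=
  FreeAlgebra.lift ℂ (Sum.elim g fun x => star (g x))

theorem liftAlg_letter (g : X → B) (y : X ⊕ X) :
    liftAlg g (letter y) = Sum.elim g (fun x => star (g x)) y :=
  FreeAlgebra.lift_ι_apply _ y

/-- The ⋆-homomorphism which evaluates ⋆-polynomials at the family `g`. -/
def lift (g : X → B) : FreeStarAlg X →⋆ₐ[ℂ] B where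
  __ := liftAlg g
  map_star' a := by
    change liftAlg g (star a) = star (liftAlg g a)
    set π := liftAlg g with hπ
    refine induction (p := fun a => π (star a) = star (π a)) ?_ ?_ ?_ ?_ a
    · intro c
      have h : star (algebraMap ℂ (FreeStarAlg X) c) = algebraMap ℂ (FreeStarAlg X) (star c) :=
        (algebraMap_star_comm c).symm
      rw [h, AlgHom.commutes, AlgHom.commutes, algebraMap_star_comm]
    · intro y
      rw [star_letter, hπ, liftAlg_letter, liftAlg_letter]
      cases y <;> simp
    · intro a b h1 h2
      simp [h1, h2]
    · intro a b h1 h2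
      simp [h1, h2]

@[simp]
theorem lift_gen (g : X → B) (x : X) : lift g (gen x) = g x :=
  liftAlg_letter g (Sum.inl x)

end FreeStarAlg

namespace CStarPresentation

variable {X : Type*} (P : CStarPresentation X) {B : Type*} [CStarAlgebra B]

/-- A family in a C⋆-algebra which satisfies the relations and the bounds. -/
structure IsModel (g : X → B) : Prop where
  rel : ∀ a ∈ P.rels, FreeStarAlg.lift g a = 0
  norm_le : ∀ x, ‖g x‖ ≤ P.bound x

variable {P}

/-- The norm of `B` pulled back along the evaluation is an admissible C⋆-seminorm, and the norm of
`P.Pre` is the supremum of all of these. -/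
theorem IsModel.norm_lift_le {g : X → B} (hg : P.IsModel g) (a : P.Pre) :
    ‖FreeStarAlg.lift g a‖ ≤ ‖a‖ := by
  let p : Seminorm ℂ (FreeStarAlg X) :=
    (normSeminorm ℂ B).comp (FreeStarAlg.lift g).toAlgHom.toLinearMap
  have hp : P.Admissible p :=
    { mul_le := fun a b => by
        change ‖FreeStarAlg.lift g (a * b)‖ ≤ ‖FreeStarAlg.lift g a‖ * ‖FreeStarAlg.lift g b‖
        rw [map_mul]
        exact norm_mul_le _ _
      star_mul_self := fun a => by
        change ‖FreeStarAlg.lift g (star a * a)‖ =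
          ‖FreeStarAlg.lift g a‖ * ‖FreeStarAlg.lift g a‖
        rw [map_mul, map_star, CStarRing.norm_star_mul_self]
      rel := fun a ha => by
        change ‖FreeStarAlg.lift g a‖ = 0
        rw [hg.rel a ha, norm_zero]
      gen_le := fun x => by
        change ‖FreeStarAlg.lift g (FreeStarAlg.gen x)‖ ≤ _
        rw [FreeStarAlg.lift_gen]
        exact hg.norm_le x }
  exact le_norm hp a

theorem coe_star (a : P.Pre) : star (a : P.Universal) = ((star a : P.Pre) : P.Universal) :=
  UniformSpace.Completion.map_coe P.pre_isometry_star.uniformContinuous a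

/-- The evaluation at a family in a C⋆-algebra as a homomorphism on the seminormed ring `P.Pre`. -/
def preHom (P : CStarPresentation X) (g : X → B) : P.Pre →+* B :=
  (FreeStarAlg.lift g).toAlgHom.toRingHom

theorem IsModel.continuous_preHom {g : X → B} (hg : P.IsModel g) : Continuous (P.preHom g) :=
  AddMonoidHomClass.continuous_of_bound (P.preHom g) 1 fun a => by
    rw [one_mul]; exact hg.norm_lift_le a

/-- The ⋆-homomorphism on the universal C⋆-algebra which belongs to a model of the relations. -/
def lift {g : X → B} (hg : P.IsModel g) : P.Universal →⋆ₐ[ℂ] B :=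
  let π : P.Pre →+* B := P.preHom g
  have hπ : Continuous π := hg.continuous_preHom
  { UniformSpace.Completion.extensionHom π hπ with
    commutes' := fun c => by
      change UniformSpace.Completion.extensionHom π hπ ((algebraMap ℂ P.Pre c : P.Pre) : P.Universal)
        = _
      rw [UniformSpace.Completion.extensionHom_coe]
      exact (FreeStarAlg.lift g).toAlgHom.commutes c
    map_star' := fun a => by
      change UniformSpace.Completion.extensionHom π hπ (star a) =
        star (UniformSpace.Completion.extensionHom π hπ a)
      have hc : Continuous (UniformSpace.Completion.extensionHom π hπ) :=
        UniformSpace.Completion.continuous_extension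
      induction a using UniformSpace.Completion.induction_on with
      | hp => exact isClosed_eq (hc.comp continuous_star) (continuous_star.comp hc)
      | ih a =>
        rw [coe_star, UniformSpace.Completion.extensionHom_coe,
          UniformSpace.Completion.extensionHom_coe]
        exact map_star (FreeStarAlg.lift g) a }

@[simp]
theorem lift_eval {g : X → B} (hg : P.IsModel g) (a : FreeStarAlg X) :
    lift hg (P.eval a) = FreeStarAlg.lift g a :=
  UniformSpace.Completion.extensionHom_coe (P.preHom g) hg.continuous_preHom a

@[simp]
theorem lift_ι {g : X → B} (hg : P.IsModel g) (x : X) : lift hg (P.ι x) = g x := by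
  rw [ι, lift_eval, FreeStarAlg.lift_gen]

variable (P) in
/-- The canonical ⋆-homomorphism of the free ⋆-algebra to the universal C⋆-algebra. -/
def evalHom : FreeStarAlg X →⋆ₐ[ℂ] P.Universal where
  toFun := P.eval
  map_one' := UniformSpace.Completion.coe_one P.Pre
  map_mul' a b := UniformSpace.Completion.coe_mul (α := P.Pre) a b
  map_zero' := UniformSpace.Completion.coe_zero (α := P.Pre)
  map_add' a b := UniformSpace.Completion.coe_add (α := P.Pre) a b
  commutes' _ := rfl
  map_star' a := (coe_star (P := P) a).symm

theorem eval_eq_zero {a : FreeStarAlg X} (ha : a ∈ P.rels) : P.eval a = 0 := by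
  have h : ‖P.eval a‖ ≤ 0 := by
    refine (UniformSpace.Completion.norm_coe (E := P.Pre) a).trans_le ?_
    exact norm_le fun p hp => (hp.rel a ha).le
  exact norm_le_zero_iff.1 h

theorem norm_ι_le (x : X) : ‖P.ι x‖ ≤ P.bound x :=
  (UniformSpace.Completion.norm_coe (E := P.Pre) (FreeStarAlg.gen x)).trans_le
    (norm_le fun _ hp => hp.gen_le x)

/-- Two ⋆-homomorphisms that agree on the letters. Consequently `P.ι` is itself a model, and this is
how relations inside the universal algebra are extracted later. -/
theorem eval_eq_lift (a : FreeStarAlg X) : P.eval a = FreeStarAlg.lift P.ι a := by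
  have h : ∀ a, P.evalHom a = FreeStarAlg.lift P.ι a := by
    intro a
    refine FreeStarAlg.induction (p := fun a => P.evalHom a = FreeStarAlg.lift P.ι a)
      ?_ ?_ ?_ ?_ a
    · intro c
      rw [AlgHomClass.commutes, AlgHomClass.commutes]
    · rintro (x | x)
      · exact (FreeStarAlg.lift_gen P.ι x).symm
      · have hx : FreeStarAlg.letter (Sum.inr x) = star (FreeStarAlg.gen x) :=
          (FreeStarAlg.star_letter (Sum.inl x)).symm
        rw [hx, map_star, map_star, FreeStarAlg.lift_gen]
        rfl
    · intro a b h1 h2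
      rw [map_mul, map_mul, h1, h2]
    · intro a b h1 h2
      rw [map_add, map_add, h1, h2]
  exact h a

variable (P) in
theorem isModel_ι : P.IsModel P.ι where
  rel a ha := by rw [← eval_eq_lift, eval_eq_zero ha]
  norm_le := norm_ι_le

/-- An element which commutes with the images of the generators and of their adjoints commutes with
the image of the universal C⋆-algebra. -/
theorem commute_lift {g : X → B} (hg : P.IsModel g) {c : B} (h1 : ∀ x, Commute c (g x))
    (h2 : ∀ x, Commute c (star (g x))) (a : P.Universal) : Commute c (lift hg a) := by
  have hc : Continuous (lift hg) := UniformSpace.Completion.continuous_extension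
  induction a using UniformSpace.Completion.induction_on with
  | hp => exact isClosed_eq (continuous_const.mul hc) (hc.mul continuous_const)
  | ih a =>
    suffices h : ∀ a : FreeStarAlg X, Commute c (FreeStarAlg.lift g a) by
      have := lift_eval hg a
      exact this ▸ h a
    intro a
    refine FreeStarAlg.induction (p := fun a => Commute c (FreeStarAlg.lift g a)) ?_ ?_ ?_ ?_ a
    · intro z
      rw [AlgHomClass.commutes]
      exact (Algebra.commute_algebraMap_left z c).symm
    · rintro (x | x)
      · have : FreeStarAlg.lift g (FreeStarAlg.letter (Sum.inl x)) = g x :=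
          FreeStarAlg.lift_gen g x
        rw [this]; exact h1 x
      · have hx : FreeStarAlg.letter (Sum.inr x) = star (FreeStarAlg.gen x) :=
          (FreeStarAlg.star_letter (Sum.inl x)).symm
        rw [hx, map_star, FreeStarAlg.lift_gen]
        exact h2 x
    · intro a b ha hb
      rw [map_mul]; exact ha.mul_right hb
    · intro a b ha hb
      rw [map_add]; exact ha.add_right hb

end CStarPresentation

/-- A non-unital C⋆-algebra with a two-sided unit is a C⋆-algebra. -/
abbrev CStarAlgebra.ofUnit {B : Type*} [hB : NonUnitalCStarAlgebra B] (e : B)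
    (h1 : ∀ b, e * b = b) (h2 : ∀ b, b * e = b) : CStarAlgebra B :=
  letI : Ring B := { hB with one := e, one_mul := h1, mul_one := h2 }
  letI : NormedRing B :=
    { hB, (inferInstance : Ring B) with
      norm_mul_le := norm_mul_le (α := B) }
  letI : Algebra ℂ B := Algebra.ofModule smul_mul_assoc mul_smul_comm
  { hB, (inferInstance : NormedRing B), (inferInstance : Algebra ℂ B) with
    norm_smul_le := fun c b => norm_smul_le c b }


/-! ### Bounded operators given by kernels -/

/-- The Schur test for kernels with finite rows. -/
theorem exists_operator_of_kernel {I : Type*} (k : I → I → ℂ) {C : ℝ} (hC : 0 ≤ C)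
    (hfin : ∀ t, (Function.support (k t)).Finite)
    (hrow : ∀ t (F : Finset I), ∑ u ∈ F, ‖k t u‖ ≤ C)
    (hcol : ∀ u (F : Finset I), ∑ t ∈ F, ‖k t u‖ ≤ C) :
    ∃ A : HilbertL2 I →L[ℂ] HilbertL2 I, ‖A‖ ≤ C ∧
      ∀ (ξ : HilbertL2 I) t, (A ξ : I → ℂ) t = ∑ᶠ u, k t u * ξ u := by
  classical
  have hval : ∀ (ξ : I → ℂ) t (F : Finset I), (hfin t).toFinset ⊆ F →
      ∑ᶠ u, k t u * ξ u = ∑ u ∈ F, k t u * ξ u := by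
    intro ξ t F hF
    refine finsum_eq_sum_of_support_subset _ fun u hu => hF ?_
    rw [Set.Finite.mem_toFinset]
    intro h
    exact hu (by simp [h])
  have hbound : ∀ (ξ : HilbertL2 I) (s : Finset I),
      ∑ t ∈ s, ‖∑ᶠ u, k t u * ξ u‖ ^ 2 ≤ (C * ‖ξ‖) ^ 2 := by
    intro ξ s
    -- One finite set that contains the supports of all rows in `s`, so that the two summations can
    -- be interchanged.
    let F : Finset I := s.biUnion fun t => (hfin t).toFinset
    have h1 : ∀ t ∈ s, ‖∑ᶠ u, k t u * ξ u‖ ^ 2 ≤ C * ∑ u ∈ F, ‖k t u‖ * ‖ξ u‖ ^ 2 := by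
      intro t ht
      rw [hval ξ t F (Finset.subset_biUnion_of_mem (fun t => (hfin t).toFinset) ht)]
      calc ‖∑ u ∈ F, k t u * ξ u‖ ^ 2 ≤ (∑ u ∈ F, ‖k t u‖ * ‖ξ u‖) ^ 2 := by
            refine pow_le_pow_left₀ (norm_nonneg _) ?_ 2
            exact (norm_sum_le _ _).trans_eq (Finset.sum_congr rfl fun u _ => norm_mul _ _)
        -- Cauchy–Schwarz with `‖k t u‖` split into two square roots: one factor is absorbed by the
        -- row bound here, the other by the column bound after the interchange of sums.
        _ ≤ (∑ u ∈ F, ‖k t u‖) * ∑ u ∈ F, ‖k t u‖ * ‖ξ u‖ ^ 2 :=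
            Finset.sum_sq_le_sum_mul_sum_of_sq_le_mul _ (fun u _ => norm_nonneg _)
              (fun u _ => by positivity) (fun u _ => le_of_eq (by ring))
        _ ≤ C * ∑ u ∈ F, ‖k t u‖ * ‖ξ u‖ ^ 2 :=
            mul_le_mul_of_nonneg_right (hrow t F) (Finset.sum_nonneg fun u _ => by positivity)
    have h2 : ∑ u ∈ F, ‖ξ u‖ ^ 2 ≤ ‖ξ‖ ^ 2 := by
      have h := lp.sum_rpow_le_norm_rpow (p := 2) (by norm_num) ξ F
      simpa using h
    calc ∑ t ∈ s, ‖∑ᶠ u, k t u * ξ u‖ ^ 2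
        ≤ ∑ t ∈ s, C * ∑ u ∈ F, ‖k t u‖ * ‖ξ u‖ ^ 2 := Finset.sum_le_sum h1
      _ = C * ∑ u ∈ F, (∑ t ∈ s, ‖k t u‖) * ‖ξ u‖ ^ 2 := by
          rw [← Finset.mul_sum, Finset.sum_comm]
          simp_rw [Finset.sum_mul]
      _ ≤ C * ∑ u ∈ F, C * ‖ξ u‖ ^ 2 :=
          mul_le_mul_of_nonneg_left (Finset.sum_le_sum fun u _ =>
            mul_le_mul_of_nonneg_right (hcol u s) (by positivity)) hC
      _ = C * (C * ∑ u ∈ F, ‖ξ u‖ ^ 2) := by rw [← Finset.mul_sum]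
      _ ≤ C * (C * ‖ξ‖ ^ 2) :=
          mul_le_mul_of_nonneg_left (mul_le_mul_of_nonneg_left h2 hC) hC
      _ = (C * ‖ξ‖) ^ 2 := by ring
  have hmem : ∀ ξ : HilbertL2 I, Memℓp (fun t => ∑ᶠ u, k t u * ξ u) 2 := fun ξ =>
    memℓp_gen' (C := (C * ‖ξ‖) ^ 2) fun s => by simpa using hbound ξ s
  refine ⟨LinearMap.mkContinuous
    { toFun := fun ξ => ⟨fun t => ∑ᶠ u, k t u * ξ u, hmem ξ⟩
      map_add' := fun ξ η => ?_
      map_smul' := fun c ξ => ?_ } C fun ξ => ?_, LinearMap.mkContinuous_norm_le _ hC _,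
    fun ξ t => rfl⟩
  · ext t
    change ∑ᶠ u, k t u * (ξ + η : HilbertL2 I) u = (∑ᶠ u, k t u * ξ u) + ∑ᶠ u, k t u * η u
    rw [hval _ t _ subset_rfl, hval _ t _ subset_rfl, hval _ t _ subset_rfl,
      ← Finset.sum_add_distrib]
    exact Finset.sum_congr rfl fun u _ => by simp [mul_add]
  · ext t
    change ∑ᶠ u, k t u * (c • ξ : HilbertL2 I) u = c * ∑ᶠ u, k t u * ξ u
    rw [hval _ t _ subset_rfl, hval _ t _ subset_rfl, Finset.mul_sum]
    exact Finset.sum_congr rfl fun u _ => by simp; ring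
  · refine lp.norm_le_of_forall_sum_le (by norm_num) (by positivity) fun s => ?_
    simpa using hbound ξ s

/-- Bounded operators on `ℓ²(I)` which have the same matrix agree. -/
theorem HilbertL2.ext_matrix {I : Type*} {A B : HilbertL2 I →L[ℂ] HilbertL2 I}
    (h : ∀ u t, (A (basisVec u) : I → ℂ) t = (B (basisVec u) : I → ℂ) t) : A = B := by
  classical
  have hb : ∀ u, A (basisVec u) = B (basisVec u) := fun u => by ext t; exact h u t
  ext1 ξ
  have hs := lp.hasSum_single (p := 2) (by norm_num) ξ
  have key : ∀ u, A (lp.single 2 u (ξ u)) = B (lp.single 2 u (ξ u)) := by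
    intro u
    have : (lp.single 2 u (ξ u) : HilbertL2 I) = ξ u • basisVec u := by
      unfold basisVec
      rw [← lp.single_smul, smul_eq_mul, mul_one]
    rw [this, map_smul, map_smul, hb]
  have hA := A.hasSum hs
  have hB := B.hasSum hs
  exact hA.unique (by simpa only [key] using hB)

theorem apply_basisVec_eq_conj {I : Type*} (A : HilbertL2 I →L[ℂ] HilbertL2 I) (u t : I) :
    (star A (basisVec u) : I → ℂ) t = conj ((A (basisVec t) : I → ℂ) u) := by
  rw [← inner_basisVec, ContinuousLinearMap.star_eq_adjoint,
    ContinuousLinearMap.adjoint_inner_right, ← inner_conj_symm, inner_basisVec]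

/-! ### Finite fibres -/

section Fibres

variable {G X : Type*} [TopologicalSpace G] [TopologicalSpace X]

/-- The source of a chart meets each fibre at most once, so `N = 1` works near every point; a
compact set is covered by finitely many charts. -/
theorem IsLocalHomeomorph.exists_card_fibre_le {ρ : G → X} (hρ : IsLocalHomeomorph ρ) {K : Set G}
    (hK : IsCompact K) :
    ∃ N : ℕ, ∀ x, ∃ F : Finset G, F.card ≤ N ∧ ∀ g ∈ K, ρ g = x → g ∈ F := by
  classical
  refine hK.induction_on (p := fun K => ∃ N : ℕ, ∀ x, ∃ F : Finset G, F.card ≤ N ∧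
    ∀ g ∈ K, ρ g = x → g ∈ F) ?_ ?_ ?_ ?_
  · exact ⟨0, fun x => ⟨∅, by simp, by simp⟩⟩
  · rintro s t hst ⟨N, hN⟩
    refine ⟨N, fun x => ?_⟩
    obtain ⟨F, h1, h2⟩ := hN x
    exact ⟨F, h1, fun g hg => h2 g (hst hg)⟩
  · rintro s t ⟨N, hN⟩ ⟨M, hM⟩
    refine ⟨N + M, fun x => ?_⟩
    obtain ⟨F, h1, h2⟩ := hN x
    obtain ⟨F', h1', h2'⟩ := hM x
    refine ⟨F ∪ F', (Finset.card_union_le _ _).trans (add_le_add h1 h1'), ?_⟩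
    rintro g (hg | hg) hx
    · exact Finset.mem_union_left _ (h2 g hg hx)
    · exact Finset.mem_union_right _ (h2' g hg hx)
  · intro g _
    obtain ⟨e, hge, rfl⟩ := hρ g
    refine ⟨e.source, mem_nhdsWithin_of_mem_nhds (e.open_source.mem_nhds hge), 1, fun x => ?_⟩
    by_cases hx : ∃ h ∈ e.source, e h = x
    · obtain ⟨h, hh, rfl⟩ := hx
      refine ⟨{h}, by simp, fun g' hg' heq => ?_⟩
      rw [Finset.mem_singleton]
      exact e.injOn hg' hh heq
    · exact ⟨∅, by simp, fun g' hg' heq => absurd ⟨g', hg', heq⟩ hx⟩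

theorem CompactlySupportedContinuousMap.finite_fibre_support {ρ : G → X}
    (hρ : IsLocalHomeomorph ρ) (f : C_c(G, ℂ)) (x : X) :
    {g | ρ g = x ∧ f g ≠ 0}.Finite := by
  obtain ⟨N, hN⟩ := hρ.exists_card_fibre_le f.hasCompactSupport
  obtain ⟨F, -, hF⟩ := hN x
  exact F.finite_toSet.subset fun g hg => hF g (subset_tsupport _ hg.2) hg.1

/-- An unbounded supremum in `ℝ≥0` has the default value `0`, so this bound is needed before the
I-norm can be said to dominate the individual fibre sums. -/
theorem CompactlySupportedContinuousMap.bddAbove_fibre_sum {ρ : G → X}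
    (hρ : IsLocalHomeomorph ρ) (f : C_c(G, ℂ)) :
    BddAbove (Set.range fun x : X => ∑ᶠ g : {g : G // ρ g = x}, ‖f g‖₊) := by
  classical
  obtain ⟨N, hN⟩ := hρ.exists_card_fibre_le f.hasCompactSupport
  obtain ⟨C, hC⟩ := f.hasCompactSupport.exists_bound_of_continuous f.continuous
  refine ⟨N * C.toNNReal, ?_⟩
  rintro _ ⟨x, rfl⟩
  obtain ⟨F, hF1, hF2⟩ := hN x
  have hsub : Function.support (fun g : {g : G // ρ g = x} => ‖f g‖₊) ⊆
      (F.subtype fun g => ρ g = x) := by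
    intro g hg
    have hg' : f g ≠ 0 := by simpa using hg
    simpa using hF2 g (subset_tsupport _ hg') g.2
  change ∑ᶠ g : {g : G // ρ g = x}, ‖f g‖₊ ≤ _
  rw [finsum_eq_sum_of_support_subset _ hsub]
  refine (Finset.sum_le_card_nsmul _ _ C.toNNReal fun g _ => ?_).trans ?_
  · exact NNReal.le_toNNReal_of_coe_le (hC g)
  · rw [nsmul_eq_mul]
    gcongr
    rw [Finset.card_subtype]
    exact (Finset.card_filter_le _ _).trans hF1

end Fibres

/-! ### Groupoid algebra and the matrix of the regular representation -/

namespace GroupoidStr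

section Algebra

variable {G X : Type*} (𝒢 : GroupoidStr G X)

/-- The proof of composability depends on the factors and obstructs rewriting inside a product; this
takes the place of such rewriting. -/
theorem mul_congr {g g' h h' : G} (hg : g = g') (hh : h = h') (p : 𝒢.s g = 𝒢.r h)
    (p' : 𝒢.s g' = 𝒢.r h') : 𝒢.mul g h p = 𝒢.mul g' h' p' := by
  subst hg hh; rfl

theorem unit_mul_of_eq {x : X} {h : G} (p : 𝒢.s (𝒢.unit x) = 𝒢.r h) :
    𝒢.mul (𝒢.unit x) h p = h := by
  obtain rfl : x = 𝒢.r h := (𝒢.s_unit x).symm.trans p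
  exact 𝒢.unit_mul h

theorem mul_unit_of_eq {x : X} {h : G} (p : 𝒢.s h = 𝒢.r (𝒢.unit x)) :
    𝒢.mul h (𝒢.unit x) p = h := by
  obtain rfl : x = 𝒢.s h := (𝒢.r_unit x).symm.trans p.symm
  exact 𝒢.mul_unit h

theorem inv_mul_cancel_left {g h : G} (p : 𝒢.s g = 𝒢.r h)
    (q : 𝒢.s (𝒢.inv g) = 𝒢.r (𝒢.mul g h p)) : 𝒢.mul (𝒢.inv g) (𝒢.mul g h p) q = h := by
  rw [← 𝒢.mul_assoc (𝒢.inv g) g h (𝒢.s_inv g) p,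
    𝒢.mul_congr (𝒢.inv_mul g) rfl _ ((𝒢.s_unit _).trans p)]
  exact 𝒢.unit_mul_of_eq _

theorem mul_inv_cancel_left {h t : G} (p : 𝒢.s (𝒢.inv h) = 𝒢.r t)
    (q : 𝒢.s h = 𝒢.r (𝒢.mul (𝒢.inv h) t p)) : 𝒢.mul h (𝒢.mul (𝒢.inv h) t p) q = t := by
  rw [← 𝒢.mul_assoc h (𝒢.inv h) t (𝒢.r_inv h).symm p,
    𝒢.mul_congr (𝒢.mul_inv h) rfl _ ((𝒢.s_unit _).trans ((𝒢.s_inv h).symm.trans p))]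
  exact 𝒢.unit_mul_of_eq _

theorem eq_inv_of_mul {g h : G} (p : 𝒢.s g = 𝒢.r h) (e : 𝒢.mul g h p = 𝒢.unit (𝒢.r g)) :
    h = 𝒢.inv g := by
  have h1 := 𝒢.inv_mul_cancel_left p ((𝒢.s_inv g).trans (𝒢.r_mul g h p).symm)
  rw [← h1, 𝒢.mul_congr rfl e _ ((𝒢.s_inv g).trans (𝒢.r_unit _).symm)]
  exact 𝒢.mul_unit_of_eq _

theorem eq_unit_of_mul {g h : G} (p : 𝒢.s g = 𝒢.r h) (e : 𝒢.mul g h p = g) :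
    h = 𝒢.unit (𝒢.s g) := by
  have h1 := 𝒢.inv_mul_cancel_left p ((𝒢.s_inv g).trans (𝒢.r_mul g h p).symm)
  rw [← h1, 𝒢.mul_congr rfl e _ (𝒢.s_inv g), 𝒢.inv_mul]

theorem inv_inv (g : G) : 𝒢.inv (𝒢.inv g) = g := by
  refine (𝒢.eq_inv_of_mul (𝒢.s_inv g) ?_).symm
  rw [𝒢.inv_mul, 𝒢.r_inv]

theorem inv_mul_rev {g h : G} (p : 𝒢.s g = 𝒢.r h) (q : 𝒢.s (𝒢.inv h) = 𝒢.r (𝒢.inv g)) :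
    𝒢.inv (𝒢.mul g h p) = 𝒢.mul (𝒢.inv h) (𝒢.inv g) q := by
  refine (𝒢.eq_inv_of_mul ((𝒢.s_mul g h p).trans ((𝒢.r_inv h).symm.trans
    (𝒢.r_mul _ _ q).symm)) ?_).symm
  rw [𝒢.mul_assoc g h _ p ((𝒢.r_inv h).symm.trans (𝒢.r_mul _ _ q).symm),
    𝒢.mul_congr rfl (𝒢.mul_inv_cancel_left (h := h) (t := 𝒢.inv g) q _) _ (𝒢.r_inv g).symm,
    𝒢.mul_inv, 𝒢.r_mul]

/-- The elements `u` with the source of `t` correspond to the elements `t u⁻¹` with the range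
of `t`. -/
def divEquiv (t : G) : {u : G // 𝒢.s t = 𝒢.s u} ≃ {h : G // 𝒢.r h = 𝒢.r t} where
  toFun u := ⟨𝒢.mul t (𝒢.inv u) (u.2.trans (𝒢.r_inv _).symm), 𝒢.r_mul _ _ _⟩
  invFun h := ⟨𝒢.mul (𝒢.inv h) t ((𝒢.s_inv _).trans h.2), (𝒢.s_mul _ _ _).symm⟩
  left_inv u := Subtype.ext <| by
    have h1 := 𝒢.inv_mul_rev (u.2.trans (𝒢.r_inv u.1).symm)
      ((𝒢.s_inv _).trans ((𝒢.r_inv u.1).trans (u.2.symm.trans (𝒢.r_inv t).symm)))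
    have q : 𝒢.s u.1 = 𝒢.r (𝒢.inv t) := u.2.symm.trans (𝒢.r_inv t).symm
    change 𝒢.mul (𝒢.inv (𝒢.mul t (𝒢.inv u.1) _)) t _ = u.1
    rw [𝒢.mul_congr (h1.trans (𝒢.mul_congr (𝒢.inv_inv u.1) rfl _ q)) rfl _
        ((𝒢.s_mul _ _ q).trans (𝒢.s_inv t)),
      𝒢.mul_assoc _ _ _ q (𝒢.s_inv t),
      𝒢.mul_congr rfl (𝒢.inv_mul t) _ (u.2.symm.trans (𝒢.r_unit _).symm)]
    exact 𝒢.mul_unit_of_eq _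
  right_inv h := Subtype.ext <| by
    have p : 𝒢.s (𝒢.inv h.1) = 𝒢.r t := (𝒢.s_inv _).trans h.2
    have q : 𝒢.s (𝒢.inv t) = 𝒢.r h.1 := (𝒢.s_inv t).trans h.2.symm
    have h1 : 𝒢.inv (𝒢.mul (𝒢.inv h.1) t p) = 𝒢.mul (𝒢.inv t) h.1 q :=
      (𝒢.inv_mul_rev p (q.trans (congrArg 𝒢.r (𝒢.inv_inv h.1).symm))).trans
        (𝒢.mul_congr rfl (𝒢.inv_inv h.1) _ _)
    change 𝒢.mul t (𝒢.inv (𝒢.mul (𝒢.inv h.1) t p)) _ = h.1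
    rw [𝒢.mul_congr rfl h1 _ ((𝒢.r_inv t).symm.trans (𝒢.r_mul _ _ q).symm)]
    exact 𝒢.mul_inv_cancel_left q _

/-- The elements `t` with the source of `u` correspond to the elements `t u⁻¹` whose source is the
range of `u`. -/
def divEquiv' (u : G) : {t : G // 𝒢.s t = 𝒢.s u} ≃ {h : G // 𝒢.s h = 𝒢.r u} where
  toFun t := ⟨𝒢.mul t (𝒢.inv u) (t.2.trans (𝒢.r_inv _).symm), (𝒢.s_mul _ _ _).trans (𝒢.s_inv u)⟩
  invFun h := ⟨𝒢.mul h u h.2, 𝒢.s_mul _ _ _⟩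
  left_inv t := Subtype.ext <| by
    change 𝒢.mul (𝒢.mul t.1 (𝒢.inv u) _) u _ = t.1
    rw [𝒢.mul_assoc _ _ _ (t.2.trans (𝒢.r_inv _).symm) (𝒢.s_inv u),
      𝒢.mul_congr rfl (𝒢.inv_mul u) _ (t.2.trans (𝒢.r_unit _).symm)]
    exact 𝒢.mul_unit_of_eq _
  right_inv h := Subtype.ext <| by
    change 𝒢.mul (𝒢.mul h.1 u _) (𝒢.inv u) _ = h.1
    rw [𝒢.mul_assoc _ _ _ h.2 (𝒢.r_inv u).symm,
      𝒢.mul_congr rfl (𝒢.mul_inv u) _ (h.2.trans (𝒢.r_unit _).symm)]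
    exact 𝒢.mul_unit_of_eq _

open Classical in
/-- The matrix of the image of `f` in the regular representation. -/
def kernel (f : G → ℂ) (t u : G) : ℂ :=
  if h : 𝒢.s t = 𝒢.s u then f (𝒢.mul t (𝒢.inv u) (h.trans (𝒢.r_inv u).symm)) else 0

theorem kernel_pos (f : G → ℂ) {t u : G} (h : 𝒢.s t = 𝒢.s u) :
    𝒢.kernel f t u = f (𝒢.mul t (𝒢.inv u) (h.trans (𝒢.r_inv u).symm)) := dif_pos h

theorem kernel_neg (f : G → ℂ) {t u : G} (h : 𝒢.s t ≠ 𝒢.s u) : 𝒢.kernel f t u = 0 := dif_neg h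

theorem finsum_eq_finsum_subtype {α M : Type*} [AddCommMonoid M] {p : α → Prop} {F : α → M}
    (hF : ∀ a, ¬ p a → F a = 0) : ∑ᶠ a, F a = ∑ᶠ a : Subtype p, F a := by
  classical
  rw [finsum_subtype_eq_finsum_cond]
  refine finsum_congr fun a => ?_
  by_cases h : p a
  · simp [h]
  · simp [h, hF a h]

/-- The substitution `h = t u⁻¹`. It makes the rows of the matrix into range fibres and, in
`finsum_column`, the columns into source fibres, so that the two halves of the I-norm are exactly
the two bounds of the Schur test. -/
theorem finsum_row {M : Type*} [AddCommMonoid M] (t : G) {F : G → M} {H : G → M}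
    (hF : ∀ u, 𝒢.s t ≠ 𝒢.s u → F u = 0)
    (hH : ∀ u (h : 𝒢.s t = 𝒢.s u), F u = H (𝒢.mul t (𝒢.inv u) (h.trans (𝒢.r_inv u).symm))) :
    ∑ᶠ u, F u = ∑ᶠ h : {h : G // 𝒢.r h = 𝒢.r t}, H h := by
  rw [finsum_eq_finsum_subtype hF]
  exact finsum_eq_of_bijective _ (𝒢.divEquiv t).bijective fun u => hH u.1 u.2

theorem finsum_column {M : Type*} [AddCommMonoid M] (u : G) {F : G → M} {H : G → M}
    (hF : ∀ t, 𝒢.s t ≠ 𝒢.s u → F t = 0)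
    (hH : ∀ t (h : 𝒢.s t = 𝒢.s u), F t = H (𝒢.mul t (𝒢.inv u) (h.trans (𝒢.r_inv u).symm))) :
    ∑ᶠ t, F t = ∑ᶠ h : {h : G // 𝒢.s h = 𝒢.r u}, H h := by
  rw [finsum_eq_finsum_subtype hF]
  exact finsum_eq_of_bijective _ (𝒢.divEquiv' u).bijective fun t => hH t.1 t.2

/-- With `k = t v⁻¹` one has `k⁻¹ (t u⁻¹) = v u⁻¹`, so the convolution sum is the matrix product. -/
theorem kernel_conv (f g : G → ℂ) (t u : G) :
    𝒢.kernel (𝒢.conv f g) t u = ∑ᶠ v, 𝒢.kernel f t v * 𝒢.kernel g v u := by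
  by_cases h : 𝒢.s t = 𝒢.s u
  · rw [𝒢.kernel_pos _ h, conv]
    set w := 𝒢.mul t (𝒢.inv u) (h.trans (𝒢.r_inv u).symm) with hw
    have hr : 𝒢.r w = 𝒢.r t := 𝒢.r_mul _ _ _
    classical
    -- The product is defined only on the range fibre of `t`; outside it `H` is extended by zero to
    -- suit `finsum_row`.
    let H : G → ℂ := fun k => if p : 𝒢.r k = 𝒢.r t then
      f k * g (𝒢.mul (𝒢.inv k) w ((𝒢.s_inv k).trans (p.trans hr.symm))) else 0
    rw [𝒢.finsum_row t (F := fun v => 𝒢.kernel f t v * 𝒢.kernel g v u) (H := H)]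
    · refine finsum_eq_of_bijective
        (fun k : {k // 𝒢.r k = 𝒢.r w} => (⟨k.1, k.2.trans hr⟩ : {k // 𝒢.r k = 𝒢.r t})) ?_ ?_
      · constructor
        · intro a b hab
          exact Subtype.ext (congrArg Subtype.val hab :)
        · intro b
          exact ⟨⟨b.1, b.2.trans hr.symm⟩, rfl⟩
      · intro k
        simp only [H, dif_pos (k.2.trans hr)]
    · intro v hv
      rw [𝒢.kernel_neg f hv, zero_mul]
    · intro v hv
      have hr' : 𝒢.r (𝒢.mul t (𝒢.inv v) (hv.trans (𝒢.r_inv v).symm)) = 𝒢.r t := 𝒢.r_mul _ _ _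
      simp only [H, dif_pos hr']
      rw [𝒢.kernel_pos f hv, 𝒢.kernel_pos g (hv.symm.trans h)]
      congr 2
      set k := 𝒢.mul t (𝒢.inv v) (hv.trans (𝒢.r_inv v).symm) with hk
      have hp : 𝒢.s (𝒢.inv k) = 𝒢.r t := (𝒢.s_inv k).trans hr'
      have hl : 𝒢.mul (𝒢.inv k) t hp = v :=
        congrArg Subtype.val ((𝒢.divEquiv t).left_inv ⟨v, hv⟩)
      rw [𝒢.mul_congr hl.symm rfl (hv.symm.trans (h.trans (𝒢.r_inv u).symm))
        ((𝒢.s_mul _ _ hp).trans (h.trans (𝒢.r_inv u).symm)), 𝒢.mul_assoc]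
  · rw [𝒢.kernel_neg _ h]
    refine (finsum_eq_zero_of_forall_eq_zero fun v => ?_).symm
    by_cases h1 : 𝒢.s t = 𝒢.s v
    · rw [𝒢.kernel_neg g (fun h2 => h (h1.trans h2)), mul_zero]
    · rw [𝒢.kernel_neg f h1, zero_mul]

theorem kernel_invol (f : G → ℂ) (t u : G) :
    𝒢.kernel (𝒢.invol f) t u = conj (𝒢.kernel f u t) := by
  by_cases h : 𝒢.s t = 𝒢.s u
  · rw [𝒢.kernel_pos _ h, 𝒢.kernel_pos _ h.symm, invol]
    congr 2
    have q : 𝒢.s u = 𝒢.r (𝒢.inv t) := h.symm.trans (𝒢.r_inv t).symm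
    rw [𝒢.inv_mul_rev _ ((congrArg 𝒢.s (𝒢.inv_inv u)).trans q)]
    exact 𝒢.mul_congr (𝒢.inv_inv u) rfl _ _
  · rw [𝒢.kernel_neg _ h, 𝒢.kernel_neg _ (Ne.symm h), map_zero]

end Algebra

end GroupoidStr

namespace GroupoidStr

/-! ### The regular representation -/

section Regular

variable {G X : Type*} {𝒢 : GroupoidStr G X}

theorem isRegular_iff {f : G → ℂ} {A : HilbertL2 G →L[ℂ] HilbertL2 G} :
    𝒢.IsRegular f A ↔ ∀ u t, (A (basisVec u) : G → ℂ) t = 𝒢.kernel f t u := Iff.rfl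

theorem IsRegular.unique {f : G → ℂ} {A B : HilbertL2 G →L[ℂ] HilbertL2 G}
    (hA : 𝒢.IsRegular f A) (hB : 𝒢.IsRegular f B) : A = B :=
  HilbertL2.ext_matrix fun u t => (hA u t).trans (hB u t).symm

variable [TopologicalSpace G]

/-- The relations which define the groupoid C⋆-algebra. -/
theorem isModel_presentation {B : Type*} [CStarAlgebra B] {π : C_c(G, ℂ) → B}
    (hadd : ∀ f g, π (f + g) = π f + π g) (hsmul : ∀ (c : ℂ) f, π (c • f) = c • π f)
    (hmul : ∀ f g h : C_c(G, ℂ), ⇑h = 𝒢.conv f g → π h = π f * π g)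
    (hstar : ∀ f h : C_c(G, ℂ), ⇑h = 𝒢.invol f → π h = star (π f))
    (hle : ∀ f, ‖π f‖ ≤ 𝒢.INorm f) : 𝒢.presentation.IsModel π where
  rel a ha := by
    obtain ⟨f, g, rfl⟩ | ⟨c, f, rfl⟩ | ⟨f, g, h, hh, rfl⟩ | ⟨f, h, hh, rfl⟩ := ha
    · simp [hadd]
    · simp [hsmul]
    · simp [hmul f g h hh]
    · rw [map_sub, map_star, FreeStarAlg.lift_gen, FreeStarAlg.lift_gen, hstar f h hh, sub_self]
  norm_le := hle

variable [TopologicalSpace X]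

theorem INorm_range_le (h𝒢 : 𝒢.IsEtale) (f : C_c(G, ℂ)) (x : X) :
    ∑ᶠ g : {g : G // 𝒢.r g = x}, ‖f g‖₊ ≤ 𝒢.INorm f :=
  (le_ciSup (f.bddAbove_fibre_sum h𝒢.isLocalHomeomorph_r) x).trans (le_max_left _ _)

theorem INorm_source_le (h𝒢 : 𝒢.IsEtale) (f : C_c(G, ℂ)) (x : X) :
    ∑ᶠ g : {g : G // 𝒢.s g = x}, ‖f g‖₊ ≤ 𝒢.INorm f :=
  (le_ciSup (f.bddAbove_fibre_sum h𝒢.isLocalHomeomorph_s) x).trans (le_max_right _ _)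

theorem sum_nnnorm_le_finsum {I : Type*} {k : I → ℂ} (hk : (Function.support k).Finite)
    (F : Finset I) : ∑ u ∈ F, ‖k u‖₊ ≤ ∑ᶠ u, ‖k u‖₊ := by
  classical
  rw [finsum_eq_sum_of_support_subset (s := F ∪ hk.toFinset)]
  · exact Finset.sum_le_sum_of_subset Finset.subset_union_left
  · intro u hu
    have : k u ≠ 0 := by simpa using hu
    simp [this]

theorem finite_row (h𝒢 : 𝒢.IsEtale) (f : C_c(G, ℂ)) (t : G) :
    (Function.support (𝒢.kernel f t)).Finite := by
  refine Set.Finite.subset (((f.finite_fibre_support h𝒢.isLocalHomeomorph_r (𝒢.r t)).preimage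
    (f := fun h : {h : G // 𝒢.r h = 𝒢.r t} => h.1) Subtype.val_injective.injOn).image
      fun h => ((𝒢.divEquiv t).symm h).1) ?_
  intro u hu
  have hs : 𝒢.s t = 𝒢.s u := by
    by_contra h
    exact hu (𝒢.kernel_neg _ h)
  rw [Function.mem_support, 𝒢.kernel_pos _ hs] at hu
  exact ⟨𝒢.divEquiv t ⟨u, hs⟩, ⟨(𝒢.divEquiv t ⟨u, hs⟩).2, hu⟩,
    congrArg Subtype.val ((𝒢.divEquiv t).symm_apply_apply ⟨u, hs⟩)⟩

theorem finite_column (h𝒢 : 𝒢.IsEtale) (f : C_c(G, ℂ)) (u : G) :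
    (Function.support fun t => 𝒢.kernel f t u).Finite := by
  refine Set.Finite.subset (((f.finite_fibre_support h𝒢.isLocalHomeomorph_s (𝒢.r u)).preimage
    (f := fun h : {h : G // 𝒢.s h = 𝒢.r u} => h.1) Subtype.val_injective.injOn).image
      fun h => ((𝒢.divEquiv' u).symm h).1) ?_
  intro t ht
  have hs : 𝒢.s t = 𝒢.s u := by
    by_contra h
    exact ht (𝒢.kernel_neg _ h)
  rw [Function.mem_support, 𝒢.kernel_pos _ hs] at ht
  exact ⟨𝒢.divEquiv' u ⟨t, hs⟩, ⟨(𝒢.divEquiv' u ⟨t, hs⟩).2, ht⟩,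
    congrArg Subtype.val ((𝒢.divEquiv' u).symm_apply_apply ⟨t, hs⟩)⟩

theorem exists_regular (h𝒢 : 𝒢.IsEtale) (f : C_c(G, ℂ)) :
    ∃ A : HilbertL2 G →L[ℂ] HilbertL2 G, ‖A‖ ≤ 𝒢.INorm f ∧
      ∀ (ξ : HilbertL2 G) t, (A ξ : G → ℂ) t = ∑ᶠ u, 𝒢.kernel f t u * ξ u := by
  refine exists_operator_of_kernel (𝒢.kernel f) (NNReal.coe_nonneg _) (finite_row h𝒢 f) ?_ ?_
  · intro t F
    have h : ∑ u ∈ F, ‖𝒢.kernel f t u‖₊ ≤ 𝒢.INorm f := by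
      refine (sum_nnnorm_le_finsum (finite_row h𝒢 f t) F).trans ?_
      rw [𝒢.finsum_row t (H := fun h => ‖f h‖₊)]
      · exact INorm_range_le h𝒢 f _
      · intro u hu
        rw [𝒢.kernel_neg _ hu, nnnorm_zero]
      · intro u hu
        rw [𝒢.kernel_pos _ hu]
    simpa only [NNReal.coe_sum, coe_nnnorm] using NNReal.coe_le_coe.2 h
  · intro u F
    have h : ∑ t ∈ F, ‖𝒢.kernel f t u‖₊ ≤ 𝒢.INorm f := by
      refine (sum_nnnorm_le_finsum (finite_column h𝒢 f u) F).trans ?_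
      rw [𝒢.finsum_column u (H := fun h => ‖f h‖₊)]
      · exact INorm_source_le h𝒢 f _
      · intro t ht
        rw [𝒢.kernel_neg _ ht, nnnorm_zero]
      · intro t ht
        rw [𝒢.kernel_pos _ ht]
    simpa only [NNReal.coe_sum, coe_nnnorm] using NNReal.coe_le_coe.2 h

/-- The image of `f` under the regular representation. -/
def regular (h𝒢 : 𝒢.IsEtale) (f : C_c(G, ℂ)) : HilbertL2 G →L[ℂ] HilbertL2 G :=
  (exists_regular h𝒢 f).choose

theorem norm_regular_le (h𝒢 : 𝒢.IsEtale) (f : C_c(G, ℂ)) : ‖regular h𝒢 f‖ ≤ 𝒢.INorm f :=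
  (exists_regular h𝒢 f).choose_spec.1

theorem regular_apply (h𝒢 : 𝒢.IsEtale) (f : C_c(G, ℂ)) (ξ : HilbertL2 G) (t : G) :
    (regular h𝒢 f ξ : G → ℂ) t = ∑ᶠ u, 𝒢.kernel f t u * ξ u :=
  (exists_regular h𝒢 f).choose_spec.2 ξ t

theorem isRegular_regular (h𝒢 : 𝒢.IsEtale) (f : C_c(G, ℂ)) : 𝒢.IsRegular f (regular h𝒢 f) := by
  rw [isRegular_iff]
  intro u t
  rw [regular_apply, finsum_eq_single _ u]
  · rw [basisVec_apply_self, mul_one]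
  · intro v hv
    rw [basisVec_apply_ne hv, mul_zero]

theorem isModel_regular (h𝒢 : 𝒢.IsEtale) : 𝒢.presentation.IsModel (regular h𝒢) := by
  refine isModel_presentation ?_ ?_ ?_ ?_ (norm_regular_le h𝒢)
  · intro f g
    refine HilbertL2.ext_matrix fun u t => ?_
    have h1 := isRegular_iff.1 (isRegular_regular h𝒢 f) u t
    have h2 := isRegular_iff.1 (isRegular_regular h𝒢 g) u t
    rw [isRegular_iff.1 (isRegular_regular h𝒢 (f + g)) u t]
    change _ = (regular h𝒢 f (basisVec u) : G → ℂ) t + (regular h𝒢 g (basisVec u) : G → ℂ) t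
    rw [h1, h2]
    by_cases h : 𝒢.s t = 𝒢.s u
    · simp [𝒢.kernel_pos _ h]
    · simp [𝒢.kernel_neg _ h]
  · intro c f
    refine HilbertL2.ext_matrix fun u t => ?_
    have h1 := isRegular_iff.1 (isRegular_regular h𝒢 f) u t
    rw [isRegular_iff.1 (isRegular_regular h𝒢 (c • f)) u t]
    change _ = c * (regular h𝒢 f (basisVec u) : G → ℂ) t
    rw [h1]
    by_cases h : 𝒢.s t = 𝒢.s u
    · simp [𝒢.kernel_pos _ h]
    · simp [𝒢.kernel_neg _ h]
  · intro f g h hh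
    refine HilbertL2.ext_matrix fun u t => ?_
    rw [isRegular_iff.1 (isRegular_regular h𝒢 h) u t, hh, kernel_conv]
    change _ = (regular h𝒢 f (regular h𝒢 g (basisVec u)) : G → ℂ) t
    rw [regular_apply]
    exact finsum_congr fun v => by rw [isRegular_iff.1 (isRegular_regular h𝒢 g) u v]
  · intro f h hh
    refine HilbertL2.ext_matrix fun u t => ?_
    rw [isRegular_iff.1 (isRegular_regular h𝒢 h) u t, hh, kernel_invol, apply_basisVec_eq_conj,
      isRegular_iff.1 (isRegular_regular h𝒢 f) t u]

end Regular

/-! ### Homomorphisms on the full groupoid C⋆-algebra -/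

section Full

variable {G X : Type*} [TopologicalSpace G] {𝒢 : GroupoidStr G X}

theorem lift_mem {B : Type*} [CStarAlgebra B] {π : C_c(G, ℂ) → B}
    (hπ : 𝒢.presentation.IsModel π) (S : NonUnitalStarSubalgebra ℂ B) (hS : IsClosed (S : Set B))
    (hmem : ∀ f, π f ∈ S)
    (a : (NonUnitalStarAlgebra.adjoin ℂ (Set.range 𝒢.presentation.ι)).topologicalClosure) :
    CStarPresentation.lift hπ a.1 ∈ S := by
  have hc : Continuous (CStarPresentation.lift hπ) :=
    UniformSpace.Completion.continuous_extension
  refine (NonUnitalStarSubalgebra.topologicalClosure_minimal _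
    (t := S.comap (CStarPresentation.lift hπ).toNonUnitalStarAlgHom) ?_ (hS.preimage hc)) a.2
  refine NonUnitalStarAlgebra.adjoin_le ?_
  rintro _ ⟨f, rfl⟩
  change CStarPresentation.lift hπ (𝒢.presentation.ι f) ∈ S
  rw [CStarPresentation.lift_ι]
  exact hmem f

/-- The restriction of the ⋆-homomorphism which belongs to a model to `C*(G)`. -/
def fullLift {B : Type*} [CStarAlgebra B] {π : C_c(G, ℂ) → B}
    (hπ : 𝒢.presentation.IsModel π) (S : NonUnitalStarSubalgebra ℂ B) (hS : IsClosed (S : Set B))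
    (hmem : ∀ f, π f ∈ S) :
    (NonUnitalStarAlgebra.adjoin ℂ (Set.range 𝒢.presentation.ι)).topologicalClosure →⋆ₙₐ[ℂ] S :=
  NonUnitalStarAlgHom.codRestrict
    ((CStarPresentation.lift hπ).toNonUnitalStarAlgHom.comp
      (NonUnitalStarSubalgebraClass.subtype
        (NonUnitalStarAlgebra.adjoin ℂ (Set.range 𝒢.presentation.ι)).topologicalClosure)) S
    (lift_mem hπ S hS hmem)

/-- Induction on the elements of `C*(G)`. -/
theorem full_induction {p : 𝒢.FullCStar → Prop} (hclosed : IsClosed {a | p a})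
    (hgen : ∀ f, p (𝒢.toFull f)) (hzero : p 0) (hadd : ∀ a b, p a → p b → p (a + b))
    (hmul : ∀ a b, p a → p b → p (a * b)) (hsmul : ∀ (c : ℂ) a, p a → p (c • a))
    (hstar : ∀ a, p a → p (star a)) (a : 𝒢.FullCStar) : p a := by
  let S := NonUnitalStarAlgebra.adjoin ℂ (Set.range 𝒢.presentation.ι)
  have key : ∀ (b : 𝒢.presentation.Universal) (hb : b ∈ S),
      p ⟨b, S.le_topologicalClosure hb⟩ := by
    intro b hb
    induction hb using NonUnitalStarAlgebra.adjoin_induction with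
    | mem x hx =>
      obtain ⟨f, rfl⟩ := hx
      exact hgen f
    | add x y _ _ hx hy => exact hadd _ _ hx hy
    | zero => exact hzero
    | mul x y _ _ hx hy => exact hmul _ _ hx hy
    | smul c x _ hx => exact hsmul c _ hx
    | star x _ hx => exact hstar _ hx
  obtain ⟨a, ha⟩ := a
  have hc : a ∈ closure (S : Set 𝒢.presentation.Universal) := ha
  obtain ⟨C, hC, hCp⟩ := isClosed_induced_iff.1 hclosed
  have hsub : closure (S : Set 𝒢.presentation.Universal) ⊆ C := by
    refine closure_minimal (fun b hb => ?_) hC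
    have hb' : (⟨b, S.le_topologicalClosure hb⟩ : 𝒢.FullCStar) ∈ {a | p a} := key b hb
    rw [← hCp] at hb'
    exact hb'
  have hfin : (⟨a, ha⟩ : 𝒢.FullCStar) ∈ {a | p a} := by
    rw [← hCp]
    exact hsub hc
  exact hfin

/-- ⋆-homomorphisms between C⋆-algebras are contractive, so agreement on the image of `C_c(G)`
passes to the closed ⋆-subalgebra it generates. -/
theorem full_hom_ext {C : Type*} [NonUnitalCStarAlgebra C] {Φ Ψ : 𝒢.FullCStar →⋆ₙₐ[ℂ] C}
    (h : ∀ f, Φ (𝒢.toFull f) = Ψ (𝒢.toFull f)) : Φ = Ψ := by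
  have hΦ : Continuous Φ := AddMonoidHomClass.continuous_of_bound Φ 1 fun a => by
    rw [one_mul]; exact NonUnitalStarAlgHom.norm_apply_le Φ a
  have hΨ : Continuous Ψ := AddMonoidHomClass.continuous_of_bound Ψ 1 fun a => by
    rw [one_mul]; exact NonUnitalStarAlgHom.norm_apply_le Ψ a
  refine NonUnitalStarAlgHom.ext fun a => ?_
  refine full_induction (p := fun a => Φ a = Ψ a) (isClosed_eq hΦ hΨ) h ?_ ?_ ?_ ?_ ?_ a
  · rw [map_zero, map_zero]
  · intro a b ha hb
    rw [map_add, map_add, ha, hb]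
  · intro a b ha hb
    rw [map_mul, map_mul, ha, hb]
  · intro c a ha
    rw [map_smul, map_smul, ha]
  · intro a ha
    rw [map_star, map_star, ha]

variable [TopologicalSpace X]

/-- The regular representation as a homomorphism to the reduced C⋆-algebra. -/
theorem exists_full_to_reduced (h𝒢 : 𝒢.IsEtale) :
    ∃ Φ : 𝒢.FullCStar →⋆ₙₐ[ℂ] 𝒢.ReducedCStar, ∀ f, (Φ (𝒢.toFull f)).IsImage f := by
  refine ⟨fullLift (isModel_regular h𝒢) _ (NonUnitalStarSubalgebra.isClosed_topologicalClosure _)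
    fun f => NonUnitalStarSubalgebra.le_topologicalClosure _
      (NonUnitalStarAlgebra.subset_adjoin ℂ _ ⟨f, isRegular_regular h𝒢 f⟩), fun f => ?_⟩
  change 𝒢.IsRegular f (CStarPresentation.lift (isModel_regular h𝒢) (𝒢.presentation.ι f))
  rw [CStarPresentation.lift_ι]
  exact isRegular_regular h𝒢 f

end Full

/-! ### Morphisms which are bijective on range fibres -/

section Morphism

open Filter Topology

variable {G₁ X₁ G₂ X₂ : Type*} [TopologicalSpace G₁] [TopologicalSpace G₂]
  {𝒢₁ : GroupoidStr G₁ X₁} {𝒢₂ : GroupoidStr G₂ X₂} {φ : G₁ → G₂}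
  {φ₀ : X₁ → X₂}

/-- Preservation of units is not part of the definition of a morphism. It follows because the image
of a unit is idempotent, and in a groupoid an idempotent is a unit. -/
theorem IsMorphism.map_unit (hφ : IsMorphism 𝒢₁ 𝒢₂ φ φ₀) (x : X₁) :
    φ (𝒢₁.unit x) = 𝒢₂.unit (φ₀ x) := by
  have p : 𝒢₁.s (𝒢₁.unit x) = 𝒢₁.r (𝒢₁.unit x) := (𝒢₁.s_unit x).trans (𝒢₁.r_unit x).symm
  have h := hφ.map_mul (𝒢₁.unit x) (𝒢₁.unit x) p
  rw [𝒢₁.unit_mul_of_eq] at h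
  have h1 := 𝒢₂.eq_unit_of_mul _ h.symm
  rw [hφ.s_map, 𝒢₁.s_unit] at h1
  exact h1

theorem IsMorphism.map_inv (hφ : IsMorphism 𝒢₁ 𝒢₂ φ φ₀) (g : G₁) :
    φ (𝒢₁.inv g) = 𝒢₂.inv (φ g) := by
  have h := hφ.map_mul g (𝒢₁.inv g) (𝒢₁.r_inv g).symm
  refine 𝒢₂.eq_inv_of_mul _ (h.symm.trans ?_)
  rw [𝒢₁.mul_inv, hφ.map_unit, hφ.r_map]

theorem IsMorphism.conv_comp (hφ : IsMorphism 𝒢₁ 𝒢₂ φ φ₀)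
    (hb : IsRangeFibreBijective 𝒢₁ 𝒢₂ φ φ₀) (f g : G₂ → ℂ) (t : G₁) :
    𝒢₁.conv (f ∘ φ) (g ∘ φ) t = 𝒢₂.conv f g (φ t) := by
  refine finsum_eq_of_bijective
    (fun h : {h // 𝒢₁.r h = 𝒢₁.r t} => (⟨φ h, by rw [hφ.r_map, hφ.r_map, h.2]⟩ :
      {h // 𝒢₂.r h = 𝒢₂.r (φ t)})) ⟨?_, ?_⟩ ?_
  · intro a b hab
    exact Subtype.ext ((hb (𝒢₁.r t)).injOn a.2 b.2 (congrArg Subtype.val hab :))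
  · rintro ⟨k, hk⟩
    obtain ⟨h, hh, rfl⟩ := (hb (𝒢₁.r t)).surjOn
      (show k ∈ {g | 𝒢₂.r g = φ₀ (𝒢₁.r t)} from hk.trans (hφ.r_map t))
    exact ⟨⟨h, hh⟩, rfl⟩
  · rintro ⟨h, hh⟩
    have e := hφ.map_mul (𝒢₁.inv h) t ((𝒢₁.s_inv h).trans hh)
    simp only [Function.comp_apply]
    rw [e, 𝒢₂.mul_congr (hφ.map_inv h) rfl]

theorem IsMorphism.invol_comp (hφ : IsMorphism 𝒢₁ 𝒢₂ φ φ₀) (f : G₂ → ℂ) (t : G₁) :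
    𝒢₁.invol (f ∘ φ) t = 𝒢₂.invol f (φ t) := by
  simp [invol, hφ.map_inv]

variable [TopologicalSpace X₂]

/-- Range fibre sums of `f ∘ φ` are range fibre sums of `f`. For source fibres the bijection is
transported through `g ↦ g⁻¹`, which `φ` respects. Only units in the image of `φ₀` are tested,
whence an inequality. -/
theorem IsMorphism.INorm_comp_le (h₂ : 𝒢₂.IsEtale) (hφ : IsMorphism 𝒢₁ 𝒢₂ φ φ₀)
    (hb : IsRangeFibreBijective 𝒢₁ 𝒢₂ φ φ₀) (f : C_c(G₂, ℂ)) :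
    𝒢₁.INorm (f ∘ φ) ≤ 𝒢₂.INorm f := by
  refine max_le (ciSup_le' fun x => ?_) (ciSup_le' fun x => ?_)
  · refine le_trans (le_of_eq ?_) (INorm_range_le h₂ f (φ₀ x))
    refine finsum_eq_of_bijective
      (fun h : {h // 𝒢₁.r h = x} => (⟨φ h, by rw [hφ.r_map, h.2]⟩ :
        {h // 𝒢₂.r h = φ₀ x})) ⟨?_, ?_⟩ fun _ => rfl
    · intro a b hab
      exact Subtype.ext ((hb x).injOn a.2 b.2 (congrArg Subtype.val hab :))
    · rintro ⟨k, hk⟩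
      obtain ⟨h, hh, rfl⟩ := (hb x).surjOn hk
      exact ⟨⟨h, hh⟩, rfl⟩
  · refine le_trans (le_of_eq ?_) (INorm_source_le h₂ f (φ₀ x))
    refine finsum_eq_of_bijective
      (fun h : {h // 𝒢₁.s h = x} => (⟨φ h, by rw [hφ.s_map, h.2]⟩ :
        {h // 𝒢₂.s h = φ₀ x})) ⟨?_, ?_⟩ fun _ => rfl
    · intro a b hab
      have h1 : φ a.1 = φ b.1 := congrArg Subtype.val hab
      have h2 : 𝒢₁.inv a.1 = 𝒢₁.inv b.1 := by
        refine (hb x).injOn ((𝒢₁.r_inv _).trans a.2) ((𝒢₁.r_inv _).trans b.2) ?_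
        rw [hφ.map_inv, hφ.map_inv, h1]
      refine Subtype.ext ?_
      rw [← 𝒢₁.inv_inv a.1, h2, 𝒢₁.inv_inv]
    · rintro ⟨k, hk⟩
      obtain ⟨h, hh, e⟩ := (hb x).surjOn
        (show 𝒢₂.inv k ∈ {g | 𝒢₂.r g = φ₀ x} from (𝒢₂.r_inv k).trans hk)
      refine ⟨⟨𝒢₁.inv h, (𝒢₁.s_inv h).trans hh⟩, Subtype.ext ?_⟩
      change φ (𝒢₁.inv h) = k
      rw [hφ.map_inv, e, 𝒢₂.inv_inv]

/-- The composition of a compactly supported function with a proper map. -/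
def pullback (hp : IsProperMap φ) [T2Space G₂] (f : C_c(G₂, ℂ)) : C_c(G₁, ℂ) where
  toFun := f ∘ φ
  continuous_toFun := f.continuous.comp hp.continuous
  hasCompactSupport' := by
    refine HasCompactSupport.intro' (hp.isCompact_preimage f.hasCompactSupport)
      ((isClosed_tsupport _).preimage hp.continuous) fun g hg => ?_
    exact image_eq_zero_of_notMem_tsupport (f := f) hg

theorem IsMorphism.isModel_pullback [T2Space G₂] (h₂ : 𝒢₂.IsEtale)
    (hφ : IsMorphism 𝒢₁ 𝒢₂ φ φ₀) (hb : IsRangeFibreBijective 𝒢₁ 𝒢₂ φ φ₀) (hp : IsProperMap φ) :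
    𝒢₂.presentation.IsModel fun f => 𝒢₁.presentation.ι (pullback hp f) := by
  have hrel := 𝒢₁.presentation.isModel_ι.rel
  refine isModel_presentation ?_ ?_ ?_ ?_ ?_
  · intro f g
    have h := hrel _ (Or.inl ⟨pullback hp f, pullback hp g, rfl⟩)
    simp only [map_sub, map_add, FreeStarAlg.lift_gen] at h
    exact sub_eq_zero.1 h
  · intro c f
    have h := hrel _ (Or.inr (Or.inl ⟨c, pullback hp f, rfl⟩))
    simp only [map_sub, map_smul, FreeStarAlg.lift_gen] at h
    exact sub_eq_zero.1 h
  · intro f g k hk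
    have h := hrel _ (Or.inr (Or.inr (Or.inl ⟨pullback hp f, pullback hp g, pullback hp k, ?_, rfl⟩)))
    · rw [map_sub, _root_.map_mul, FreeStarAlg.lift_gen, FreeStarAlg.lift_gen,
        FreeStarAlg.lift_gen] at h
      exact sub_eq_zero.1 h
    · funext t
      exact (congrFun hk (φ t)).trans (hφ.conv_comp hb f g t).symm
  · intro f k hk
    have h := hrel _ (Or.inr (Or.inr (Or.inr ⟨pullback hp f, pullback hp k, ?_, rfl⟩)))
    · rw [map_sub, map_star, FreeStarAlg.lift_gen, FreeStarAlg.lift_gen] at h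
      exact sub_eq_zero.1 h
    · funext t
      exact (congrFun hk (φ t)).trans (hφ.invol_comp f t).symm
  · intro f
    refine (CStarPresentation.norm_ι_le (P := 𝒢₁.presentation) (pullback hp f)).trans ?_
    exact_mod_cast hφ.INorm_comp_le h₂ hb f

theorem IsMorphism.exists_full_to_full [T2Space G₂] (h₂ : 𝒢₂.IsEtale)
    (hφ : IsMorphism 𝒢₁ 𝒢₂ φ φ₀) (hb : IsRangeFibreBijective 𝒢₁ 𝒢₂ φ φ₀) (hp : IsProperMap φ) :
    ∃ Φ : 𝒢₂.FullCStar →⋆ₙₐ[ℂ] 𝒢₁.FullCStar,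
      ∀ f, Φ (𝒢₂.toFull f) = 𝒢₁.toFull (pullback hp f) := by
  refine ⟨fullLift (hφ.isModel_pullback h₂ hb hp) _
    (NonUnitalStarSubalgebra.isClosed_topologicalClosure _)
    fun f => (𝒢₁.toFull (pullback hp f)).2, fun f => Subtype.ext ?_⟩
  exact CStarPresentation.lift_ι (hφ.isModel_pullback h₂ hb hp) f

variable [TopologicalSpace X₁]

theorem IsMorphism.isProperMap (h₁ : 𝒢₁.IsEtale) (h₂ : 𝒢₂.IsEtale)
    (hφ : IsMorphism 𝒢₁ 𝒢₂ φ φ₀) (hb : IsRangeFibreBijective 𝒢₁ 𝒢₂ φ φ₀) (hp : IsProperMap φ₀) :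
    IsProperMap φ := by
  rw [isProperMap_iff_ultrafilter]
  refine ⟨hφ.continuous, fun 𝒰 y hy => ?_⟩
  -- The ranges of the images converge, so properness of `φ₀` supplies a limit `x` of the ranges
  -- themselves; surjectivity on the fibre over `x` then yields the candidate limit `g`.
  have hr : Tendsto φ₀ (𝒰.map 𝒢₁.r) (𝓝 (𝒢₂.r y)) := by
    have h := (h₂.isLocalHomeomorph_r.continuous.tendsto y).comp hy
    have e : 𝒢₂.r ∘ φ = φ₀ ∘ 𝒢₁.r := funext hφ.r_map
    rw [e] at h
    exact tendsto_map'_iff.2 h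
  obtain ⟨x, hx, hxU⟩ := hp.ultrafilter_le_nhds_of_tendsto hr
  obtain ⟨g, hg, rfl⟩ := (hb x).surjOn (show y ∈ {g | 𝒢₂.r g = φ₀ x} from hx.symm)
  obtain rfl : 𝒢₁.r g = x := hg
  refine ⟨g, rfl, ?_⟩
  obtain ⟨e, he, her⟩ := h₂.isLocalHomeomorph_r (φ g)
  intro N hN
  -- Range maps are open, so `𝒰`-almost every `u` has the range of some `u'` in `N` with `φ u'` in
  -- the chart `e`. Since `φ u` also lies in the chart and has the same range, `φ u' = φ u`, and
  -- injectivity on the fibre gives `u' = u`.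
  have hN' : N ∩ φ ⁻¹' e.source ∈ 𝓝 g :=
    inter_mem hN (hφ.continuous.continuousAt.preimage_mem_nhds (e.open_source.mem_nhds he))
  have h1 : 𝒢₁.r '' (N ∩ φ ⁻¹' e.source) ∈ 𝓝 (𝒢₁.r g) :=
    h₁.isLocalHomeomorph_r.isOpenMap.image_mem_nhds hN'
  have h2 : 𝒢₁.r ⁻¹' (𝒢₁.r '' (N ∩ φ ⁻¹' e.source)) ∈ 𝒰 := hxU h1
  have h3 : φ ⁻¹' e.source ∈ 𝒰 := hy (e.open_source.mem_nhds he)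
  filter_upwards [h2, h3] with u hu1 hu2
  obtain ⟨u', ⟨hu'N, hu'e⟩, hu'r⟩ := hu1
  have h4 : φ u' = φ u := by
    refine e.injOn hu'e hu2 ?_
    rw [← her, hφ.r_map, hφ.r_map, hu'r]
  have h5 : u' = u := (hb (𝒢₁.r u)).injOn hu'r rfl h4
  exact h5 ▸ hu'N

theorem IsMorphism.existsUnique_full_to_reduced [T2Space G₂] (h₁ : 𝒢₁.IsEtale) (h₂ : 𝒢₂.IsEtale)
    (hφ : IsMorphism 𝒢₁ 𝒢₂ φ φ₀) (hb : IsRangeFibreBijective 𝒢₁ 𝒢₂ φ φ₀) (hp : IsProperMap φ) :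
    ∃! Φ : 𝒢₂.FullCStar →⋆ₙₐ[ℂ] 𝒢₁.ReducedCStar,
      ∀ f, (Φ (𝒢₂.toFull f)).IsImage (pullback hp f) := by
  obtain ⟨Φ, hΦ⟩ := hφ.exists_full_to_full h₂ hb hp
  obtain ⟨Ψ, hΨ⟩ := exists_full_to_reduced h₁
  refine ⟨Ψ.comp Φ, fun f => ?_, fun Φ' hΦ' => ?_⟩
  · rw [NonUnitalStarAlgHom.comp_apply, hΦ]
    exact hΨ _
  · refine full_hom_ext fun f => Subtype.ext (IsRegular.unique (hΦ' f) ?_)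
    rw [NonUnitalStarAlgHom.comp_apply, hΦ]
    exact hΨ _

end Morphism

end GroupoidStr

/-! ### The semidirect product groupoid is étale -/

section Semidirect

open Filter Topology

variable {J X : Type*}

/-- The elements `(x, m - n, y)` with `T^m x = T^n y` for given `m` and `n`. -/
def repSet (T : (J → ℕ) → (X →. X)) (m n : J → ℕ) : Set (SemidirectGroupoid T) :=
  {g | (∀ j, g.1.2.1 j = (m j : ℤ) - n j) ∧ ∃ w, w ∈ T m g.1.1 ∧ w ∈ T n g.1.2.2}

theorem exists_mem_repSet {T : (J → ℕ) → (X →. X)} (g : SemidirectGroupoid T) :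
    ∃ m n, g ∈ repSet T m n := g.2

theorem eq_of_mem_repSet {T : (J → ℕ) → (X →. X)} {m n : J → ℕ} {g h : SemidirectGroupoid T}
    (hg : g ∈ repSet T m n) (hh : h ∈ repSet T m n) : g.1.2.1 = h.1.2.1 :=
  funext fun j => (hg.1 j).trans (hh.1 j).symm

variable [TopologicalSpace X]

theorem IsMGDS.mem_add {T : (J → ℕ) → (X →. X)} (hT : IsMGDS T) {a b : J → ℕ} {u u₁ v : X}
    (h : u₁ ∈ T b u) : v ∈ T (a + b) u ↔ v ∈ T a u₁ := by
  rw [hT.add, PFun.comp_apply]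
  refine Part.mem_bind_iff.trans ?_
  constructor
  · rintro ⟨u₂, h2, h3⟩
    rwa [Part.mem_unique h h2]
  · exact fun h3 => ⟨u₁, h, h3⟩

theorem IsPartialLocalHomeo.exists_injective {f : X →. X} (hf : IsPartialLocalHomeo f) {x : X}
    (hx : x ∈ f.Dom) {O : Set X} (hO : IsOpen O) (hxO : x ∈ O) :
    ∃ U ⊆ O, x ∈ U ∧ IsOpenInjective f U := by
  obtain ⟨e, hxe, he⟩ := hf.2 x hx
  refine ⟨O ∩ e.source, Set.inter_subset_left, ⟨hxO, hxe⟩, hO.inter e.open_source, ?_, ?_⟩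
  · intro y hy
    exact (PFun.mem_dom _ _).2 ⟨_, he y hy.2⟩
  · intro y hy z hz w h1 h2
    exact e.injOn hy.2 hz.2
      ((Part.mem_unique (he y hy.2) h1).trans (Part.mem_unique (he z hz.2) h2).symm)

theorem IsPartialLocalHomeo.eventually_mem {f : X →. X} (hf : IsPartialLocalHomeo f) {x w : X}
    (hw : w ∈ f x) {O : Set X} (hO : O ∈ 𝓝 w) : ∀ᶠ y in 𝓝 x, ∃ v ∈ O, v ∈ f y := by
  obtain ⟨e, hxe, he⟩ := hf.2 x ((PFun.mem_dom _ _).2 ⟨w, hw⟩)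
  obtain rfl := Part.mem_unique (he x hxe) hw
  filter_upwards [e.open_source.mem_nhds hxe, (e.continuousAt hxe).preimage_mem_nhds hO]
    with y hy hyO
  exact ⟨e y, hyO, he y hy⟩

variable {T : (J → ℕ) → (X →. X)}

theorem exists_basic_mem (hT : IsMGDS T) {m n : J → ℕ} {g : SemidirectGroupoid T}
    (hg : g ∈ repSet T m n) {O O' : Set X} (hO : IsOpen O) (hgO : g.1.1 ∈ O) (hO' : IsOpen O')
    (hgO' : g.1.2.2 ∈ O') :
    ∃ N ∈ 𝓝 g, N ⊆ repSet T m n ∧ ∀ h ∈ N, h.1.1 ∈ O ∧ h.1.2.2 ∈ O' := by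
  obtain ⟨hk, w, h1, h2⟩ := hg
  obtain ⟨U, hUO, hxU, hU⟩ :=
    (hT.localHomeo m).exists_injective ((PFun.mem_dom _ _).2 ⟨w, h1⟩) hO hgO
  obtain ⟨V, hVO, hyV, hV⟩ :=
    (hT.localHomeo n).exists_injective ((PFun.mem_dom _ _).2 ⟨w, h2⟩) hO' hgO'
  refine ⟨semidirectBasic T U m n V, IsOpen.mem_nhds ?_ ⟨hxU, hyV, hk, w, h1, h2⟩,
    fun h hh => hh.2.2, fun h hh => ⟨hUO hh.1, hVO hh.2.1⟩⟩
  exact TopologicalSpace.isOpen_generateFrom_of_mem ⟨U, m, n, V, hU, hV, rfl⟩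

theorem isOpen_repSet (hT : IsMGDS T) (m n : J → ℕ) : IsOpen (repSet T m n) := by
  rw [isOpen_iff_mem_nhds]
  intro g hg
  obtain ⟨N, hN, hN', -⟩ := exists_basic_mem hT hg isOpen_univ trivial isOpen_univ trivial
  exact mem_of_superset hN hN'

theorem continuous_range_source (hT : IsMGDS T) :
    Continuous fun g : SemidirectGroupoid T => (g.1.1, g.1.2.2) := by
  refine continuous_iff_continuousAt.2 fun g => ?_
  obtain ⟨m, n, hg⟩ := exists_mem_repSet g
  refine ContinuousAt.prodMk ?_ ?_
  · intro O hO
    obtain ⟨O', hO'O, hO', hx⟩ := mem_nhds_iff.1 hO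
    obtain ⟨N, hN, -, h⟩ := exists_basic_mem hT hg hO' hx isOpen_univ trivial
    exact mem_map.2 (mem_of_superset hN fun g hg => hO'O (h g hg).1)
  · intro O hO
    obtain ⟨O', hO'O, hO', hx⟩ := mem_nhds_iff.1 hO
    obtain ⟨N, hN, -, h⟩ := exists_basic_mem hT hg isOpen_univ trivial hO' hx
    exact mem_map.2 (mem_of_superset hN fun g hg => hO'O (h g hg).2)

/-- Two pairs of exponents with the same difference become equal after adding `c` to one pair and
`d` to the other, with the same `c`, `d` in both components. -/
theorem exists_common_rep {m n m' n' : J → ℕ}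
    (h : ∀ j, (m j : ℤ) - n j = (m' j : ℤ) - n' j) :
    (m ⊔ m' - m') + m' = m ⊔ m' ∧ (m ⊔ m' - m') + n' = n ⊔ n' ∧
      (m ⊔ m' - m) + m = m ⊔ m' ∧ (m ⊔ m' - m) + n = n ⊔ n' := by
  refine ⟨funext fun j => ?_, funext fun j => ?_, funext fun j => ?_, funext fun j => ?_⟩ <;>
  · have := h j
    simp only [Pi.add_apply, Pi.sub_apply, Pi.sup_apply]
    omega

/-- An element near `g` with `T^m x = T^n y` must be shown to satisfy `T^{m'} x = T^{n'} y`. By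
(DC), `T^{m ∨ m'}` is defined at `x`, and it can be computed through either pair of exponents. This
gives `T^c T^{m'} x = T^c T^{n'} y` with `c = m ∨ m' - m'`, and `T^c` is injective near the common
value at `g`. -/
theorem semidirectBasic_mem (hT : IsMGDS T) (hDC : DomainCondition T) {m n m' n' : J → ℕ}
    {g : SemidirectGroupoid T} (hg : g ∈ repSet T m n) {U V : Set X}
    (hU : IsOpenInjective (T m') U) (hV : IsOpenInjective (T n') V)
    (hgA : g ∈ semidirectBasic T U m' n' V) :
    semidirectBasic T U m' n' V ∈
      comap (fun g : SemidirectGroupoid T => (g.1.1, g.1.2.2)) (𝓝 (g.1.1, g.1.2.2)) ⊓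
        𝓟 (repSet T m n) := by
  obtain ⟨hk, w, h1, h2⟩ := hg
  obtain ⟨hxU, hyV, hk', w', h1', h2'⟩ := hgA
  have hkk : ∀ j, (m j : ℤ) - n j = (m' j : ℤ) - n' j := fun j => (hk j).symm.trans (hk' j)
  obtain ⟨e1, e2, e3, e4⟩ := exists_common_rep hkk
  set c := m ⊔ m' - m'
  set d := m ⊔ m' - m
  have hdom : g.1.1 ∈ (T (m ⊔ m')).Dom :=
    hDC m m' ⟨(PFun.mem_dom _ _).2 ⟨w, h1⟩, (PFun.mem_dom _ _).2 ⟨w', h1'⟩⟩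
  obtain ⟨v, hv⟩ := (PFun.mem_dom _ _).1 hdom
  have hw'dom : w' ∈ (T c).Dom :=
    (PFun.mem_dom _ _).2 ⟨v, (hT.mem_add h1').1 (by rwa [e1])⟩
  obtain ⟨O, -, hw'O, hO, -, hOinj⟩ := (hT.localHomeo c).exists_injective hw'dom isOpen_univ trivial
  have hx : ∀ᶠ x in 𝓝 g.1.1, x ∈ U ∧ x ∈ (T (m ⊔ m')).Dom ∧ ∃ v ∈ O, v ∈ T m' x := by
    filter_upwards [hU.1.mem_nhds hxU, (hT.localHomeo (m ⊔ m')).1.mem_nhds hdom,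
      (hT.localHomeo m').eventually_mem h1' (hO.mem_nhds hw'O)] with x a b c using ⟨a, b, c⟩
  have hy : ∀ᶠ y in 𝓝 g.1.2.2, y ∈ V ∧ ∃ v ∈ O, v ∈ T n' y := by
    filter_upwards [hV.1.mem_nhds hyV,
      (hT.localHomeo n').eventually_mem h2' (hO.mem_nhds hw'O)] with x a b using ⟨a, b⟩
  have hxy := preimage_mem_comap (m := fun g : SemidirectGroupoid T => (g.1.1, g.1.2.2))
    (prod_mem_nhds hx hy)
  refine mem_inf_of_inter hxy (mem_principal_self _) ?_
  rintro h ⟨⟨⟨hhU, hhd, a, haO, ha⟩, ⟨hhV, b, hbO, hb⟩⟩, hhk, q, hq1, hq2⟩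
  obtain ⟨v, hv⟩ := (PFun.mem_dom _ _).1 hhd
  have hv1 : v ∈ T c a := (hT.mem_add ha).1 (by rwa [e1])
  have hvq : v ∈ T d q := (hT.mem_add hq1).1 (by rwa [e3])
  have hvN : v ∈ T (d + n) h.1.2.2 := (hT.mem_add hq2).2 hvq
  have hv2 : v ∈ T c b := (hT.mem_add hb).1 (by rwa [e2, ← e4])
  obtain rfl : a = b := hOinj a haO b hbO v hv1 hv2
  exact ⟨hhU, hhV, fun j => (hhk j).trans (hkk j), a, ha, hb⟩

/-- On the open set `repSet T m n` the topology is induced from `X × X`. -/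
theorem semidirect_nhds_eq (hT : IsMGDS T) (hDC : DomainCondition T) {m n : J → ℕ}
    {g : SemidirectGroupoid T} (hg : g ∈ repSet T m n) :
    𝓝 g = comap (fun g : SemidirectGroupoid T => (g.1.1, g.1.2.2)) (𝓝 (g.1.1, g.1.2.2)) ⊓
        𝓟 (repSet T m n) := by
  refine le_antisymm (le_inf ?_ ?_) ?_
  · exact map_le_iff_le_comap.1 (continuous_range_source hT).continuousAt
  · exact le_principal_iff.2 ((isOpen_repSet hT m n).mem_nhds hg)
  · rw [TopologicalSpace.nhds_generateFrom (a := g)]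
    refine le_iInf₂ fun A hA => le_principal_iff.2 ?_
    obtain ⟨hgA, U, m', n', V, hU, hV, rfl⟩ := hA
    exact semidirectBasic_mem hT hDC hg hU hV hgA

theorem semidirect_tendsto (hT : IsMGDS T) (hDC : DomainCondition T) {Y : Type*} {l : Filter Y}
    {f : Y → SemidirectGroupoid T} {g : SemidirectGroupoid T} {m n : J → ℕ}
    (hg : g ∈ repSet T m n) (hf : ∀ᶠ y in l, f y ∈ repSet T m n)
    (h1 : Tendsto (fun y => (f y).1.1) l (𝓝 g.1.1))
    (h2 : Tendsto (fun y => (f y).1.2.2) l (𝓝 g.1.2.2)) : Tendsto f l (𝓝 g) := by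
  rw [semidirect_nhds_eq hT hDC hg, tendsto_inf, tendsto_comap_iff, tendsto_principal]
  exact ⟨h1.prodMk_nhds h2, hf⟩

/-- The explicit exponents depend only on those of the factors, so they stay the same for nearby
pairs; this is what continuity of the product needs. -/
theorem mul_mem_repSet (hT : IsMGDS T) (hDC : DomainCondition T) {m n m' n' : J → ℕ}
    {g h : SemidirectGroupoid T} (hg : g ∈ repSet T m n) (hh : h ∈ repSet T m' n')
    (p : g.1.2.2 = h.1.1) :
    (semidirectGroupoid hT hDC).mul g h p ∈
      repSet T ((n ⊔ m' - n) + m) ((n ⊔ m' - m') + n') := by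
  obtain ⟨⟨x, k, y⟩, hg'⟩ := g
  obtain ⟨⟨y', k', z⟩, hh'⟩ := h
  obtain ⟨hk, w, hx, hy⟩ := hg
  obtain ⟨hk', w', hy', hz⟩ := hh
  simp only at p hk hk' hx hy hy' hz
  subst p
  have hdom : y ∈ (T (n ⊔ m')).Dom :=
    hDC n m' ⟨(PFun.mem_dom _ _).2 ⟨w, hy⟩, (PFun.mem_dom _ _).2 ⟨w', hy'⟩⟩
  obtain ⟨v, hv⟩ := (PFun.mem_dom _ _).1 hdom
  have e1 : (n ⊔ m' - n) + n = n ⊔ m' := tsub_add_cancel_of_le le_sup_left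
  have e2 : (n ⊔ m' - m') + m' = n ⊔ m' := tsub_add_cancel_of_le le_sup_right
  refine ⟨fun j => ?_, v, ?_, ?_⟩
  · have h1 := congrFun e1 j
    have h2 := congrFun e2 j
    change k j + k' j = _
    simp only [Pi.add_apply, hk, hk'] at h1 h2 ⊢
    omega
  · exact (hT.mem_add hx).2 ((hT.mem_add hy).1 (by rwa [e1]))
  · exact (hT.mem_add hz).2 ((hT.mem_add hy').1 (by rwa [e2]))

theorem inv_mem_repSet (hT : IsMGDS T) (hDC : DomainCondition T) {m n : J → ℕ}
    {g : SemidirectGroupoid T} (hg : g ∈ repSet T m n) :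
    (semidirectGroupoid hT hDC).inv g ∈ repSet T n m := by
  obtain ⟨hk, w, h1, h2⟩ := hg
  exact ⟨fun j => by simp [semidirectGroupoid, hk], w, h2, h1⟩

theorem unit_mem_repSet (hT : IsMGDS T) (hDC : DomainCondition T) (x : X) :
    (semidirectGroupoid hT hDC).unit x ∈ repSet T 0 0 :=
  ⟨fun j => by simp [semidirectGroupoid], x, by simp [semidirectGroupoid, hT.zero],
    by simp [semidirectGroupoid, hT.zero]⟩

theorem semidirect_continuous_inv (hT : IsMGDS T) (hDC : DomainCondition T) :
    Continuous (semidirectGroupoid hT hDC).inv := by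
  refine continuous_iff_continuousAt.2 fun g => ?_
  obtain ⟨m, n, hg⟩ := exists_mem_repSet g
  refine semidirect_tendsto hT hDC (inv_mem_repSet hT hDC hg) ?_
    ((continuous_snd.comp (continuous_range_source hT)).tendsto g)
    ((continuous_fst.comp (continuous_range_source hT)).tendsto g)
  filter_upwards [(isOpen_repSet hT m n).mem_nhds hg] with h hh using inv_mem_repSet hT hDC hh

theorem isLocalHomeomorph_range (hT : IsMGDS T) (hDC : DomainCondition T) :
    IsLocalHomeomorph (semidirectGroupoid hT hDC).r := by
  classical
  refine IsLocalHomeomorph.mk _ fun g => ?_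
  obtain ⟨m, n, hg⟩ := exists_mem_repSet g
  obtain ⟨hk, w, h1, h2⟩ := id hg
  obtain ⟨e₁, hx, he₁⟩ := (hT.localHomeo m).2 _ ((PFun.mem_dom _ _).2 ⟨w, h1⟩)
  obtain ⟨e₂, hy, he₂⟩ := (hT.localHomeo n).2 _ ((PFun.mem_dom _ _).2 ⟨w, h2⟩)
  -- Near `g` the source is a function of the range, namely `y = e₂⁻¹ (e₁ x)`, which provides the
  -- local inverse of the range map.
  let e := e₁.trans e₂.symm
  have hmem : ∀ x ∈ e.source, e₁ x ∈ T m x ∧ e₁ x ∈ T n (e x) ∧ e x ∈ e₂.source := by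
    intro x hxe
    rw [OpenPartialHomeomorph.trans_source] at hxe
    have h3 : e x ∈ e₂.source := e₂.map_target hxe.2
    refine ⟨he₁ x hxe.1, ?_, h3⟩
    have h4 := he₂ _ h3
    have h5 : e₂ (e x) = e₁ x := e₂.right_inv hxe.2
    rwa [h5] at h4
  let sec : X → SemidirectGroupoid T := fun x => if h : x ∈ e.source then
    ⟨(x, g.1.2.1, e x), m, n, hk, e₁ x, (hmem x h).1, (hmem x h).2.1⟩ else g
  have hsec : ∀ x (h : x ∈ e.source), (sec x).1 = (x, g.1.2.1, e x) := by
    intro x h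
    exact congrArg Subtype.val (dif_pos h)
  have hsecrep : ∀ x ∈ e.source, sec x ∈ repSet T m n := by
    intro x h
    refine ⟨?_, e₁ x, ?_, ?_⟩
    · rw [hsec x h]; exact hk
    · rw [hsec x h]; exact (hmem x h).1
    · rw [hsec x h]; exact (hmem x h).2.1
  have hsrc : ∀ h : SemidirectGroupoid T, h ∈ repSet T m n → h.1.1 ∈ e₁.source →
      h.1.2.2 ∈ e₂.source → h.1.1 ∈ e.source ∧ e h.1.1 = h.1.2.2 := by
    rintro h ⟨-, v, hv1, hv2⟩ ha hb
    have h3 : e₁ h.1.1 = e₂ h.1.2.2 :=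
      (Part.mem_unique (he₁ _ ha) hv1).trans (Part.mem_unique (he₂ _ hb) hv2).symm
    constructor
    · rw [OpenPartialHomeomorph.trans_source]
      refine ⟨ha, ?_⟩
      rw [Set.mem_preimage, OpenPartialHomeomorph.symm_source, h3]
      exact e₂.map_source hb
    · change e₂.symm (e₁ h.1.1) = h.1.2.2
      rw [h3, e₂.left_inv hb]
  have hcr : Continuous fun g : SemidirectGroupoid T => g.1.1 :=
    (continuous_range_source hT).fst
  have hcs : Continuous fun g : SemidirectGroupoid T => g.1.2.2 :=
    (continuous_range_source hT).snd
  refine ⟨{ toFun := fun h => h.1.1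
            invFun := sec
            source := repSet T m n ∩ ((fun h => h.1.1) ⁻¹' e₁.source ∩ (fun h => h.1.2.2) ⁻¹' e₂.source)
            target := e.source
            map_source' := fun h hh => (hsrc h hh.1 hh.2.1 hh.2.2).1
            map_target' := fun x hx => ⟨hsecrep x hx, ?_, ?_⟩
            left_inv' := fun h hh => ?_
            right_inv' := fun x hx => ?_
            open_source := (isOpen_repSet hT m n).inter
              ((e₁.open_source.preimage hcr).inter (e₂.open_source.preimage hcs))
            open_target := e.open_source
            continuousOn_toFun := hcr.continuousOn
            continuousOn_invFun := fun x hx => ?_ }, ⟨hg, hx, hy⟩, fun h _ => rfl⟩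
  · change (sec x).1.1 ∈ e₁.source
    rw [hsec x hx]
    rw [OpenPartialHomeomorph.trans_source] at hx
    exact hx.1
  · change (sec x).1.2.2 ∈ e₂.source
    rw [hsec x hx]
    exact (hmem x hx).2.2
  · obtain ⟨h3, h4⟩ := hsrc h hh.1 hh.2.1 hh.2.2
    refine Subtype.ext ?_
    change (sec h.1.1).1 = h.1
    rw [hsec _ h3, h4, eq_of_mem_repSet hg hh.1]
  · rw [hsec x hx]
  · have hev : ∀ᶠ y in 𝓝 x, y ∈ e.source := e.open_source.mem_nhds hx
    refine ContinuousAt.continuousWithinAt (semidirect_tendsto hT hDC (hsecrep x hx)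
      (hev.mono hsecrep) ?_ ?_)
    · rw [hsec x hx]
      refine tendsto_id.congr' (hev.mono fun y hy => ?_)
      exact (congrArg Prod.fst (hsec y hy)).symm
    · rw [hsec x hx]
      refine (e.continuousAt hx).tendsto.congr' (hev.mono fun y hy => ?_)
      exact (congrArg (fun p => p.2.2) (hsec y hy)).symm

theorem IsLocalHomeomorph.locallyCompactSpace {Y Z : Type*} [TopologicalSpace Y]
    [TopologicalSpace Z] [LocallyCompactSpace Z] {f : Y → Z} (hf : IsLocalHomeomorph f) :
    LocallyCompactSpace Y := by
  refine ⟨fun y N hN => ?_⟩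
  obtain ⟨e, hy, -⟩ := hf y
  have h1 : e.target ∩ e.symm ⁻¹' N ∈ 𝓝 (e y) := by
    refine inter_mem (e.open_target.mem_nhds (e.map_source hy)) ?_
    refine (e.symm.continuousAt (e.map_source hy)).preimage_mem_nhds ?_
    rwa [e.left_inv hy]
  obtain ⟨K, hK, hKN, hKc⟩ := local_compact_nhds h1
  refine ⟨e.symm '' K, ?_, ?_, hKc.image_of_continuousOn
    (e.symm.continuousOn.mono fun z hz => (hKN hz).1)⟩
  · have h2 := e.symm.map_nhds_eq (e.map_source hy)
    rw [e.left_inv hy] at h2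
    rw [← h2]
    exact image_mem_map hK
  · rintro _ ⟨z, hz, rfl⟩
    exact (hKN hz).2

/-- The semidirect product groupoid of a system with (DC) on a locally compact Hausdorff space is
étale. -/
theorem semidirectGroupoid_isEtale [T2Space X] [LocallyCompactSpace X] (hT : IsMGDS T)
    (hDC : DomainCondition T) : (semidirectGroupoid hT hDC).IsEtale where
  t2 := by
    -- The degree is constant on each open set `repSet T m n`; together with range and source it
    -- gives a continuous injection into a Hausdorff space.
    have hk : Continuous fun g : SemidirectGroupoid T => g.1.2.1 := by
      refine continuous_iff_continuousAt.2 fun g => ?_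
      obtain ⟨m, n, hg⟩ := exists_mem_repSet g
      refine (continuousAt_const (y := g.1.2.1)).congr ?_
      filter_upwards [(isOpen_repSet hT m n).mem_nhds hg] with h hh using eq_of_mem_repSet hg hh
    refine T2Space.of_injective_continuous
      (f := fun g : SemidirectGroupoid T => ((g.1.1, g.1.2.2), g.1.2.1)) ?_
      ((continuous_range_source hT).prodMk hk)
    intro g h hgh
    simp only [Prod.mk.injEq] at hgh
    exact Subtype.ext (Prod.ext hgh.1.1 (Prod.ext hgh.2 hgh.1.2))
  locallyCompact := (isLocalHomeomorph_range hT hDC).locallyCompactSpace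
  continuous_unit := continuous_iff_continuousAt.2 fun x =>
    semidirect_tendsto hT hDC (unit_mem_repSet hT hDC x)
      (Eventually.of_forall (unit_mem_repSet hT hDC)) tendsto_id tendsto_id
  continuous_inv := semidirect_continuous_inv hT hDC
  continuous_mul := by
    refine continuous_iff_continuousAt.2 fun p => ?_
    obtain ⟨m, n, hg⟩ := exists_mem_repSet p.1.1
    obtain ⟨m', n', hh⟩ := exists_mem_repSet p.1.2
    have c1 : Continuous fun p : {p : SemidirectGroupoid T × SemidirectGroupoid T //
        (semidirectGroupoid hT hDC).s p.1 = (semidirectGroupoid hT hDC).r p.2} => p.1.1 :=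
      continuous_fst.comp continuous_subtype_val
    have c2 : Continuous fun p : {p : SemidirectGroupoid T × SemidirectGroupoid T //
        (semidirectGroupoid hT hDC).s p.1 = (semidirectGroupoid hT hDC).r p.2} => p.1.2 :=
      continuous_snd.comp continuous_subtype_val
    refine semidirect_tendsto hT hDC (mul_mem_repSet hT hDC hg hh p.2) ?_
      ((continuous_fst.comp ((continuous_range_source hT).comp c1)).tendsto p)
      ((continuous_snd.comp ((continuous_range_source hT).comp c2)).tendsto p)
    filter_upwards [((isOpen_repSet hT m n).preimage c1).mem_nhds hg,
      ((isOpen_repSet hT m' n').preimage c2).mem_nhds hh] with q h1 h2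
    exact mul_mem_repSet hT hDC h1 h2 q.2
  isLocalHomeomorph_r := isLocalHomeomorph_range hT hDC
  isLocalHomeomorph_s := by
    let e : SemidirectGroupoid T ≃ₜ SemidirectGroupoid T :=
      { toFun := (semidirectGroupoid hT hDC).inv
        invFun := (semidirectGroupoid hT hDC).inv
        left_inv := (semidirectGroupoid hT hDC).inv_inv
        right_inv := (semidirectGroupoid hT hDC).inv_inv
        continuous_toFun := semidirect_continuous_inv hT hDC
        continuous_invFun := semidirect_continuous_inv hT hDC }
    exact (isLocalHomeomorph_range hT hDC).comp e.isLocalHomeomorph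

end Semidirect

namespace HigherRankGraph

variable {r : ℕ} {V Λ : Type*} {Γ : HigherRankGraph r V Λ}

/-! ### Factorizations -/

theorem comp_congr {l l' m m' : Λ} (hl : l = l') (hm : m = m') (h : Γ.s l = Γ.t m)
    (h' : Γ.s l' = Γ.t m') : Γ.comp l m h = Γ.comp l' m' h' := by
  subst hl hm; rfl

/-- When the left shapes agree, so do the right ones, and both pairs are the unique factorization of
the product for these shapes. -/
theorem comp_injective {l l' m m' : Λ} {h : Γ.s l = Γ.t m} {h' : Γ.s l' = Γ.t m'}
    (hσ : Γ.σ l = Γ.σ l') (e : Γ.comp l m h = Γ.comp l' m' h') : l = l' ∧ m = m' := by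
  have h1 := Γ.σ_comp l m h
  have h2 := Γ.σ_comp l' m' h'
  rw [e, h2, hσ] at h1
  have h3 : Γ.σ m = Γ.σ m' := (add_left_cancel h1).symm
  have h4 := (Γ.factorization (Γ.comp l m h) (Γ.σ l) (Γ.σ m) (Γ.σ_comp l m h)).unique
    (y₁ := (l, m)) (y₂ := (l', m')) ⟨rfl, rfl, h, rfl⟩ ⟨hσ.symm, h3.symm, h', e.symm⟩
  exact ⟨congrArg Prod.fst h4, congrArg Prod.snd h4⟩

theorem comp_injective_right {l l' m m' : Λ} {h : Γ.s l = Γ.t m} {h' : Γ.s l' = Γ.t m'}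
    (hσ : Γ.σ m = Γ.σ m') (e : Γ.comp l m h = Γ.comp l' m' h') : l = l' ∧ m = m' := by
  refine comp_injective ?_ e
  have h1 := Γ.σ_comp l m h
  rw [e, Γ.σ_comp, hσ] at h1
  exact (add_right_cancel h1).symm

theorem exists_factor (l : Λ) (a b : Fin r → ℕ) (h : Γ.σ l = a + b) :
    ∃ p q, Γ.σ p = a ∧ Γ.σ q = b ∧ ∃ e, Γ.comp p q e = l := by
  obtain ⟨⟨p, q⟩, ⟨h1, h2, h3⟩, -⟩ := Γ.factorization l a b h
  exact ⟨p, q, h1, h2, h3⟩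

/-- Both `t(l) l` and `l s(l)` factor `l` into two morphisms of shape `0`. Thus the morphisms of
shape `0` are exactly the objects. -/
theorem id_t_of_σ_eq_zero {l : Λ} (h : Γ.σ l = 0) : Γ.id (Γ.t l) = l :=
  (comp_injective ((Γ.σ_id _).trans h.symm)
    ((Γ.id_comp l).trans (Γ.comp_id l).symm)).1

theorem id_s_of_σ_eq_zero {l : Λ} (h : Γ.σ l = 0) : Γ.id (Γ.s l) = l :=
  (comp_injective (h.trans (Γ.σ_id _).symm) ((Γ.comp_id l).trans (Γ.id_comp l).symm)).2

theorem t_eq_s_of_σ_eq_zero {l : Λ} (h : Γ.σ l = 0) : Γ.t l = Γ.s l := by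
  have h1 := congrArg Γ.t (id_s_of_σ_eq_zero h)
  rw [Γ.t_id] at h1
  exact h1.symm

theorem id_injective {v w : V} (h : Γ.id v = Γ.id w) : v = w := by
  rw [← Γ.t_id v, h, Γ.t_id]

theorem comp_of_σ_eq_zero_right {l m : Λ} (h : Γ.s l = Γ.t m) (hm : Γ.σ m = 0) :
    Γ.comp l m h = l := by
  rw [comp_congr (Γ := Γ) rfl ((id_t_of_σ_eq_zero hm).symm.trans (congrArg Γ.id h.symm)) h
    (Γ.t_id _).symm, Γ.comp_id]

theorem comp_of_σ_eq_zero_left {l m : Λ} (h : Γ.s l = Γ.t m) (hl : Γ.σ l = 0) :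
    Γ.comp l m h = m := by
  rw [comp_congr (Γ := Γ) ((id_s_of_σ_eq_zero hl).symm.trans (congrArg Γ.id h)) rfl h
    (Γ.s_id _), Γ.id_comp]

variable (Γ) in
/-- `l = p q` for some `q`. -/
def IsPrefix (p l : Λ) : Prop := ∃ q h, Γ.comp p q h = l

theorem IsPrefix.eq_of_σ_eq {p p' l : Λ} (h : Γ.IsPrefix p l) (h' : Γ.IsPrefix p' l)
    (hσ : Γ.σ p = Γ.σ p') : p = p' := by
  obtain ⟨q, e, hq⟩ := h
  obtain ⟨q', e', hq'⟩ := h'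
  exact (comp_injective hσ (hq.trans hq'.symm)).1

theorem IsPrefix.trans {p l k : Λ} (h : Γ.IsPrefix p l) (h' : Γ.IsPrefix l k) :
    Γ.IsPrefix p k := by
  obtain ⟨q, e, rfl⟩ := h
  obtain ⟨q', e', rfl⟩ := h'
  exact ⟨_, _, (Γ.assoc p q q' e ((Γ.s_comp p q e).symm.trans e')).symm⟩

theorem IsPrefix.of_comp {l q q' : Λ} (h : Γ.s l = Γ.t q) (h' : Γ.s l = Γ.t q')
    (hq : Γ.IsPrefix q q') : Γ.IsPrefix (Γ.comp l q h) (Γ.comp l q' h') := by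
  obtain ⟨p, e, rfl⟩ := hq
  exact ⟨p, _, Γ.assoc l q p h e⟩

theorem isPrefix_comp {l m : Λ} (h : Γ.s l = Γ.t m) : Γ.IsPrefix l (Γ.comp l m h) := ⟨m, h, rfl⟩

theorem exists_isPrefix {l : Λ} {k : Fin r → ℕ} (h : k ≤ Γ.σ l) :
    ∃ p, Γ.σ p = k ∧ Γ.IsPrefix p l := by
  obtain ⟨p, q, h1, -, h3⟩ := Γ.exists_factor l k (Γ.σ l - k) (add_tsub_cancel_of_le h).symm
  exact ⟨p, h1, q, h3⟩

theorem IsPrefix.of_le {p p' l : Λ} (h : Γ.IsPrefix p l) (h' : Γ.IsPrefix p' l)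
    (hσ : Γ.σ p ≤ Γ.σ p') : Γ.IsPrefix p p' := by
  obtain ⟨a, ha, hap⟩ := exists_isPrefix hσ
  obtain rfl := h.eq_of_σ_eq (hap.trans h') ha.symm
  exact hap

/-! ### Infinite paths -/

namespace InfPath

theorem seg_congr (x : Γ.InfPath) {n n' m m' : Fin r → ℕ} (hn : n = n') (hm : m = m') (h : n ≤ m)
    (h' : n' ≤ m') : x.seg n m h = x.seg n' m' h' := by
  subst hn hm; rfl

theorem σ_init (x : Γ.InfPath) (k : Fin r → ℕ) : Γ.σ (x.init k) = k := by
  rw [← zero_add (Γ.σ (x.init k))]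
  exact x.σ_seg 0 k zero_le

theorem isPrefix_init (x : Γ.InfPath) {n m : Fin r → ℕ} (h : n ≤ m) :
    Γ.IsPrefix (x.init n) (x.init m) := by
  obtain ⟨e, he⟩ := x.seg_comp 0 n m zero_le h
  exact ⟨_, e, he⟩

theorem t_init (x : Γ.InfPath) (k : Fin r → ℕ) : Γ.t (x.init k) = x.t := by
  obtain ⟨q, e, he⟩ := x.isPrefix_init (zero_le (a := k))
  rw [← he, Γ.t_comp]
  rfl

theorem init_zero (x : Γ.InfPath) : x.init 0 = Γ.id x.t :=
  (id_t_of_σ_eq_zero (x.σ_init 0)).symm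

theorem ext_init {x y : Γ.InfPath} (h : ∀ k, x.init k = y.init k) : x = y := by
  refine InfPath.ext (funext fun n => funext fun m => funext fun hnm => ?_)
  obtain ⟨e, he⟩ := x.seg_comp 0 n m zero_le hnm
  obtain ⟨e', he'⟩ := y.seg_comp 0 n m zero_le hnm
  have h1 : x.seg 0 n zero_le = y.seg 0 n zero_le := h n
  have h2 : x.seg 0 m zero_le = y.seg 0 m zero_le := h m
  exact (comp_injective (congrArg Γ.σ h1) (he.trans (h2.trans he'.symm))).2

/-- The infinite path with given initial segments. -/
def ofInit (l : (Fin r → ℕ) → Λ) (hσ : ∀ k, Γ.σ (l k) = k)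
    (hl : ∀ n m, n ≤ m → Γ.IsPrefix (l n) (l m)) : Γ.InfPath where
  seg n m h := (hl n m h).choose
  σ_seg n m h := by
    obtain ⟨e, he⟩ := (hl n m h).choose_spec
    have h1 := congrArg Γ.σ he
    rw [Γ.σ_comp, hσ, hσ] at h1
    exact h1
  seg_comp n m k h h' := by
    obtain ⟨e1, he1⟩ := (hl n m h).choose_spec
    obtain ⟨e2, he2⟩ := (hl m k h').choose_spec
    obtain ⟨e3, he3⟩ := (hl n k (h.trans h')).choose_spec
    have h4 : Γ.s (hl n m h).choose = Γ.t (hl m k h').choose := by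
      rw [← e2, ← Γ.s_comp _ _ e1, he1]
    refine ⟨h4, ?_⟩
    have h5 := Γ.assoc (l n) _ _ e1 h4
    exact (comp_injective rfl (h5.symm.trans
      ((comp_congr he1 rfl _ e2).trans (he2.trans he3.symm)))).2

theorem init_ofInit (l : (Fin r → ℕ) → Λ) (hσ : ∀ k, Γ.σ (l k) = k)
    (hl : ∀ n m, n ≤ m → Γ.IsPrefix (l n) (l m)) (k : Fin r → ℕ) :
    (ofInit l hσ hl).init k = l k := by
  obtain ⟨e, he⟩ := (hl 0 k zero_le).choose_spec
  rw [comp_of_σ_eq_zero_left e (hσ 0)] at he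
  exact he

theorem comp_init_shift (x : Γ.InfPath) (k m : Fin r → ℕ) :
    ∃ e : Γ.s (x.init k) = Γ.t ((x.shift k).init m),
      Γ.comp (x.init k) ((x.shift k).init m) e = x.init (m + k) := by
  obtain ⟨e, he⟩ := x.seg_comp 0 (0 + k) (m + k) zero_le (add_le_add_left zero_le k)
  have h1 : x.seg 0 (0 + k) zero_le = x.init k := x.seg_congr rfl (zero_add k) _ _
  have e' : Γ.s (x.init k) = Γ.t ((x.shift k).init m) := by
    rw [← h1]; exact e
  exact ⟨e', (comp_congr h1.symm rfl e' e).trans he⟩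

theorem t_shift (x : Γ.InfPath) (k : Fin r → ℕ) : (x.shift k).t = Γ.s (x.init k) := by
  obtain ⟨e, -⟩ := x.comp_init_shift k 0
  exact e.symm

theorem shift_shift (x : Γ.InfPath) (a b : Fin r → ℕ) :
    (x.shift a).shift b = x.shift (a + b) := by
  refine InfPath.ext (funext fun n => funext fun m => funext fun h => ?_)
  exact x.seg_congr (by rw [add_assoc, add_comm b]) (by rw [add_assoc, add_comm b]) _ _

theorem shift_zero (x : Γ.InfPath) : x.shift 0 = x :=
  InfPath.ext (funext fun n => funext fun m => funext fun _ =>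
    x.seg_congr (add_zero n) (add_zero m) _ _)

theorem eq_of_init_shift {x y : Γ.InfPath} {k : Fin r → ℕ} (h1 : x.init k = y.init k)
    (h2 : x.shift k = y.shift k) : x = y := by
  refine ext_init fun m => ?_
  obtain ⟨e, he⟩ := x.comp_init_shift k m
  obtain ⟨e', he'⟩ := y.comp_init_shift k m
  have h3 : x.init (m + k) = y.init (m + k) := by
    rw [← he, ← he']
    exact comp_congr h1 (by rw [h2]) _ _
  have h4 := y.isPrefix_init (le_self_add (a := m) (b := k))
  rw [← h3] at h4
  exact (x.isPrefix_init le_self_add).eq_of_σ_eq h4 ((x.σ_init m).trans (y.σ_init m).symm)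

theorem IsPrepend.unique {l : Λ} {y z z' : Γ.InfPath} (h : IsPrepend l y z)
    (h' : IsPrepend l y z') : z = z' :=
  eq_of_init_shift (h.1.trans h'.1.symm) (h.2.trans h'.2.symm)

/-- The initial segment of `l y` of shape `k` is taken to be the prefix of shape `k` of `l y(0, k)`.
These prefixes are nested by unique factorization, hence form an infinite path. -/
theorem exists_isPrepend {l : Λ} {y : Γ.InfPath} (h : Γ.s l = y.t) :
    ∃ z, IsPrepend l y z := by
  have hk : ∀ k, Γ.s l = Γ.t (y.init k) := fun k => h.trans (y.t_init k).symm
  have hσ : ∀ k, Γ.σ (Γ.comp l (y.init k) (hk k)) = Γ.σ l + k := fun k => by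
    rw [Γ.σ_comp, σ_init]
  choose p hp1 hp2 using fun k : Fin r → ℕ =>
    exists_isPrefix (Γ := Γ) (l := Γ.comp l (y.init k) (hk k)) (k := k)
      (by rw [hσ]; exact le_add_self)
  have hpre : ∀ n m, n ≤ m → Γ.IsPrefix (p n) (p m) := by
    intro n m hnm
    refine IsPrefix.of_le ((hp2 n).trans
      (IsPrefix.of_comp (hk n) (hk m) (y.isPrefix_init hnm))) (hp2 m) ?_
    rw [hp1, hp1]
    exact hnm
  have h1 : p (Γ.σ l) = l :=
    (hp2 _).eq_of_σ_eq (isPrefix_comp (hk _)) (hp1 _)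
  refine ⟨ofInit p hp1 hpre, (init_ofInit p hp1 hpre _).trans h1, ext_init fun m => ?_⟩
  obtain ⟨e, he⟩ := (ofInit p hp1 hpre).comp_init_shift (Γ.σ l) m
  have h2 : p (m + Γ.σ l) = Γ.comp l (y.init m) (hk m) := by
    refine (hp2 _).eq_of_σ_eq (IsPrefix.of_comp (hk m) (hk _) (y.isPrefix_init le_self_add)) ?_
    rw [hp1, hσ, add_comm]
  exact (comp_injective (by rw [init_ofInit, h1])
    (he.trans ((init_ofInit p hp1 hpre _).trans h2))).2

theorem IsPrepend.t_eq {l : Λ} {y z : Γ.InfPath} (h : IsPrepend l y z) : z.t = Γ.t l := by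
  rw [← z.t_init (Γ.σ l), h.1]

theorem IsPrepend.s_eq {l : Λ} {y z : Γ.InfPath} (h : IsPrepend l y z) : Γ.s l = y.t := by
  rw [← h.2, t_shift, h.1]

theorem isPrepend_init (z : Γ.InfPath) (k : Fin r → ℕ) :
    IsPrepend (z.init k) (z.shift k) z := by
  constructor <;> rw [σ_init]

/-! ### The topology of the infinite path space -/

open Filter Topology

theorem isLocallyConstant_init (k : Fin r → ℕ) :
    IsLocallyConstant fun x : Γ.InfPath => x.init k := by
  refine (IsLocallyConstant.iff_exists_open _).2 fun x => ⟨{y | y.init k = x.init k}, ?_, rfl,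
    fun y hy => hy⟩
  exact TopologicalSpace.isOpen_generateFrom_of_mem ⟨k, _, rfl⟩

theorem isClopen_init (k : Fin r → ℕ) (A : Set Λ) : IsClopen {x : Γ.InfPath | x.init k ∈ A} :=
  ⟨⟨isLocallyConstant_init k Aᶜ⟩, isLocallyConstant_init k A⟩

theorem continuous_of_init {Y : Type*} [TopologicalSpace Y] {f : Y → Γ.InfPath}
    (h : ∀ k, IsLocallyConstant fun y => (f y).init k) : Continuous f := by
  refine continuous_generateFrom_iff.2 ?_
  rintro _ ⟨k, l, rfl⟩
  exact (h k).isOpen_fiber l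

theorem isLocallyConstant_t : IsLocallyConstant fun x : Γ.InfPath => x.t :=
  (isLocallyConstant_init 0).comp Γ.t

theorem shift_init_eq {x y : Γ.InfPath} {k m : Fin r → ℕ} (h : x.init (m + k) = y.init (m + k)) :
    (x.shift k).init m = (y.shift k).init m := by
  obtain ⟨e, he⟩ := x.comp_init_shift k m
  obtain ⟨e', he'⟩ := y.comp_init_shift k m
  exact (comp_injective ((x.σ_init k).trans (y.σ_init k).symm)
    (he.trans (h.trans he'.symm))).2

theorem continuous_shift (k : Fin r → ℕ) : Continuous fun x : Γ.InfPath => x.shift k := by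
  refine continuous_of_init fun m => (IsLocallyConstant.iff_eventually_eq _).2 fun x => ?_
  filter_upwards [(IsLocallyConstant.iff_eventually_eq _).1 (isLocallyConstant_init (m + k)) x]
    with y hy using shift_init_eq hy

instance : T2Space Γ.InfPath := by
  refine ⟨fun x y hxy => ?_⟩
  obtain ⟨k, hk⟩ : ∃ k, x.init k ≠ y.init k := by
    by_contra! h
    exact hxy (ext_init h)
  refine ⟨{z | z.init k ∈ ({x.init k} : Set Λ)}, {z | z.init k ∈ ({x.init k} : Set Λ)}ᶜ,
    (isClopen_init k _).isOpen, (isClopen_init k _).compl.isOpen, rfl, fun h => hk h.symm,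
    disjoint_compl_right⟩

/-- The families of nested initial segments form a closed subset of a product of finite discrete
sets, and assembling them into paths is a continuous surjection. -/
theorem compactSpace (hΓ : Γ.FinitenessCondition) : CompactSpace Γ.InfPath := by
  let F : (Fin r → ℕ) → Type _ := fun k => {l : Λ // Γ.σ l = k}
  let _ : ∀ k, TopologicalSpace (F k) := fun k => ⊥
  have _ : ∀ k, DiscreteTopology (F k) := fun k => ⟨rfl⟩
  have _ : ∀ k, Finite (F k) := fun k => hΓ.finite k
  let S : Set (∀ k, F k) := {f | ∀ n m, n ≤ m → Γ.IsPrefix (f n).1 (f m).1}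
  have hS : IsClosed S := by
    simp only [S, Set.ofPred_forall]
    refine isClosed_iInter fun n => isClosed_iInter fun m => isClosed_iInter fun _ => ?_
    have hc : Continuous fun f : ∀ k, F k => (f n, f m) :=
      (continuous_apply n).prodMk (continuous_apply m)
    exact (isClosed_discrete {p : F n × F m | Γ.IsPrefix p.1.1 p.2.1}).preimage hc
  have _ : CompactSpace S := isCompact_iff_compactSpace.1 hS.isCompact
  let e : S → Γ.InfPath := fun f => ofInit (fun k => (f.1 k).1) (fun k => (f.1 k).2) f.2
  have he : Continuous e := by
    refine continuous_of_init fun k => ?_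
    have h1 : (fun f : S => (e f).init k) = fun f : S => (f.1 k).1 :=
      funext fun f => init_ofInit _ _ _ k
    rw [h1]
    have h2 : IsLocallyConstant fun f : S => f.1 k :=
      (IsLocallyConstant.iff_continuous _).2 ((continuous_apply k).comp continuous_subtype_val)
    exact h2.comp Subtype.val
  refine Function.Surjective.compactSpace he ?_
  intro x
  refine ⟨⟨fun k => ⟨x.init k, x.σ_init k⟩, fun n m h => x.isPrefix_init h⟩, ?_⟩
  exact ext_init fun k => init_ofInit _ _ _ k

end InfPath

theorem FinitenessCondition.finite_objects (hΓ : Γ.FinitenessCondition) : Finite V := by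
  have : Finite {l : Λ // Γ.σ l = 0} := hΓ.finite 0
  exact Finite.of_injective (fun v => (⟨Γ.id v, Γ.σ_id v⟩ : {l : Λ // Γ.σ l = 0}))
    fun v w h => id_injective (congrArg Subtype.val h :)

end HigherRankGraph

/-! ### Partial isometries of partial injections -/

section PartialInjections

variable {I : Type*}

/-- A partially defined map which is injective on its domain. -/
def PartialInjective (a : I → Option I) : Prop := ∀ i j k, a i = some k → a j = some k → i = j

open Classical in
/-- The inverse of a partially defined injective map. -/
def partialInv (a : I → Option I) (k : I) : Option I :=
  if h : ∃ i, a i = some k then some h.choose else none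

theorem PartialInjective.partialInv_eq_some {a : I → Option I} (ha : PartialInjective a) {i k : I} :
    partialInv a k = some i ↔ a i = some k := by
  unfold partialInv
  constructor
  · intro h
    split_ifs at h with h1
    obtain rfl := Option.some.inj h
    exact h1.choose_spec
  · intro h
    have h1 : ∃ i, a i = some k := ⟨i, h⟩
    rw [dif_pos h1, ha _ _ _ h1.choose_spec h]

theorem PartialInjective.partialInv {a : I → Option I} (ha : PartialInjective a) :
    PartialInjective (partialInv a) := by
  intro i j k hi hj
  rw [ha.partialInv_eq_some] at hi hj
  exact Option.some.inj (hi.symm.trans hj)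

open Classical in
theorem PartialInjective.partialIsometry_entry {a : I → Option I} (ha : PartialInjective a)
    (i k : I) :
    (partialIsometry a (basisVec i) : I → ℂ) k = if a i = some k then 1 else 0 := by
  change partialIsometryFun a (basisVec i) k = _
  unfold partialIsometryFun
  by_cases h : a i = some k
  · have h1 : ∃ i, a i = some k := ⟨i, h⟩
    rw [dif_pos h1, if_pos h, ha _ _ _ h1.choose_spec h, basisVec_apply_self]
  · rw [if_neg h]
    split_ifs with h1
    · refine basisVec_apply_ne fun h2 => h ?_
      rw [← h2]
      exact h1.choose_spec
    · rfl

theorem PartialInjective.star_partialIsometry {a : I → Option I} (ha : PartialInjective a) :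
    star (partialIsometry a) = partialIsometry (_root_.partialInv a) := by
  classical
  refine HilbertL2.ext_matrix fun u t => ?_
  rw [apply_basisVec_eq_conj, ha.partialIsometry_entry, ha.partialInv.partialIsometry_entry]
  simp only [ha.partialInv_eq_some]
  split_ifs <;> simp

theorem PartialInjective.partialIsometry_apply_some {a : I → Option I} (ha : PartialInjective a)
    {i k : I} (h : a i = some k) : partialIsometry a (basisVec i) = basisVec k := by
  classical
  ext j
  rw [ha.partialIsometry_entry]
  by_cases hj : j = k
  · subst hj
    rw [if_pos h, basisVec_apply_self]
  · rw [if_neg, basisVec_apply_ne hj]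
    intro h'
    exact hj (Option.some.inj (h'.symm.trans h))

theorem PartialInjective.partialIsometry_apply_none {a : I → Option I} (ha : PartialInjective a)
    {i : I} (h : a i = none) : partialIsometry a (basisVec i) = 0 := by
  classical
  ext j
  rw [ha.partialIsometry_entry, h]
  simp

theorem PartialInjective.conj_apply_some {a : I → Option I} (ha : PartialInjective a)
    {f : HilbertL2 I →L[ℂ] HilbertL2 I} (hf : IsDiagonal f) {i k : I} (h : a i = some k) :
    (star (partialIsometry a) * f * partialIsometry a) (basisVec i) =
      (f (basisVec k) : I → ℂ) k • basisVec i := by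
  change star (partialIsometry a) (f (partialIsometry a (basisVec i))) = _
  rw [ha.partialIsometry_apply_some h, ha.star_partialIsometry]
  conv_lhs => rw [hf.apply_basisVec]
  rw [map_smul, ha.partialInv.partialIsometry_apply_some (ha.partialInv_eq_some.2 h)]

theorem PartialInjective.conj_apply_none {a : I → Option I} (ha : PartialInjective a)
    (f : HilbertL2 I →L[ℂ] HilbertL2 I) {i : I} (h : a i = none) :
    (star (partialIsometry a) * f * partialIsometry a) (basisVec i) = 0 := by
  change star (partialIsometry a) (f (partialIsometry a (basisVec i))) = _
  rw [ha.partialIsometry_apply_none h, map_zero, map_zero]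

theorem PartialInjective.isDiagonal_conj {a : I → Option I} (ha : PartialInjective a)
    {f : HilbertL2 I →L[ℂ] HilbertL2 I} (hf : IsDiagonal f) :
    IsDiagonal (star (partialIsometry a) * f * partialIsometry a) := by
  intro i j hij
  cases h : a j with
  | none => rw [ha.conj_apply_none f h]; rfl
  | some k =>
    rw [ha.conj_apply_some hf h]
    simp [basisVec_apply_ne hij]

theorem isClosed_diagonalOperators :
    IsClosed (diagonalOperators I : Set (HilbertL2 I →L[ℂ] HilbertL2 I)) := by
  have h : (diagonalOperators I : Set (HilbertL2 I →L[ℂ] HilbertL2 I)) =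
      ⋂ (i) (j) (_ : i ≠ j), {A | inner ℂ (basisVec i) (A (basisVec j)) = 0} := by
    ext A
    simp only [Set.mem_iInter, Set.mem_ofPred_eq, inner_basisVec]
    rfl
  rw [h]
  refine isClosed_iInter fun i => isClosed_iInter fun j => isClosed_iInter fun _ => ?_
  exact isClosed_eq (continuous_const.inner (continuous_eval_const _))
    continuous_const

end PartialInjections

/-- A set of characters which separates the elements of a commutative C⋆-algebra from `0` is
dense. -/
theorem WeakDual.CharacterSpace.dense_of_separating {A : Type*} [CommCStarAlgebra A]
    (S : Set (WeakDual.characterSpace ℂ A)) (hS : ∀ a : A, (∀ φ ∈ S, φ a = 0) → a = 0) :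
    Dense S := by
  rw [dense_iff_closure_eq]
  by_contra h
  obtain ⟨x, hx⟩ := (Set.ne_univ_iff_exists_notMem _).1 h
  obtain ⟨f, hf0, hf1, -⟩ := exists_continuous_zero_one_of_isClosed
    (isClosed_closure (s := S)) (isClosed_singleton (x := x))
    (Set.disjoint_singleton_right.2 hx)
  -- A Urysohn function that vanishes on the closure of `S` but not at `x` is the Gelfand transform
  -- of some `a`; this `a` is annihilated by `S`, hence zero.
  let F : C(WeakDual.characterSpace ℂ A, ℂ) := ⟨fun y => (f y : ℂ), by fun_prop⟩
  obtain ⟨a, ha⟩ := (gelfandTransform_bijective A).2 F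
  have hv : ∀ y : WeakDual.characterSpace ℂ A, y a = (f y : ℂ) := fun y =>
    congrArg (fun F : C(WeakDual.characterSpace ℂ A, ℂ) => F y) ha
  have h0 : a = 0 := hS a fun φ hφ => by
    rw [hv, hf0 (subset_closure hφ)]
    simp
  have h1 := hv x
  rw [hf1 rfl, h0, map_zero] at h1
  simp at h1

theorem Continuous.if_isClopen {X Y : Type*} [TopologicalSpace X] [TopologicalSpace Y] {U : Set X}
    [∀ x, Decidable (x ∈ U)] (hU : IsClopen U) {f g : X → Y} (hf : Continuous f)
    (hg : Continuous g) : Continuous fun x => if x ∈ U then f x else g x := by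
  refine Continuous.if (fun a ha => ?_) hf hg
  have h : a ∈ frontier U := ha
  rw [hU.frontier_eq] at h
  exact h.elim

/-- The device by which statements on `X` and on `Z` are reduced to a dense set of explicit points.
-/
theorem DenseRange.isClopen_subset {P X : Type*} [TopologicalSpace X] {f : P → X}
    (hf : DenseRange f) {U W : Set X} (hU : IsOpen U) (hW : IsClosed W)
    (h : ∀ p, f p ∈ U → f p ∈ W) : U ⊆ W := by
  intro x hx
  have h1 := hf.open_subset_closure_inter hU hx
  refine closure_minimal ?_ hW h1
  rintro _ ⟨hy, p, rfl⟩
  exact h p hy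

namespace HigherRankGraph

variable {r : ℕ} {V Λ : Type*} {Γ : HigherRankGraph r V Λ}

/-! ### The commutative algebra `ℰ ∩ ℓ^∞` and its spectrum -/

theorem isClosed_toeplitzTwoSided : IsClosed (Γ.toeplitzTwoSided :
    Set (HilbertL2 Γ.FockIndex →L[ℂ] HilbertL2 Γ.FockIndex)) :=
  StarSubalgebra.isClosed_topologicalClosure _

instance isClosed_diagonalAlgebra : IsClosed (Γ.diagonalAlgebra :
    Set (HilbertL2 Γ.FockIndex →L[ℂ] HilbertL2 Γ.FockIndex)) :=
  isClosed_toeplitzTwoSided.inter isClosed_diagonalOperators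

theorem point_apply (i : Γ.FockIndex) (f : Γ.diagonalAlgebra) :
    Γ.point i f = (f.1 (basisVec i) : Γ.FockIndex → ℂ) i :=
  inner_basisVec i _

theorem diagonalAlgebra_ext {f g : Γ.diagonalAlgebra} (h : ∀ i, Γ.point i f = Γ.point i g) :
    f = g := by
  refine Subtype.ext (HilbertL2.ext_matrix fun u t => ?_)
  by_cases htu : t = u
  · subst htu
    rw [← point_apply, ← point_apply, h]
  · have hf : IsDiagonal f.1 := f.2.2
    have hg : IsDiagonal g.1 := g.2.2
    rw [hf t u htu, hg t u htu]

instance : CommCStarAlgebra Γ.diagonalAlgebra where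
  __ := (inferInstance : CStarAlgebra Γ.diagonalAlgebra)
  mul_comm f g := diagonalAlgebra_ext fun i => by
    rw [map_mul, map_mul, mul_comm]

instance : CompactSpace Γ.SpectrumX := inferInstance

instance : T2Space Γ.SpectrumX := inferInstance

theorem denseRange_point : DenseRange Γ.point := by
  refine WeakDual.CharacterSpace.dense_of_separating (A := Γ.diagonalAlgebra) _ fun f hf => ?_
  refine diagonalAlgebra_ext fun i => ?_
  rw [map_zero]
  exact hf _ ⟨i, rfl⟩

variable (Γ) in
/-- A partial injection of the index set whose partial isometry belongs to `ℰ`. -/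
structure IsAdmissible (a : Γ.FockIndex → Option Γ.FockIndex) : Prop where
  inj : PartialInjective a
  mem : partialIsometry a ∈ Γ.toeplitzTwoSided

namespace IsAdmissible

variable {a : Γ.FockIndex → Option Γ.FockIndex}

theorem partialInv (ha : Γ.IsAdmissible a) : Γ.IsAdmissible (partialInv a) where
  inj := ha.inj.partialInv
  mem := by
    rw [← ha.inj.star_partialIsometry]
    exact star_mem ha.mem

/-- The map `f ↦ A^* f A` on `ℰ ∩ ℓ^∞`. -/
def compress (ha : Γ.IsAdmissible a) (f : Γ.diagonalAlgebra) : Γ.diagonalAlgebra :=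
  ⟨star (partialIsometry a) * f.1 * partialIsometry a,
    mul_mem (mul_mem (star_mem ha.mem) f.2.1) ha.mem, ha.inj.isDiagonal_conj f.2.2⟩

theorem point_compress_some (ha : Γ.IsAdmissible a) (f : Γ.diagonalAlgebra) {i k : Γ.FockIndex}
    (h : a i = some k) : Γ.point i (ha.compress f) = Γ.point k f := by
  rw [point_apply, point_apply, compress, ha.inj.conj_apply_some f.2.2 h]
  simp [basisVec_apply_self]

theorem point_compress_none (ha : Γ.IsAdmissible a) (f : Γ.diagonalAlgebra) {i : Γ.FockIndex}
    (h : a i = none) : Γ.point i (ha.compress f) = 0 := by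
  rw [point_apply, compress, ha.inj.conj_apply_none f.1 h]
  rfl

/-- The range projection `A A^*` is diagonal and commutes with `f`, so it may be inserted between
`f` and `g`. The proof reads this off the diagonal entries. -/
theorem compress_mul (ha : Γ.IsAdmissible a) (f g : Γ.diagonalAlgebra) :
    ha.compress (f * g) = ha.compress f * ha.compress g := by
  refine diagonalAlgebra_ext fun i => ?_
  rw [map_mul]
  cases h : a i with
  | none => simp only [ha.point_compress_none _ h, mul_zero]
  | some k => simp only [ha.point_compress_some _ h, map_mul]

theorem compress_compress_partialInv (ha : Γ.IsAdmissible a) (f : Γ.diagonalAlgebra) :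
    ha.compress (ha.partialInv.compress f) = ha.compress 1 * f := by
  refine diagonalAlgebra_ext fun i => ?_
  rw [map_mul]
  cases h : a i with
  | none => simp only [ha.point_compress_none _ h, zero_mul]
  | some k =>
    rw [ha.point_compress_some _ h, ha.point_compress_some _ h, map_one, one_mul,
      ha.partialInv.point_compress_some f (ha.inj.partialInv_eq_some.2 h)]

/-- The map `f ↦ A^* f A` as a continuous linear map. -/
def compressL (ha : Γ.IsAdmissible a) : Γ.diagonalAlgebra →L[ℂ] Γ.diagonalAlgebra where
  toFun := ha.compress
  map_add' f g := Subtype.ext (by simp [compress, mul_add, add_mul])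
  map_smul' c f := Subtype.ext (by simp [compress])
  cont := by
    refine Continuous.subtype_mk ?_ _
    exact (continuous_const.mul continuous_subtype_val).mul continuous_const

/-- The domain of the partial homeomorphism of `X` which belongs to `a`. -/
def dom (ha : Γ.IsAdmissible a) : Set Γ.SpectrumX := {x | x (ha.compress 1) = 1}

theorem continuous_eval (f : Γ.diagonalAlgebra) : Continuous fun x : Γ.SpectrumX => x f :=
  (WeakDual.eval_continuous f).comp continuous_subtype_val

/-- A character takes only the values `0` and `1` on the projection `A^* A`, so the domain and its
complement are both closed. -/
theorem isClopen_dom (ha : Γ.IsAdmissible a) : IsClopen ha.dom := by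
  have h0 : ∀ x : Γ.SpectrumX, x (ha.compress 1) = 0 ∨ x (ha.compress 1) = 1 := by
    intro x
    have h : x (ha.compress 1) * x (ha.compress 1) = x (ha.compress 1) := by
      rw [← map_mul, ← ha.compress_mul, mul_one]
    exact or_iff_not_imp_left.2 fun h0 => mul_right_cancel₀ h0 (h.trans (one_mul _).symm)
  refine ⟨isClosed_eq (continuous_eval _) continuous_const, ?_⟩
  have h : ha.dom = {x | x (ha.compress 1) = 0}ᶜ := by
    ext x
    simp only [dom, Set.mem_ofPred_eq, Set.mem_compl_iff]
    rcases h0 x with h | h <;> simp [h]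
  rw [h]
  exact (isClosed_eq (continuous_eval _) continuous_const).isOpen_compl

theorem point_mem_dom (ha : Γ.IsAdmissible a) {i : Γ.FockIndex} :
    Γ.point i ∈ ha.dom ↔ ∃ k, a i = some k := by
  change Γ.point i (ha.compress 1) = 1 ↔ _
  cases h : a i with
  | none => simp [ha.point_compress_none _ h]
  | some k => simp [ha.point_compress_some _ h]

open Classical in
/-- The partial homeomorphism of `X` which belongs to `a`, extended by the identity. -/
def act (ha : Γ.IsAdmissible a) (x : Γ.SpectrumX) : Γ.SpectrumX :=
  if hx : x ∈ ha.dom then ⟨x.1.comp ha.compressL, by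
    constructor
    · intro h
      have h1 := congrArg (fun F : WeakDual ℂ Γ.diagonalAlgebra => F 1) h
      change x (ha.compress 1) = 0 at h1
      rw [show x (ha.compress 1) = 1 from hx] at h1
      exact one_ne_zero h1
    · intro f g
      change x (ha.compress (f * g)) = x (ha.compress f) * x (ha.compress g)
      rw [ha.compress_mul, map_mul]⟩
  else x

theorem act_apply (ha : Γ.IsAdmissible a) {x : Γ.SpectrumX} (hx : x ∈ ha.dom)
    (f : Γ.diagonalAlgebra) : ha.act x f = x (ha.compress f) := by
  rw [act, dif_pos hx]
  rfl

theorem act_of_notMem (ha : Γ.IsAdmissible a) {x : Γ.SpectrumX} (hx : x ∉ ha.dom) :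
    ha.act x = x := dif_neg hx

theorem spectrumX_ext {x z : Γ.SpectrumX} (h : ∀ f : Γ.diagonalAlgebra, x f = z f) : x = z :=
  Subtype.ext (ContinuousLinearMap.ext h)

/-- The domain is clopen, so the extension by the identity is continuous on all of `X` and domains
need not be carried along in continuity arguments. -/
theorem continuous_act (ha : Γ.IsAdmissible a) : Continuous ha.act := by
  classical
  refine Continuous.subtype_mk (f := fun x => (ha.act x).1)
    (WeakDual.continuous_of_continuous_eval fun f => ?_) fun x => (ha.act x).2
  have h : (fun x => (ha.act x).1 f) =
      fun x : Γ.SpectrumX => if x ∈ ha.dom then x (ha.compress f) else x f := by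
    funext x
    change ha.act x f = _
    by_cases hx : x ∈ ha.dom
    · rw [ha.act_apply hx, if_pos hx]
    · rw [ha.act_of_notMem hx, if_neg hx]
  rw [h]
  exact Continuous.if_isClopen ha.isClopen_dom (continuous_eval _) (continuous_eval _)

theorem act_point (ha : Γ.IsAdmissible a) {i k : Γ.FockIndex} (h : a i = some k) :
    ha.act (Γ.point i) = Γ.point k :=
  spectrumX_ext fun f => by
    rw [ha.act_apply (ha.point_mem_dom.2 ⟨k, h⟩), ha.point_compress_some f h]

theorem inDom_iff (ha : Γ.IsAdmissible a) {x : Γ.SpectrumX} :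
    InDom (partialIsometry a) x ↔ x ∈ ha.dom := by
  have h1 : (ha.compress 1).1 = star (partialIsometry a) * partialIsometry a := by
    change star (partialIsometry a) * 1 * partialIsometry a = _
    rw [mul_one]
  constructor
  · rintro ⟨p, hp, hx⟩
    obtain rfl : p = ha.compress 1 := Subtype.ext (hp.trans h1.symm)
    exact hx
  · intro hx
    exact ⟨ha.compress 1, h1, hx⟩

theorem sends_iff (ha : Γ.IsAdmissible a) {x z : Γ.SpectrumX} :
    Sends (partialIsometry a) x z ↔ x ∈ ha.dom ∧ ha.act x = z := by
  constructor
  · rintro ⟨hx, h⟩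
    rw [ha.inDom_iff] at hx
    refine ⟨hx, spectrumX_ext fun f => ?_⟩
    obtain ⟨g, hg, hz⟩ := h f
    obtain rfl : g = ha.compress f := Subtype.ext hg
    rw [ha.act_apply hx, hz]
  · rintro ⟨hx, rfl⟩
    exact ⟨ha.inDom_iff.2 hx, fun f => ⟨ha.compress f, rfl, ha.act_apply hx f⟩⟩

theorem act_mem_dom_partialInv (ha : Γ.IsAdmissible a) {x : Γ.SpectrumX} (hx : x ∈ ha.dom) :
    ha.act x ∈ ha.partialInv.dom := by
  change ha.act x (ha.partialInv.compress 1) = 1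
  rw [ha.act_apply hx, ha.compress_compress_partialInv, mul_one]
  exact hx

theorem act_partialInv_act (ha : Γ.IsAdmissible a) {x : Γ.SpectrumX} (hx : x ∈ ha.dom) :
    ha.partialInv.act (ha.act x) = x :=
  spectrumX_ext fun f => by
    rw [ha.partialInv.act_apply (ha.act_mem_dom_partialInv hx), ha.act_apply hx,
      ha.compress_compress_partialInv, map_mul, show x (ha.compress 1) = 1 from hx, one_mul]

theorem partialInv_partialInv (ha : Γ.IsAdmissible a) :
    _root_.partialInv (_root_.partialInv a) = a := by
  funext i
  cases h : a i with
  | some k =>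
    exact ha.inj.partialInv.partialInv_eq_some.2 (ha.inj.partialInv_eq_some.2 h)
  | none =>
    cases h' : _root_.partialInv (_root_.partialInv a) i with
    | none => rfl
    | some k =>
      have := ha.inj.partialInv_eq_some.1 (ha.inj.partialInv.partialInv_eq_some.1 h')
      rw [h] at this
      cases this

theorem act_partialInv (ha : Γ.IsAdmissible a) {z : Γ.SpectrumX} (hz : z ∈ ha.partialInv.dom) :
    ha.partialInv.act z ∈ ha.dom ∧ ha.act (ha.partialInv.act z) = z := by
  -- The double inverse equals `a` only propositionally, so the facts about it are transported along
  -- that equation.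
  have key : ∀ (b : Γ.FockIndex → Option Γ.FockIndex) (hb : Γ.IsAdmissible b), b = a →
      ∀ w, w ∈ hb.dom → hb.act w = z → w ∈ ha.dom ∧ ha.act w = z := by
    rintro b hb rfl w h1 h2
    exact ⟨h1, h2⟩
  exact key _ ha.partialInv.partialInv ha.partialInv_partialInv _
    (ha.partialInv.act_mem_dom_partialInv hz) (ha.partialInv.act_partialInv_act hz)

end IsAdmissible

/-! ### Subsets of the index set which have clopen closures in the spectrum -/

variable (Γ) in
/-- The set `S` is the trace of a clopen subset of `X`. -/
def IsTrace (S : Set Γ.FockIndex) : Prop :=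
  ∃ U : Set Γ.SpectrumX, IsClopen U ∧ ∀ i, Γ.point i ∈ U ↔ i ∈ S

theorem IsTrace.compl {S : Set Γ.FockIndex} (h : Γ.IsTrace S) : Γ.IsTrace Sᶜ := by
  obtain ⟨U, hU, h⟩ := h
  exact ⟨Uᶜ, hU.compl, fun i => not_congr (h i)⟩

theorem IsTrace.inter {S S' : Set Γ.FockIndex} (h : Γ.IsTrace S) (h' : Γ.IsTrace S') :
    Γ.IsTrace (S ∩ S') := by
  obtain ⟨U, hU, h⟩ := h
  obtain ⟨U', hU', h'⟩ := h'
  exact ⟨U ∩ U', hU.inter hU', fun i => and_congr (h i) (h' i)⟩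

theorem IsTrace.union {S S' : Set Γ.FockIndex} (h : Γ.IsTrace S) (h' : Γ.IsTrace S') :
    Γ.IsTrace (S ∪ S') := by
  obtain ⟨U, hU, h⟩ := h
  obtain ⟨U', hU', h'⟩ := h'
  exact ⟨U ∪ U', hU.union hU', fun i => or_congr (h i) (h' i)⟩

theorem isTrace_univ : Γ.IsTrace Set.univ := ⟨Set.univ, isClopen_univ, fun _ => Iff.rfl⟩

theorem isTrace_empty : Γ.IsTrace ∅ := ⟨∅, isClopen_empty, fun _ => Iff.rfl⟩

theorem isTrace_biUnion {α : Type*} {A : Set α} (hA : A.Finite) {S : α → Set Γ.FockIndex}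
    (h : ∀ i ∈ A, Γ.IsTrace (S i)) : Γ.IsTrace (⋃ i ∈ A, S i) := by
  induction A, hA using Set.Finite.induction_on with
  | empty => simpa using isTrace_empty
  | insert _ _ ih =>
    rw [Set.biUnion_insert]
    exact (h _ (Set.mem_insert _ _)).union (ih fun i hi => h i (Set.mem_insert_of_mem _ hi))

theorem isTrace_iInter {α : Type*} [Finite α] {S : α → Set Γ.FockIndex}
    (h : ∀ i, Γ.IsTrace (S i)) : Γ.IsTrace (⋂ i, S i) := by
  have h1 : ⋂ i, S i = (⋃ i ∈ (Set.univ : Set α), (S i)ᶜ)ᶜ := by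
    simp [Set.compl_iUnion]
  rw [h1]
  exact (isTrace_biUnion Set.finite_univ fun i _ => (h i).compl).compl

/-- The clopen subset of `X` with trace `S`. -/
def hat (S : Set Γ.FockIndex) : Set Γ.SpectrumX := closure (Γ.point '' S)

/-- Points of the index set are dense in `X`, so a clopen set is recovered from its trace. -/
theorem IsTrace.hat_eq {S : Set Γ.FockIndex} {U : Set Γ.SpectrumX} (hU : IsClopen U)
    (h : ∀ i, Γ.point i ∈ U ↔ i ∈ S) : hat S = U := by
  refine Set.Subset.antisymm (closure_minimal ?_ hU.isClosed) ?_
  · rintro _ ⟨i, hi, rfl⟩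
    exact (h i).2 hi
  · exact denseRange_point.isClopen_subset hU.isOpen isClosed_closure
      fun i hi => subset_closure ⟨i, (h i).1 hi, rfl⟩

theorem IsTrace.isClopen_hat {S : Set Γ.FockIndex} (h : Γ.IsTrace S) : IsClopen (hat S) := by
  obtain ⟨U, hU, h⟩ := h
  rwa [IsTrace.hat_eq hU h]

theorem IsTrace.point_mem_hat {S : Set Γ.FockIndex} (h : Γ.IsTrace S) (i : Γ.FockIndex) :
    Γ.point i ∈ hat S ↔ i ∈ S := by
  obtain ⟨U, hU, h⟩ := h
  rw [IsTrace.hat_eq hU h]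
  exact h i

theorem IsAdmissible.isTrace_preimage {a : Γ.FockIndex → Option Γ.FockIndex}
    (ha : Γ.IsAdmissible a) {S : Set Γ.FockIndex} (hS : Γ.IsTrace S) :
    Γ.IsTrace {i | ∃ k ∈ S, a i = some k} := by
  refine ⟨ha.dom ∩ ha.act ⁻¹' hat S, ha.isClopen_dom.inter (hS.isClopen_hat.preimage
    ha.continuous_act), fun i => ?_⟩
  simp only [Set.mem_inter_iff, Set.mem_preimage, Set.mem_ofPred_eq, ha.point_mem_dom]
  constructor
  · rintro ⟨⟨k, hk⟩, h⟩
    rw [ha.act_point hk, hS.point_mem_hat] at h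
    exact ⟨k, h, hk⟩
  · rintro ⟨k, hkS, hk⟩
    refine ⟨⟨k, hk⟩, ?_⟩
    rw [ha.act_point hk, hS.point_mem_hat]
    exact hkS

theorem IsAdmissible.isTrace_dom {a : Γ.FockIndex → Option Γ.FockIndex}
    (ha : Γ.IsAdmissible a) : Γ.IsTrace {i | ∃ k, a i = some k} :=
  ⟨ha.dom, ha.isClopen_dom, fun _ => ha.point_mem_dom⟩

theorem IsAdmissible.isTrace_range {a : Γ.FockIndex → Option Γ.FockIndex}
    (ha : Γ.IsAdmissible a) : Γ.IsTrace {k | ∃ i, a i = some k} := by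
  have h := ha.partialInv.isTrace_dom
  simpa only [ha.inj.partialInv_eq_some] using h

end HigherRankGraph

/-! ### Topological preliminaries -/

section LocallyConstant

open Filter Topology

variable {X Y α : Type*} [TopologicalSpace X] [TopologicalSpace Y]

/-- Locally the parameter `g y` does not move, so the clopen set may depend on it. This handles
conditions on `x` that involve a segment of `y` for `(x, y)` in `Z`. -/
theorem IsLocallyConstant.isClopen_setOf {g : Y → α} (hg : IsLocallyConstant g) {f : Y → X}
    (hf : Continuous f) {U : α → Set X} (hU : ∀ a, IsClopen (U a)) :
    IsClopen {y | f y ∈ U (g y)} := by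
  have key : ∀ W : α → Set X, (∀ a, IsOpen (W a)) → IsOpen {y | f y ∈ W (g y)} := by
    intro W hW
    rw [isOpen_iff_mem_nhds]
    intro y hy
    filter_upwards [(IsLocallyConstant.iff_eventually_eq _).1 hg y,
      hf.continuousAt.preimage_mem_nhds ((hW (g y)).mem_nhds hy)] with y' h1 h2
    exact (congrArg (fun a => f y' ∈ W a) h1).mpr h2
  refine ⟨⟨?_⟩, key U fun a => (hU a).isOpen⟩
  exact key (fun a => (U a)ᶜ) fun a => (hU a).compl.isOpen

theorem IsLocallyConstant.continuous_eval {Z : Type*} [TopologicalSpace Z] {g : Y → α}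
    (hg : IsLocallyConstant g) {f : Y → X} (hf : Continuous f) {F : α → X → Z}
    (hF : ∀ a, Continuous (F a)) : Continuous fun y => F (g y) (f y) := by
  refine continuous_iff_continuousAt.2 fun y => ?_
  refine ((hF (g y)).comp hf).continuousAt.congr ?_
  filter_upwards [(IsLocallyConstant.iff_eventually_eq _).1 hg y] with y' h
  rw [Function.comp_apply, h]

/-- A map on a dense subset whose values can be separated by clopen sets extends continuously. -/
theorem DenseRange.exists_continuous_extension {P K : Type*} [TopologicalSpace K] [CompactSpace K]
    {ψ : P → X} (hψ : DenseRange ψ) (f : P → K)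
    (h : ∀ k k' : K, k ≠ k' → ∃ (C : Set X) (B : Set K), IsClopen C ∧ B ∈ 𝓝 k ∧ Bᶜ ∈ 𝓝 k' ∧
      ∀ p, ψ p ∈ C ↔ f p ∈ B) :
    ∃ F : X → K, Continuous F ∧ ∀ p, F (ψ p) = f p := by
  -- The extension has the closure of the graph as its graph: the clopen separation makes it
  -- single-valued, and compactness of `K`, through closed projections, makes it everywhere defined
  -- and continuous.
  let A : Set (X × K) := closure (Set.range fun p => (ψ p, f p))
  have hA : IsClosed A := isClosed_closure
  have hinj : ∀ x k k', (x, k) ∈ A → (x, k') ∈ A → k = k' := by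
    intro x k k' h1 h2
    by_contra hne
    obtain ⟨C, B, hC, hB, hB', hCB⟩ := h k k' hne
    by_cases hx : x ∈ C
    · obtain ⟨_, ⟨hC', hB''⟩, p, rfl⟩ := mem_closure_iff_nhds.1 h2 (C ×ˢ Bᶜ)
        (prod_mem_nhds (hC.isOpen.mem_nhds hx) hB')
      exact hB'' ((hCB p).1 hC')
    · obtain ⟨_, ⟨hC', hB''⟩, p, rfl⟩ := mem_closure_iff_nhds.1 h1 (Cᶜ ×ˢ B)
        (prod_mem_nhds (hC.compl.isOpen.mem_nhds hx) hB)
      exact hC' ((hCB p).2 hB'')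
  have hsurj : ∀ x, ∃ k, (x, k) ∈ A := by
    have hcl : IsClosed (Prod.fst '' A) := isClosedMap_fst_of_compactSpace _ hA
    have huniv : Prod.fst '' A = Set.univ := by
      rw [Set.eq_univ_iff_forall]
      intro x
      refine closure_minimal ?_ hcl (hψ x)
      rintro _ ⟨p, rfl⟩
      exact ⟨_, subset_closure ⟨p, rfl⟩, rfl⟩
    intro x
    obtain ⟨⟨x', k⟩, hk, rfl⟩ : x ∈ Prod.fst '' A := huniv ▸ trivial
    exact ⟨k, hk⟩
  choose F hF using hsurj
  refine ⟨F, continuous_iff_isClosed.2 fun B hB => ?_, fun p =>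
    hinj _ _ _ (hF _) (subset_closure ⟨p, rfl⟩)⟩
  have h1 : F ⁻¹' B = Prod.fst '' (A ∩ Prod.snd ⁻¹' B) := by
    ext x
    constructor
    · intro hx
      exact ⟨(x, F x), ⟨hF x, hx⟩, rfl⟩
    · rintro ⟨⟨x', k⟩, ⟨hk, hkB⟩, rfl⟩
      change F x' ∈ B
      rw [hinj x' _ _ (hF x') hk]
      exact hkB
  rw [h1]
  exact isClosedMap_fst_of_compactSpace _ (hA.inter (hB.preimage continuous_snd))

end LocallyConstant

namespace HigherRankGraph

variable {r : ℕ} {V Λ : Type*} {Γ : HigherRankGraph r V Λ}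

/-! ### Multiplication on the index set of the Fock space -/

theorem toFock_of_ne {l : Λ} (h : Γ.σ l ≠ 0) : Γ.toFock l = some ⟨l, h⟩ := dif_pos h

theorem toFock_of_eq {l : Λ} (h : Γ.σ l = 0) : Γ.toFock l = none := dif_neg (not_not.2 h)

theorem toFock_coe (m : {l : Λ // Γ.σ l ≠ 0}) : Γ.toFock m = some m := toFock_of_ne m.2

/-- All objects are identified with `Ω`, so the passage to the index set is injective only away from
shape `0`. This accounts for the separate treatment of shape `0` in what follows. -/
theorem eq_of_toFock_eq {l l' : Λ} (h : Γ.toFock l = Γ.toFock l') (hl : Γ.σ l ≠ 0) : l = l' := by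
  rw [toFock_of_ne hl] at h
  by_cases hl' : Γ.σ l' = 0
  · rw [toFock_of_eq hl'] at h
    cases h
  · rw [toFock_of_ne hl'] at h
    exact congrArg Subtype.val (Option.some.inj h)

theorem σ_eq_of_toFock_eq {l l' : Λ} (h : Γ.toFock l = Γ.toFock l') : Γ.σ l = Γ.σ l' := by
  by_cases hl : Γ.σ l = 0
  · by_cases hl' : Γ.σ l' = 0
    · rw [hl, hl']
    · rw [eq_of_toFock_eq h.symm hl']
  · rw [eq_of_toFock_eq h hl]

theorem leftMul_toFock {l m : Λ} (h : Γ.s l = Γ.t m) :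
    Γ.leftMul l (Γ.toFock m) = some (Γ.toFock (Γ.comp l m h)) := by
  by_cases hm : Γ.σ m = 0
  · rw [toFock_of_eq hm, comp_of_σ_eq_zero_right h hm]
    rfl
  · rw [toFock_of_ne hm]
    exact dif_pos h

theorem rightMul_toFock {l m : Λ} (h : Γ.s m = Γ.t l) :
    Γ.rightMul l (Γ.toFock m) = some (Γ.toFock (Γ.comp m l h)) := by
  by_cases hm : Γ.σ m = 0
  · rw [toFock_of_eq hm, comp_of_σ_eq_zero_left h hm]
    rfl
  · rw [toFock_of_ne hm]
    exact dif_pos h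

/-- The vacuum is represented by the object `s(l)`, the one that can be composed with `l`; thereby
all products become products in the category. -/
theorem exists_of_leftMul {l : Λ} {i k : Γ.FockIndex} (h : Γ.leftMul l i = some k) :
    ∃ m e, i = Γ.toFock m ∧ k = Γ.toFock (Γ.comp l m e) := by
  cases i with
  | none =>
    refine ⟨Γ.id (Γ.s l), (Γ.t_id _).symm, (toFock_of_eq (Γ.σ_id _)).symm, ?_⟩
    rw [Γ.comp_id]
    exact (Option.some.inj h).symm
  | some m =>
    by_cases e : Γ.s l = Γ.t m
    · refine ⟨m, e, (toFock_coe m).symm, ?_⟩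
      rw [← toFock_coe m, leftMul_toFock e] at h
      exact (Option.some.inj h).symm
    · have h' : Γ.leftMul l (some m) = none := dif_neg e
      rw [h'] at h
      cases h

theorem exists_of_rightMul {l : Λ} {i k : Γ.FockIndex} (h : Γ.rightMul l i = some k) :
    ∃ m e, i = Γ.toFock m ∧ k = Γ.toFock (Γ.comp m l e) := by
  cases i with
  | none =>
    refine ⟨Γ.id (Γ.t l), Γ.s_id _, (toFock_of_eq (Γ.σ_id _)).symm, ?_⟩
    rw [Γ.id_comp]
    exact (Option.some.inj h).symm
  | some m =>
    by_cases e : Γ.s m = Γ.t l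
    · refine ⟨m, e, (toFock_coe m).symm, ?_⟩
      rw [← toFock_coe m, rightMul_toFock e] at h
      exact (Option.some.inj h).symm
    · have h' : Γ.rightMul l (some m) = none := dif_neg e
      rw [h'] at h
      cases h

theorem leftMul_injective (l : Λ) : PartialInjective (Γ.leftMul l) := by
  intro i j k hi hj
  obtain ⟨m, e, rfl, rfl⟩ := exists_of_leftMul hi
  obtain ⟨m', e', rfl, hk⟩ := exists_of_leftMul hj
  by_cases h : Γ.σ (Γ.comp l m e) = 0
  · have h' := (σ_eq_of_toFock_eq hk).symm.trans h
    rw [Γ.σ_comp] at h h'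
    rw [toFock_of_eq (add_eq_zero.1 h).2, toFock_of_eq (add_eq_zero.1 h').2]
  · rw [(comp_injective rfl (eq_of_toFock_eq hk h)).2]

theorem rightMul_injective (l : Λ) : PartialInjective (Γ.rightMul l) := by
  intro i j k hi hj
  obtain ⟨m, e, rfl, rfl⟩ := exists_of_rightMul hi
  obtain ⟨m', e', rfl, hk⟩ := exists_of_rightMul hj
  by_cases h : Γ.σ (Γ.comp m l e) = 0
  · have h' := (σ_eq_of_toFock_eq hk).symm.trans h
    rw [Γ.σ_comp] at h h'
    rw [toFock_of_eq (add_eq_zero.1 h).1, toFock_of_eq (add_eq_zero.1 h').1]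
  · rw [(comp_injective_right rfl (eq_of_toFock_eq hk h)).1]

theorem isAdmissible_leftMul (l : Λ) : Γ.IsAdmissible (Γ.leftMul l) where
  inj := leftMul_injective l
  mem := StarSubalgebra.le_topologicalClosure _
    (StarAlgebra.subset_adjoin ℂ _ (Or.inl ⟨l, rfl⟩))

theorem isAdmissible_rightMul (l : Λ) : Γ.IsAdmissible (Γ.rightMul l) where
  inj := rightMul_injective l
  mem := StarSubalgebra.le_topologicalClosure _
    (StarAlgebra.subset_adjoin ℂ _ (Or.inr ⟨l, rfl⟩))

theorem eq_of_leftMul_eq {l l' : Λ} (hσ : Γ.σ l = Γ.σ l') (h0 : Γ.σ l ≠ 0) {i j k : Γ.FockIndex}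
    (h : Γ.leftMul l i = some k) (h' : Γ.leftMul l' j = some k) : l = l' := by
  obtain ⟨m, e, rfl, rfl⟩ := exists_of_leftMul h
  obtain ⟨m', e', rfl, hk⟩ := exists_of_leftMul h'
  refine (comp_injective hσ (eq_of_toFock_eq hk fun h => h0 ?_)).1
  rw [Γ.σ_comp] at h
  exact (add_eq_zero.1 h).1

theorem eq_of_rightMul_eq {l l' : Λ} (hσ : Γ.σ l = Γ.σ l') (h0 : Γ.σ l ≠ 0) {i j k : Γ.FockIndex}
    (h : Γ.rightMul l i = some k) (h' : Γ.rightMul l' j = some k) : l = l' := by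
  obtain ⟨m, e, rfl, rfl⟩ := exists_of_rightMul h
  obtain ⟨m', e', rfl, hk⟩ := exists_of_rightMul h'
  refine (comp_injective_right hσ (eq_of_toFock_eq hk fun h => h0 ?_)).2
  rw [Γ.σ_comp] at h
  exact (add_eq_zero.1 h).2

/-- Characters in the ranges of two left creation operators of the same nonzero shape. -/
theorem eq_of_mem_range_leftMul {l l' : Λ} (hσ : Γ.σ l = Γ.σ l') (h0 : Γ.σ l ≠ 0)
    {x : Γ.SpectrumX} (h : x ∈ (isAdmissible_leftMul l).partialInv.dom)
    (h' : x ∈ (isAdmissible_leftMul l').partialInv.dom) : l = l' := by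
  by_contra hne
  have h1 := denseRange_point.isClopen_subset
    ((isAdmissible_leftMul l).partialInv.isClopen_dom.inter
      (isAdmissible_leftMul l').partialInv.isClopen_dom).isOpen isClosed_empty ?_ ⟨h, h'⟩
  · exact h1
  · rintro i ⟨hi, hi'⟩
    obtain ⟨j, hj⟩ := (IsAdmissible.point_mem_dom _).1 hi
    obtain ⟨j', hj'⟩ := (IsAdmissible.point_mem_dom _).1 hi'
    exact (hne (eq_of_leftMul_eq hσ h0 ((leftMul_injective l).partialInv_eq_some.1 hj)
      ((leftMul_injective l').partialInv_eq_some.1 hj'))).elim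

theorem eq_of_mem_range_rightMul {l l' : Λ} (hσ : Γ.σ l = Γ.σ l') (h0 : Γ.σ l ≠ 0)
    {x : Γ.SpectrumX} (h : x ∈ (isAdmissible_rightMul l).partialInv.dom)
    (h' : x ∈ (isAdmissible_rightMul l').partialInv.dom) : l = l' := by
  by_contra hne
  have h1 := denseRange_point.isClopen_subset
    ((isAdmissible_rightMul l).partialInv.isClopen_dom.inter
      (isAdmissible_rightMul l').partialInv.isClopen_dom).isOpen isClosed_empty ?_ ⟨h, h'⟩
  · exact h1
  · rintro i ⟨hi, hi'⟩
    obtain ⟨j, hj⟩ := (IsAdmissible.point_mem_dom _).1 hi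
    obtain ⟨j', hj'⟩ := (IsAdmissible.point_mem_dom _).1 hi'
    exact (hne (eq_of_rightMul_eq hσ h0 ((rightMul_injective l).partialInv_eq_some.1 hj)
      ((rightMul_injective l').partialInv_eq_some.1 hj'))).elim

/-- Left multiplication by an object fixes every point of the index set on which it is defined;
density extends this to its domain. -/
theorem act_leftMul_of_σ_eq_zero {l : Λ} (hl : Γ.σ l = 0) (x : Γ.SpectrumX) :
    (isAdmissible_leftMul l).act x = x := by
  have ha := isAdmissible_leftMul (Γ := Γ) l
  by_cases hx : x ∈ ha.dom
  · refine denseRange_point.isClopen_subset (W := {x | ha.act x = x}) ha.isClopen_dom.isOpen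
      (isClosed_eq ha.continuous_act continuous_id) ?_ hx
    intro i hi
    obtain ⟨k, hk⟩ := ha.point_mem_dom.1 hi
    change ha.act (Γ.point i) = Γ.point i
    rw [ha.act_point hk]
    obtain ⟨m, e, rfl, rfl⟩ := exists_of_leftMul hk
    rw [comp_of_σ_eq_zero_left e hl]
  · exact ha.act_of_notMem hx

/-- Whether `x λ` is defined depends only on `t(λ)`. -/
theorem dom_rightMul (l : Λ) :
    (isAdmissible_rightMul (Γ := Γ) l).dom = (isAdmissible_rightMul (Γ.id (Γ.t l))).dom := by
  have key : ∀ l l' : Λ, Γ.t l = Γ.t l' →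
      (isAdmissible_rightMul (Γ := Γ) l).dom ⊆ (isAdmissible_rightMul l').dom := by
    intro l l' hl
    refine denseRange_point.isClopen_subset (IsAdmissible.isClopen_dom _).isOpen
      (IsAdmissible.isClopen_dom _).isClosed fun i hi => ?_
    obtain ⟨k, hk⟩ := (IsAdmissible.point_mem_dom _).1 hi
    obtain ⟨m, e, rfl, -⟩ := exists_of_rightMul hk
    exact (IsAdmissible.point_mem_dom _).2 ⟨_, rightMul_toFock (e.trans hl)⟩
  exact Set.Subset.antisymm (key _ _ (Γ.t_id _).symm) (key _ _ (Γ.t_id _))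

/-! ### Traces of clopen sets -/

/-- The shape of an element of the index set. -/
def fockShape : Γ.FockIndex → (Fin r → ℕ)
  | none => 0
  | some m => Γ.σ m

theorem fockShape_toFock (l : Λ) : fockShape (Γ.toFock l) = Γ.σ l := by
  by_cases h : Γ.σ l = 0
  · rw [toFock_of_eq h, h]
    rfl
  · rw [toFock_of_ne h]
    rfl

/-- A morphism has shape at least `a` exactly when it has a prefix of shape `a`, that is, when it
lies in the range of one of the finitely many `L_l` with `σ(l) = a`. -/
theorem isTrace_le_shape (hΓ : Γ.FinitenessCondition) (a : Fin r → ℕ) :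
    Γ.IsTrace {i | a ≤ fockShape i} := by
  by_cases ha : a = 0
  · subst ha
    convert isTrace_univ (Γ := Γ)
    exact Set.eq_univ_of_forall fun i => show (0 : Fin r → ℕ) ≤ fockShape i from zero_le
  · have h : {i : Γ.FockIndex | a ≤ fockShape i} =
        ⋃ l ∈ {l | Γ.σ l = a}, {k | ∃ i, Γ.leftMul l i = some k} := by
      ext i
      simp only [Set.mem_iUnion, Set.mem_ofPred_eq, exists_prop]
      constructor
      · intro hi
        cases i with
        | none => exact (ha (le_antisymm hi zero_le)).elim
        | some m =>
          obtain ⟨p, hp, q, e, hq⟩ := exists_isPrefix (Γ := Γ) (l := m.1) hi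
          refine ⟨p, hp, Γ.toFock q, ?_⟩
          rw [leftMul_toFock e, hq, toFock_coe]
      · rintro ⟨l, hl, j, hj⟩
        obtain ⟨m, e, -, rfl⟩ := exists_of_leftMul hj
        rw [fockShape_toFock, Γ.σ_comp, hl]
        exact le_self_add
    rw [h]
    exact isTrace_biUnion (hΓ.finite a) fun l _ => (isAdmissible_leftMul l).isTrace_range

/-- `Ω` is the only element of the index set whose shape dominates no unit vector, so it is an
isolated point of `X`. -/
theorem isTrace_vacuum (hΓ : Γ.FinitenessCondition) : Γ.IsTrace {none} := by
  have h : ({none} : Set Γ.FockIndex) = ⋂ j : Fin r, {i | Pi.single j 1 ≤ fockShape i}ᶜ := by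
    ext i
    simp only [Set.mem_singleton_iff, Set.mem_iInter, Set.mem_compl_iff, Set.mem_ofPred_eq]
    constructor
    · rintro rfl j hj
      have := hj j
      simp [fockShape] at this
    · intro h
      cases i with
      | none => rfl
      | some m =>
        exfalso
        refine m.2 (funext fun j => ?_)
        by_contra hj
        refine h j fun j' => ?_
        by_cases hjj : j' = j
        · subst hjj
          rw [Pi.single_eq_same]
          exact Nat.one_le_iff_ne_zero.2 hj
        · simp [hjj]
  rw [h]
  exact isTrace_iInter fun j => (isTrace_le_shape hΓ _).compl

/-- The elements `μ` such that `l` is an initial segment of `μ n`. -/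
def prefixSet (l n : Λ) : Set Γ.FockIndex :=
  {i | ∃ (m : Λ) (e : Γ.s m = Γ.t n), i = Γ.toFock m ∧ Γ.IsPrefix l (Γ.comp m n e)}

/-- For nonzero shape this is the preimage under `R_n` of the range of `L_l`. For shape `0` the
product of `Ω` with an object is `Ω` again, and the name of the object is lost; there the isolated
point `Ω` is added by hand, precisely when `l = n`. -/
theorem isTrace_prefixSet (hΓ : Γ.FinitenessCondition) {l n : Λ} (hσ : Γ.σ l = Γ.σ n) :
    Γ.IsTrace (prefixSet (Γ := Γ) l n) := by
  classical
  by_cases hn : Γ.σ n = 0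
  · have hl := hσ.trans hn
    have h : prefixSet (Γ := Γ) l n = ({i | ∃ k, Γ.rightMul n i = some k} ∩
        {i | ∃ k, Γ.leftMul l i = some k} ∩ {none}ᶜ) ∪ (if l = n then {none} else ∅) := by
      ext i
      constructor
      · rintro ⟨m, e, rfl, hp⟩
        have hp' : Γ.IsPrefix l m := by rwa [comp_of_σ_eq_zero_right e hn] at hp
        obtain ⟨q, e', hq⟩ := hp'
        rw [comp_of_σ_eq_zero_left e' hl] at hq
        subst hq
        by_cases hm : Γ.σ q = 0
        · right
          have h1 : l = n := by
            rw [← id_s_of_σ_eq_zero hl, e', ← id_t_of_σ_eq_zero hn, t_eq_s_of_σ_eq_zero hm, e]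
          rw [if_pos h1, toFock_of_eq hm]
          rfl
        · left
          refine ⟨⟨⟨_, rightMul_toFock e⟩, ⟨_, leftMul_toFock e'⟩⟩, ?_⟩
          rw [toFock_of_ne hm]
          simp
      · rintro (⟨⟨⟨k, hk⟩, ⟨k', hk'⟩⟩, hi⟩ | hi)
        · obtain ⟨m, e, rfl, -⟩ := exists_of_rightMul hk
          obtain ⟨m', e', h1, -⟩ := exists_of_leftMul hk'
          have hm : Γ.σ m ≠ 0 := fun h => hi (toFock_of_eq h)
          obtain rfl := eq_of_toFock_eq h1 hm
          refine ⟨m, e, rfl, m, e', ?_⟩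
          rw [comp_of_σ_eq_zero_left e' hl, comp_of_σ_eq_zero_right e hn]
        · split_ifs at hi with h1
          · subst h1
            obtain rfl : i = none := hi
            refine ⟨Γ.id (Γ.t l), Γ.s_id _, (toFock_of_eq (Γ.σ_id _)).symm, Γ.id (Γ.s l),
              (Γ.t_id _).symm, ?_⟩
            rw [Γ.comp_id, Γ.id_comp]
          · exact hi.elim
    rw [h]
    refine ((((isAdmissible_rightMul n).isTrace_dom.inter (isAdmissible_leftMul l).isTrace_dom).inter
      (isTrace_vacuum hΓ).compl)).union ?_
    split_ifs
    · exact isTrace_vacuum hΓ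
    · exact isTrace_empty
  · have h : prefixSet (Γ := Γ) l n =
        {i | ∃ k ∈ {k | ∃ j, Γ.leftMul l j = some k}, Γ.rightMul n i = some k} := by
      ext i
      constructor
      · rintro ⟨m, e, rfl, q, e', hq⟩
        exact ⟨_, ⟨Γ.toFock q, by rw [leftMul_toFock e', hq]⟩, rightMul_toFock e⟩
      · rintro ⟨k, ⟨j, hj⟩, hk⟩
        obtain ⟨m, e, rfl, rfl⟩ := exists_of_rightMul hk
        obtain ⟨q, e', rfl, h1⟩ := exists_of_leftMul hj
        refine ⟨m, e, rfl, q, e', (eq_of_toFock_eq h1 fun h => hn ?_).symm⟩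
        rw [Γ.σ_comp] at h
        exact (add_eq_zero.1 h).2
    rw [h]
    exact (isAdmissible_rightMul n).isTrace_preimage (isAdmissible_leftMul l).isTrace_range

end HigherRankGraph

/-! ### Extended natural numbers and partial maps given by relations -/

theorem ENat.isClopen_setOf_le (k : ℕ) : IsClopen {a : ℕ∞ | (k : ℕ∞) ≤ a} := by
  refine ⟨isClosed_Ici, ?_⟩
  cases k with
  | zero => simp
  | succ k =>
    have h : {a : ℕ∞ | ((k + 1 : ℕ) : ℕ∞) ≤ a} = Set.Ioi (k : ℕ∞) := by
      ext a
      simp only [Set.mem_ofPred_eq, Set.mem_Ioi, Nat.cast_add, Nat.cast_one]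
      exact ENat.add_one_le_iff (ENat.natCast_ne_top k)
    rw [h]
    exact isOpen_Ioi

theorem ENat.exists_natCast_le_of_ne {a b : ℕ∞} (h : a ≠ b) :
    ∃ k : ℕ, ((k : ℕ∞) ≤ a ∧ ¬ (k : ℕ∞) ≤ b) ∨ ((k : ℕ∞) ≤ b ∧ ¬ (k : ℕ∞) ≤ a) := by
  by_contra! hk
  exact h (ENat.eq_of_forall_natCast_le_iff fun k => ⟨(hk k).1, (hk k).2⟩)

/-- For a functional relation the uniqueness demanded in the domain is automatic. -/
theorem mem_pfunOfGraph {Z : Type*} {Q : Z → Z → Prop} (hQ : ∀ z w w', Q z w → Q z w' → w = w')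
    {z w : Z} : w ∈ pfunOfGraph Q z ↔ Q z w := by
  constructor
  · rintro ⟨h, rfl⟩
    exact h.choose_spec.1
  · intro h
    have h1 : ∃! w, Q z w := ⟨w, h, fun w' h' => hQ _ _ _ h' h⟩
    exact ⟨h1, hQ _ _ _ h1.choose_spec.1 h⟩

namespace HigherRankGraph

open Filter Topology

variable {r : ℕ} {V Λ : Type*} {Γ : HigherRankGraph r V Λ}

/-! ### The space `Z` -/

/-- The condition on `x` depends on `y` only through the locally constant object `t(y)`. -/
theorem isClopen_spaceZ :
    IsClopen {p : Γ.SpectrumX × Γ.InfPath | InDom (Γ.R (Γ.id p.2.t)) p.1} := by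
  have h := (InfPath.isLocallyConstant_t.comp_continuous
    (continuous_snd (X := Γ.SpectrumX) (Y := Γ.InfPath))).isClopen_setOf
    continuous_fst (fun v => (isAdmissible_rightMul (Γ := Γ) (Γ.id v)).isClopen_dom)
  convert h using 1
  ext p
  exact (isAdmissible_rightMul _).inDom_iff

instance : T2Space Γ.SpaceZ :=
  inferInstanceAs (T2Space {p : Γ.SpectrumX × Γ.InfPath // InDom (Γ.R (Γ.id p.2.t)) p.1})

theorem compactSpace_spaceZ (hΓ : Γ.FinitenessCondition) : CompactSpace Γ.SpaceZ := by
  have := InfPath.compactSpace hΓ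
  exact isCompact_iff_compactSpace.1 (isClopen_spaceZ (Γ := Γ)).isClosed.isCompact

namespace SpaceZ

theorem continuous_val : Continuous fun p : Γ.SpaceZ => p.1 := continuous_subtype_val

theorem continuous_fst : Continuous fun p : Γ.SpaceZ => p.1.1 :=
  _root_.continuous_fst.comp continuous_val

theorem continuous_snd : Continuous fun p : Γ.SpaceZ => p.1.2 :=
  _root_.continuous_snd.comp continuous_val

theorem ext {p q : Γ.SpaceZ} (h1 : p.1.1 = q.1.1) (h2 : p.1.2 = q.1.2) : p = q :=
  Subtype.ext (Prod.ext h1 h2)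

theorem mem_dom (p : Γ.SpaceZ) (m : Fin r → ℕ) :
    p.1.1 ∈ (isAdmissible_rightMul (p.1.2.init m)).dom := by
  rw [dom_rightMul, InfPath.t_init]
  exact (isAdmissible_rightMul _).inDom_iff.1 p.2

/-- The point `(z(0, n), W_n z)` of `Z`. -/
def ofPath (p : (Fin r → ℕ) × Γ.InfPath) : Γ.SpaceZ :=
  ⟨(Γ.point (Γ.toFock (p.2.init p.1)), p.2.shift p.1),
    (isAdmissible_rightMul _).inDom_iff.2 ((isAdmissible_rightMul _).point_mem_dom.2
      ⟨_, rightMul_toFock ((p.2.t_shift p.1).symm.trans (Γ.t_id _).symm)⟩)⟩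

theorem eq_ofPath_zero (y : Γ.InfPath) (h : InDom (Γ.R (Γ.id y.t)) (Γ.point none)) :
    (⟨(Γ.point none, y), h⟩ : Γ.SpaceZ) = ofPath (0, y) := by
  refine ext ?_ (y.shift_zero).symm
  change Γ.point none = Γ.point (Γ.toFock (y.init 0))
  rw [toFock_of_eq (y.σ_init 0)]

theorem exists_eq_ofPath (m : {l : Λ // Γ.σ l ≠ 0}) (y : Γ.InfPath)
    (h : InDom (Γ.R (Γ.id y.t)) (Γ.point (some m))) :
    ∃ z, InfPath.IsPrepend (m : Λ) y z ∧
      (⟨(Γ.point (some m), y), h⟩ : Γ.SpaceZ) = ofPath (Γ.σ m, z) := by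
  obtain ⟨k, hk⟩ := (isAdmissible_rightMul _).point_mem_dom.1
    ((isAdmissible_rightMul _).inDom_iff.1 h)
  obtain ⟨m', e, hm, -⟩ := exists_of_rightMul hk
  rw [← toFock_coe] at hm
  obtain rfl := eq_of_toFock_eq hm m.2
  obtain ⟨z, hz⟩ := InfPath.exists_isPrepend (e.trans (Γ.t_id _))
  refine ⟨z, hz, ext ?_ hz.2.symm⟩
  change Γ.point (some m) = Γ.point (Γ.toFock (z.init _))
  rw [hz.1, toFock_coe]

/-- `Z` is open in `X × Λ^∞`, so the pairs `(μ, y)` that lie in `Z` are dense in it, and each of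
them is the point with parameters `(σ(μ), μ y)`. -/
theorem denseRange_ofPath : DenseRange (ofPath (Γ := Γ)) := by
  have h : DenseRange fun p : Γ.FockIndex × Γ.InfPath => (Γ.point p.1, p.2) :=
    denseRange_point.prodMap denseRange_id
  intro p
  rw [mem_closure_iff_nhds]
  intro U hU
  have h1 : (Subtype.val '' U : Set (Γ.SpectrumX × Γ.InfPath)) ∈ 𝓝 p.1 :=
    isClopen_spaceZ.isOpen.isOpenMap_subtype_val.image_mem_nhds hU
  obtain ⟨_, ⟨q, hq, hqv⟩, ⟨⟨i, y⟩, rfl⟩⟩ := mem_closure_iff_nhds.1 (h p.1) _ h1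
  refine ⟨q, hq, ?_⟩
  obtain ⟨q, hq'⟩ := q
  subst hqv
  cases i with
  | none => exact ⟨_, (eq_ofPath_zero y hq').symm⟩
  | some m =>
    obtain ⟨z, -, hz⟩ := exists_eq_ofPath m y hq'
    exact ⟨_, hz.symm⟩

theorem forall_of_ofPath {C : Set Γ.SpaceZ} (hC : IsClosed C) (h : ∀ n z, ofPath (n, z) ∈ C)
    (p : Γ.SpaceZ) : p ∈ C :=
  denseRange_ofPath.isClopen_subset isOpen_univ hC (fun q _ => h q.1 q.2) trivial

/-! ### The map from `Z` to `ℕ̄^r × Λ^∞` -/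

/-- Here `z(0, n)` followed by the next segment of shape `k` is `z(0, n + k)`, whose prefix of shape
`k` is `z(0, k)`. So a condition on the point of `Z` detects an initial segment of the path `z`. -/
theorem ofPath_mem_prefix (n k : Fin r → ℕ) (z : Γ.InfPath) {l : Λ}
    (hl : Γ.σ l = k) :
    Γ.toFock (z.init n) ∈ prefixSet (Γ := Γ) l ((z.shift n).init k) ↔ z.init k = l := by
  obtain ⟨e, he⟩ := z.comp_init_shift n k
  have hz : Γ.IsPrefix (z.init k) (Γ.comp (z.init n) ((z.shift n).init k) e) := by
    rw [he]
    exact z.isPrefix_init le_self_add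
  constructor
  · rintro ⟨m, e', hm, hp⟩
    -- A representative of `Ω` is an object; composability with the remaining path determines which
    -- one.
    have hmz : m = z.init n := by
      by_cases h : Γ.σ m = 0
      · have h' := (σ_eq_of_toFock_eq hm).trans h
        rw [← id_s_of_σ_eq_zero h, ← id_s_of_σ_eq_zero h', e, e']
      · exact eq_of_toFock_eq hm.symm h
    subst hmz
    exact hz.eq_of_σ_eq hp ((z.σ_init k).trans hl.symm)
  · rintro rfl
    exact ⟨_, e, rfl, hz⟩

theorem exists_phi (hΓ : Γ.FinitenessCondition) : ∃ φ : Γ.SpaceZ → Γ.SpaceNL, Continuous φ ∧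
    ∀ n z, φ (ofPath (n, z)) = (fun j => (n j : ℕ∞), z) := by
  have := InfPath.compactSpace hΓ
  refine Exists.imp (fun φ h => ⟨h.1, fun n z => h.2 (n, z)⟩)
    (denseRange_ofPath.exists_continuous_extension (K := Γ.SpaceNL)
      (fun p : (Fin r → ℕ) × Γ.InfPath => (fun j => (p.1 j : ℕ∞), p.2)) ?_)
  have sep : ∀ (C : Set Γ.SpaceZ) (B : Set Γ.SpaceNL), IsClopen C → IsClopen B →
      (∀ p : (Fin r → ℕ) × Γ.InfPath,
        ofPath p ∈ C ↔ ((fun j => (p.1 j : ℕ∞), p.2) : Γ.SpaceNL) ∈ B) →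
      ∀ k k' : Γ.SpaceNL, (k ∈ B ∧ k' ∉ B) ∨ (k' ∈ B ∧ k ∉ B) →
        ∃ (C : Set Γ.SpaceZ) (B : Set Γ.SpaceNL), IsClopen C ∧ B ∈ 𝓝 k ∧ Bᶜ ∈ 𝓝 k' ∧
          ∀ p : (Fin r → ℕ) × Γ.InfPath,
            ofPath p ∈ C ↔ ((fun j => (p.1 j : ℕ∞), p.2) : Γ.SpaceNL) ∈ B := by
    rintro C B hC hB h k k' (⟨h1, h2⟩ | ⟨h1, h2⟩)
    · exact ⟨C, B, hC, hB.isOpen.mem_nhds h1, hB.compl.isOpen.mem_nhds h2, h⟩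
    · refine ⟨Cᶜ, Bᶜ, hC.compl, hB.compl.isOpen.mem_nhds h2, ?_, fun p => not_congr (h p)⟩
      rw [compl_compl]
      exact hB.isOpen.mem_nhds h1
  rintro ⟨a, x⟩ ⟨b, y⟩ hne
  by_cases hab : a = b
  · subst hab
    obtain ⟨k, hk⟩ : ∃ k, x.init k ≠ y.init k := by
      by_contra! h
      exact hne (by rw [InfPath.ext_init h])
    -- Distinct paths are separated by a cylinder, whose pullback is clopen because the second path
    -- enters only through its locally constant segment of shape `k`.
    refine sep {p | p.1.1 ∈ hat (prefixSet (Γ := Γ) (x.init k) (p.1.2.init k))}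
      {q | q.2.init k ∈ ({x.init k} : Set Λ)} ?_
      ((InfPath.isClopen_init k _).preimage _root_.continuous_snd) ?_ _ _
      (Or.inl ⟨rfl, fun h => hk (Eq.symm h)⟩)
    · have hloc : IsLocallyConstant fun p : Γ.SpaceZ => p.1.2.init k :=
        (InfPath.isLocallyConstant_init k).comp_continuous continuous_snd
      have := hloc.isClopen_setOf (f := fun p : Γ.SpaceZ => p.1.1) continuous_fst
        -- The guard is harmless: the segment always has shape `k`, and traces are available only
        -- when the two shapes agree.
        (U := fun m => if Γ.σ m = k then hat (prefixSet (Γ := Γ) (x.init k) m) else ∅) ?_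
      · convert this using 1
        ext p
        simp only [Set.mem_ofPred_eq, InfPath.σ_init, if_true]
      · intro m
        split_ifs with hm
        · exact (isTrace_prefixSet hΓ ((x.σ_init k).trans hm.symm)).isClopen_hat
        · exact isClopen_empty
    · rintro ⟨n, z⟩
      refine ((isTrace_prefixSet hΓ ?_).point_mem_hat _).trans
        (ofPath_mem_prefix n k z (x.σ_init k))
      rw [InfPath.σ_init, InfPath.σ_init]
  · obtain ⟨j, hj⟩ := Function.ne_iff.1 hab
    obtain ⟨k, hk⟩ := ENat.exists_natCast_le_of_ne hj
    have ht := isTrace_le_shape hΓ (Pi.single j k)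
    refine sep {p | p.1.1 ∈ hat {i | Pi.single j k ≤ fockShape i}} {q | (k : ℕ∞) ≤ q.1 j}
      (ht.isClopen_hat.preimage continuous_fst) ((ENat.isClopen_setOf_le k).preimage
        ((continuous_apply j).comp _root_.continuous_fst)) ?_ _ _ hk
    rintro ⟨n, z⟩
    refine (ht.point_mem_hat _).trans ?_
    simp only [Set.mem_ofPred_eq, fockShape_toFock, InfPath.σ_init, Nat.cast_le]
    constructor
    · intro h
      simpa using h j
    · intro h j'
      by_cases hj' : j' = j
      · subst hj'
        simpa using h
      · simp [hj']

/-- The continuous extension of `(μ, y) ↦ (σ(μ), μ y)`. -/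
def phi (hΓ : Γ.FinitenessCondition) : Γ.SpaceZ → Γ.SpaceNL := (exists_phi hΓ).choose

theorem continuous_phi (hΓ : Γ.FinitenessCondition) : Continuous (phi hΓ) :=
  (exists_phi hΓ).choose_spec.1

theorem phi_ofPath (hΓ : Γ.FinitenessCondition) (n : Fin r → ℕ) (z : Γ.InfPath) :
    phi hΓ (ofPath (n, z)) = (fun j => (n j : ℕ∞), z) :=
  (exists_phi hΓ).choose_spec.2 n z

theorem isPhi_phi (hΓ : Γ.FinitenessCondition) : Γ.IsPhi (phi hΓ) where
  continuous := continuous_phi hΓ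
  vacuum y h := by
    rw [eq_ofPath_zero, phi_ofPath]
    simp only [Pi.zero_apply, Nat.cast_zero]
    rfl
  morphism m y h := by
    obtain ⟨z, hz, h1⟩ := exists_eq_ofPath m y h
    rw [h1, phi_ofPath]
    exact ⟨fun j => rfl, hz⟩

/-! ### The shifts on `Z` -/

/-- The underlying pair of `tau`. -/
def tauFun (m : Fin r → ℕ) (p : Γ.SpaceZ) : Γ.SpectrumX × Γ.InfPath :=
  ((isAdmissible_rightMul (p.1.2.init m)).act p.1.1, p.1.2.shift m)

theorem isLocallyConstant_init_snd (m : Fin r → ℕ) :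
    IsLocallyConstant fun p : Γ.SpaceZ => p.1.2.init m :=
  (InfPath.isLocallyConstant_init m).comp_continuous continuous_snd

theorem continuous_tauFun (m : Fin r → ℕ) : Continuous (tauFun (Γ := Γ) m) :=
  ((isLocallyConstant_init_snd m).continuous_eval continuous_fst
    fun l => (isAdmissible_rightMul l).continuous_act).prodMk
    ((InfPath.continuous_shift m).comp continuous_snd)

theorem tauFun_ofPath (m n : Fin r → ℕ) (z : Γ.InfPath) :
    tauFun m (ofPath (n, z)) = (ofPath (n + m, z)).1 := by
  obtain ⟨e, he⟩ := z.comp_init_shift n m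
  refine Prod.ext ?_ (InfPath.shift_shift _ _ _)
  refine ((isAdmissible_rightMul _).act_point (rightMul_toFock e)).trans ?_
  rw [he, add_comm]
  rfl

/-- The inverse `(x, λ y) ↦ (x λ, y)`, `σ(λ) = m`, of the shift `T_m`. -/
def tau (m : Fin r → ℕ) (p : Γ.SpaceZ) : Γ.SpaceZ :=
  ⟨tauFun m p, forall_of_ofPath (C := tauFun m ⁻¹' _)
    (isClopen_spaceZ.isClosed.preimage (continuous_tauFun m))
    (fun n z => by rw [Set.mem_preimage, tauFun_ofPath]; exact (ofPath (n + m, z)).2) p⟩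

theorem continuous_tau (m : Fin r → ℕ) : Continuous (tau (Γ := Γ) m) :=
  (continuous_tauFun m).subtype_mk _

theorem tau_ofPath (m n : Fin r → ℕ) (z : Γ.InfPath) :
    tau m (ofPath (n, z)) = ofPath (n + m, z) :=
  Subtype.ext (tauFun_ofPath m n z)

theorem tau_zero (p : Γ.SpaceZ) : tau 0 p = p :=
  forall_of_ofPath (C := {p | tau 0 p = p}) (isClosed_eq (continuous_tau 0) continuous_id)
    (fun n z => by rw [Set.mem_ofPred_eq, tau_ofPath, add_zero]) p

/-- The morphism `λ` can be recovered from `x λ` and its shape, then `x` by inverting right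
multiplication. Recovery fails for shape `0`, where objects collapse to `Ω`, but there the map is
the identity. -/
theorem tau_injective (m : Fin r → ℕ) : Function.Injective (tau (Γ := Γ) m) := by
  by_cases hm : m = 0
  · subst hm
    intro p q h
    rwa [tau_zero, tau_zero] at h
  intro p q h
  have h1 : (isAdmissible_rightMul (p.1.2.init m)).act p.1.1 =
      (isAdmissible_rightMul (q.1.2.init m)).act q.1.1 := congrArg (fun p : Γ.SpaceZ => p.1.1) h
  have h2 : p.1.2.shift m = q.1.2.shift m := congrArg (fun p : Γ.SpaceZ => p.1.2) h
  have hp := (isAdmissible_rightMul _).act_mem_dom_partialInv (p.mem_dom m)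
  have hq := (isAdmissible_rightMul _).act_mem_dom_partialInv (q.mem_dom m)
  have h3 : p.1.2.init m = q.1.2.init m :=
    eq_of_mem_range_rightMul (by rw [InfPath.σ_init, InfPath.σ_init])
      (by rwa [InfPath.σ_init]) hp (by rwa [h1])
  refine ext ?_ (InfPath.eq_of_init_shift h3 h2)
  have key : ∀ l l' (x x' : Γ.SpectrumX), l = l' → x ∈ (isAdmissible_rightMul (Γ := Γ) l).dom →
      x' ∈ (isAdmissible_rightMul (Γ := Γ) l').dom →
      (isAdmissible_rightMul l).act x = (isAdmissible_rightMul l').act x' → x = x' := by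
    rintro l _ x x' rfl hx hx' he
    rw [← (isAdmissible_rightMul l).act_partialInv_act hx, he,
      (isAdmissible_rightMul l).act_partialInv_act hx']
  exact key _ _ _ _ h3 (p.mem_dom m) (q.mem_dom m) h1

variable (hΓ : Γ.FinitenessCondition)

theorem isLocallyConstant_init_phi (m : Fin r → ℕ) :
    IsLocallyConstant fun p : Γ.SpaceZ => (phi hΓ p).2.init m :=
  (InfPath.isLocallyConstant_init m).comp_continuous
    (_root_.continuous_snd.comp (continuous_phi hΓ))

/-- The underlying pair of `nu`. -/
def nuFun (m : Fin r → ℕ) (p : Γ.SpaceZ) : Γ.SpectrumX × Γ.InfPath :=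
  ((isAdmissible_leftMul ((phi hΓ p).2.init m)).partialInv.act (tau m p).1.1, p.1.2.shift m)

theorem continuous_nuFun (m : Fin r → ℕ) : Continuous (nuFun hΓ m) :=
  ((isLocallyConstant_init_phi hΓ m).continuous_eval (continuous_fst.comp (continuous_tau m))
    fun l => (isAdmissible_leftMul l).partialInv.continuous_act).prodMk
    ((InfPath.continuous_shift m).comp continuous_snd)

theorem leftMul_init_shift (m n : Fin r → ℕ) (z : Γ.InfPath) :
    Γ.leftMul (z.init m) (Γ.toFock ((z.shift m).init n)) = some (Γ.toFock (z.init (n + m))) := by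
  obtain ⟨e, he⟩ := z.comp_init_shift m n
  rw [leftMul_toFock e, he]

/-- Appending a segment of shape `m` gives `z(0, n + m)`; deleting `z(0, m)` from the front leaves
the initial segment of `W_m z` of shape `n`. -/
theorem nuFun_ofPath (m n : Fin r → ℕ) (z : Γ.InfPath) :
    nuFun hΓ m (ofPath (n, z)) = (ofPath (n, z.shift m)).1 := by
  refine Prod.ext ?_ ?_
  · have h : ∀ l, l = z.init m → (isAdmissible_leftMul l).partialInv.act
        (Γ.point (Γ.toFock (z.init (n + m)))) = Γ.point (Γ.toFock ((z.shift m).init n)) := by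
      rintro _ rfl
      exact (isAdmissible_leftMul _).partialInv.act_point
        ((leftMul_injective _).partialInv_eq_some.2 (leftMul_init_shift m n z))
    have h1 : (tau m (ofPath (n, z))).1.1 = Γ.point (Γ.toFock (z.init (n + m))) := by
      rw [tau_ofPath]
      rfl
    change (isAdmissible_leftMul _).partialInv.act (tau m (ofPath (n, z))).1.1 = _
    rw [h1]
    refine h _ ?_
    rw [phi_ofPath]
  · change (z.shift n).shift m = (z.shift m).shift n
    rw [InfPath.shift_shift, InfPath.shift_shift, add_comm]

/-- The shift `V_m`. -/
def nu (m : Fin r → ℕ) (p : Γ.SpaceZ) : Γ.SpaceZ :=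
  ⟨nuFun hΓ m p, forall_of_ofPath (C := nuFun hΓ m ⁻¹' _)
    (isClopen_spaceZ.isClosed.preimage (continuous_nuFun hΓ m))
    (fun n z => by rw [Set.mem_preimage, nuFun_ofPath]; exact (ofPath (n, z.shift m)).2) p⟩

theorem continuous_nu (m : Fin r → ℕ) : Continuous (nu hΓ m) :=
  (continuous_nuFun hΓ m).subtype_mk _

theorem nu_ofPath (m n : Fin r → ℕ) (z : Γ.InfPath) :
    nu hΓ m (ofPath (n, z)) = ofPath (n, z.shift m) :=
  Subtype.ext (nuFun_ofPath hΓ m n z)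

theorem tau_snd (m : Fin r → ℕ) (p : Γ.SpaceZ) : (tau m p).1.2 = p.1.2.shift m := rfl

theorem nu_snd (m : Fin r → ℕ) (p : Γ.SpaceZ) : (nu hΓ m p).1.2 = p.1.2.shift m := rfl

/-- Ensures that the left division in `nuFun` is the genuine one and not the default value used
outside the domain. -/
theorem tau_mem_dom (m : Fin r → ℕ) (p : Γ.SpaceZ) :
    (tau m p).1.1 ∈ (isAdmissible_leftMul ((phi hΓ p).2.init m)).partialInv.dom := by
  refine forall_of_ofPath (C := {p : Γ.SpaceZ | (tau m p).1.1 ∈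
    (isAdmissible_leftMul ((phi hΓ p).2.init m)).partialInv.dom}) ?_ ?_ p
  · exact ((isLocallyConstant_init_phi hΓ m).isClopen_setOf
      (continuous_fst.comp (continuous_tau m))
      fun l => (isAdmissible_leftMul l).partialInv.isClopen_dom).isClosed
  · intro n z
    have h : ∀ l, l = z.init m → Γ.point (Γ.toFock (z.init (n + m))) ∈
        (isAdmissible_leftMul l).partialInv.dom := by
      rintro _ rfl
      exact (isAdmissible_leftMul _).partialInv.point_mem_dom.2
        ⟨_, (leftMul_injective _).partialInv_eq_some.2 (leftMul_init_shift m n z)⟩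
    have h1 : (tau m (ofPath (n, z))).1.1 = Γ.point (Γ.toFock (z.init (n + m))) := by
      rw [tau_ofPath]
      rfl
    rw [Set.mem_ofPred_eq, h1]
    refine h _ ?_
    rw [phi_ofPath]

theorem act_nu (m : Fin r → ℕ) (p : Γ.SpaceZ) :
    (nu hΓ m p).1.1 ∈ (isAdmissible_leftMul ((phi hΓ p).2.init m)).dom ∧
      (isAdmissible_leftMul ((phi hΓ p).2.init m)).act (nu hΓ m p).1.1 = (tau m p).1.1 :=
  (isAdmissible_leftMul _).act_partialInv (tau_mem_dom hΓ m p)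

theorem mem_shiftT {m : Fin r → ℕ} {z w : Γ.SpaceZ} : w ∈ Γ.shiftT m z ↔ tau m w = z := by
  have key : ∀ z w : Γ.SpaceZ, (∃ l, Γ.σ l = m ∧ Sends (Γ.R l) w.1.1 z.1.1 ∧
      InfPath.IsPrepend l z.1.2 w.1.2) ↔ tau m w = z := by
    intro z w
    constructor
    · rintro ⟨l, rfl, h1, h2⟩
      refine ext ?_ h2.2
      refine Eq.trans ?_ ((isAdmissible_rightMul l).sends_iff.1 h1).2
      have h : ∀ l', l' = l → (isAdmissible_rightMul l').act w.1.1 =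
          (isAdmissible_rightMul l).act w.1.1 := by
        rintro _ rfl
        rfl
      exact h _ h2.1
    · rintro rfl
      exact ⟨w.1.2.init m, w.1.2.σ_init m, (isAdmissible_rightMul _).sends_iff.2
        ⟨w.mem_dom m, rfl⟩, InfPath.isPrepend_init _ _⟩
  refine (mem_pfunOfGraph fun z w w' h h' => ?_).trans (key z w)
  exact tau_injective m (((key _ _).1 h).trans ((key _ _).1 h').symm)

theorem mem_shiftV {m : Fin r → ℕ} {z w : Γ.SpaceZ} : w ∈ Γ.shiftV m z ↔ w = nu hΓ m z := by
  have key : ∀ z w : Γ.SpaceZ, (w.1.2 = z.1.2.shift m ∧ ∃ u : Γ.SpectrumX,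
      Sends (Γ.R (z.1.2.init m)) z.1.1 u ∧ ∃ l, Γ.σ l = m ∧ Sends (Γ.L l) w.1.1 u) ↔
      w = nu hΓ m z := by
    intro z w
    constructor
    · rintro ⟨h1, u, hu, l, rfl, hl⟩
      refine ext ?_ h1
      obtain ⟨-, rfl⟩ := (isAdmissible_rightMul _).sends_iff.1 hu
      obtain ⟨hw, hl⟩ := (isAdmissible_leftMul _).sends_iff.1 hl
      have hz := act_nu hΓ (Γ.σ l) z
      -- For nonzero shape the common value lies in the ranges of two left multiplications of the
      -- same shape, so their morphisms coincide; for shape `0` both act trivially.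
      by_cases hm : Γ.σ l = 0
      · rw [act_leftMul_of_σ_eq_zero hm] at hl
        rw [act_leftMul_of_σ_eq_zero ((InfPath.σ_init _ _).trans hm)] at hz
        exact hl.trans hz.2.symm
      · have h : ∀ l', Γ.σ l' = Γ.σ l → (nu hΓ (Γ.σ l) z).1.1 ∈ (isAdmissible_leftMul l').dom →
            (isAdmissible_leftMul l').act (nu hΓ (Γ.σ l) z).1.1 = (tau (Γ.σ l) z).1.1 →
            w.1.1 = (nu hΓ (Γ.σ l) z).1.1 := by
          intro l' hl' h2 h3
          have h4 := (isAdmissible_leftMul _).act_mem_dom_partialInv hw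
          have h5 := (isAdmissible_leftMul _).act_mem_dom_partialInv h2
          rw [h3] at h5
          rw [hl] at h4
          obtain rfl := eq_of_mem_range_leftMul hl' (by rwa [hl']) h5 h4
          rw [← (isAdmissible_leftMul _).act_partialInv_act hw, hl,
            ← (isAdmissible_leftMul _).act_partialInv_act h2, h3]
          rfl
        exact h _ (InfPath.σ_init _ _) hz.1 hz.2
    · rintro rfl
      exact ⟨rfl, (tau m z).1.1, (isAdmissible_rightMul _).sends_iff.2 ⟨z.mem_dom m, rfl⟩,
        _, InfPath.σ_init _ _, (isAdmissible_leftMul _).sends_iff.2 (act_nu hΓ m z)⟩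
  refine (mem_pfunOfGraph fun z w w' h h' => ?_).trans (key z w)
  exact ((key _ _).1 h).trans ((key _ _).1 h').symm

/-- `V` is everywhere defined and `T_m` is the inverse of the injection `tau m`, so the partial
system is described by one equation between total continuous maps. -/
theorem mem_systemZ {n : Fin r ⊕ Fin r → ℕ} {z w : Γ.SpaceZ} : w ∈ Γ.systemZ n z ↔
    tau (fun j => n (Sum.inl j)) w = nu hΓ (fun j => n (Sum.inr j)) z := by
  unfold systemZ
  rw [PFun.comp_apply]
  refine Part.mem_bind_iff.trans ?_
  constructor
  · rintro ⟨u, h1, h2⟩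
    rw [mem_shiftT.1 h2, (mem_shiftV hΓ).1 h1]
  · intro h
    exact ⟨_, (mem_shiftV hΓ).2 rfl, mem_shiftT.2 h⟩

theorem nu_injective {m : Fin r → ℕ} {p q : Γ.SpaceZ}
    (h : (phi hΓ p).2.init m = (phi hΓ q).2.init m) (h' : nu hΓ m p = nu hΓ m q) : p = q := by
  refine tau_injective m (ext ?_ ?_)
  swap
  · rw [tau_snd, tau_snd, ← nu_snd hΓ, ← nu_snd hΓ, h']
  have key : ∀ l l' (x x' : Γ.SpectrumX), l = l' → x = x' →
      (isAdmissible_leftMul (Γ := Γ) l).act x = (isAdmissible_leftMul (Γ := Γ) l').act x' := by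
    rintro l _ x _ rfl rfl
    rfl
  rw [← (act_nu hΓ m p).2, ← (act_nu hΓ m q).2]
  exact key _ _ _ _ h (by rw [h'])

end SpaceZ

end HigherRankGraph

/-- A closed relation between compact spaces which is the graph of a bijection between open sets is
the graph of a partial homeomorphism. -/
theorem exists_openPartialHomeomorph_of_graph {X Y : Type*} [TopologicalSpace X]
    [TopologicalSpace Y] [CompactSpace X] [CompactSpace Y] {R : Set (X × Y)} (hR : IsClosed R)
    {S : Set X} {S' : Set Y} (hS : IsOpen S) (hS' : IsOpen S')
    (hRS : ∀ p ∈ R, p.1 ∈ S ∧ p.2 ∈ S') (h1 : ∀ x ∈ S, ∃! y, (x, y) ∈ R)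
    (h2 : ∀ y ∈ S', ∃! x, (x, y) ∈ R) [Nonempty X] [Nonempty Y] :
    ∃ e : OpenPartialHomeomorph X Y, e.source = S ∧ ∀ x ∈ S, (x, e x) ∈ R := by
  classical
  choose! f hf hf' using h1
  choose! g hg hg' using h2
  refine ⟨{
    toFun := f
    invFun := g
    source := S
    target := S'
    map_source' := fun x hx => (hRS _ (hf x hx)).2
    map_target' := fun y hy => (hRS _ (hg y hy)).1
    left_inv' := fun x hx => (hg' _ (hRS _ (hf x hx)).2 x (hf x hx)).symm
    right_inv' := fun y hy => (hf' _ (hRS _ (hg y hy)).1 y (hg y hy)).symm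
    open_source := hS
    open_target := hS'
    -- On `S` the preimage of a closed set is the projection of a closed part of `R`, which is
    -- closed by compactness.
    continuousOn_toFun := continuousOn_iff_isClosed.2 fun C hC =>
      ⟨Prod.fst '' (R ∩ Prod.snd ⁻¹' C),
        isClosedMap_fst_of_compactSpace _ (hR.inter (hC.preimage continuous_snd)), ?_⟩
    continuousOn_invFun := continuousOn_iff_isClosed.2 fun C hC =>
      ⟨Prod.snd '' (R ∩ Prod.fst ⁻¹' C),
        isClosedMap_snd_of_compactSpace _ (hR.inter (hC.preimage continuous_fst)), ?_⟩ },
    rfl, hf⟩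
  · ext x
    constructor
    · rintro ⟨hx, hxS⟩
      exact ⟨⟨(x, f x), ⟨hf x hxS, hx⟩, rfl⟩, hxS⟩
    · rintro ⟨⟨⟨x', y⟩, ⟨hR', hy⟩, rfl⟩, hxS⟩
      refine ⟨?_, hxS⟩
      rw [Set.mem_preimage, ← hf' _ hxS _ hR']
      exact hy
  · ext y
    constructor
    · rintro ⟨hy, hyS⟩
      exact ⟨⟨(g y, y), ⟨hg y hyS, hy⟩, rfl⟩, hyS⟩
    · rintro ⟨⟨⟨x, y'⟩, ⟨hR', hx⟩, rfl⟩, hyS⟩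
      refine ⟨?_, hyS⟩
      rw [Set.mem_preimage, ← hg' _ hyS _ hR']
      exact hx

/-! ### Shift models and their systems -/

namespace HigherRankGraph

open Filter Topology

variable {r : ℕ} {V Λ : Type*} (Γ : HigherRankGraph r V Λ)

/-- Two commuting actions `τ`, `ν` of `ℕ^r` on `Y` over the maps `(n, x) ↦ (n + m, x)` and
`(n, x) ↦ (n, W_m x)` of `ℕ̄^r × Λ^∞`, where `τ_m` is injective with range `{n ≥ m}`, and `ν_m`
maps the part of `Y` over each cylinder of shape `m` bijectively to the part over the paths which
can follow. -/
structure ShiftModel (Y : Type*) [TopologicalSpace Y] where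
  φ : Y → Γ.SpaceNL
  τ : (Fin r → ℕ) → Y → Y
  ν : (Fin r → ℕ) → Y → Y
  continuous_φ : Continuous φ
  continuous_τ : ∀ m, Continuous (τ m)
  continuous_ν : ∀ m, Continuous (ν m)
  τ_zero : ∀ y, τ 0 y = y
  ν_zero : ∀ y, ν 0 y = y
  τ_add : ∀ m n y, τ (m + n) y = τ m (τ n y)
  ν_add : ∀ m n y, ν (m + n) y = ν m (ν n y)
  τ_ν : ∀ m n y, τ m (ν n y) = ν n (τ m y)
  φ_τ : ∀ m y, φ (τ m y) = (fun j => (φ y).1 j + m j, (φ y).2)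
  φ_ν : ∀ m y, φ (ν m y) = ((φ y).1, (φ y).2.shift m)
  τ_injective : ∀ m, Function.Injective (τ m)
  exists_τ : ∀ m y, (∀ j, (m j : ℕ∞) ≤ (φ y).1 j) → ∃ w, τ m w = y
  ν_injective : ∀ m y y', (φ y).2.init m = (φ y').2.init m → ν m y = ν m y' → y = y'
  exists_ν : ∀ l y, Γ.s l = (φ y).2.t → ∃ w, (φ w).2.init (Γ.σ l) = l ∧ ν (Γ.σ l) w = y

namespace ShiftModel

variable {Γ} {Y : Type*} [TopologicalSpace Y] (M : Γ.ShiftModel Y)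

/-- `T` is the system `τ⁻¹ ν` of rank `r + r`. -/
def IsSystem (T : (Fin r ⊕ Fin r → ℕ) → (Y →. Y)) : Prop :=
  ∀ n y w, w ∈ T n y ↔ M.τ (fun j => n (Sum.inl j)) w = M.ν (fun j => n (Sum.inr j)) y

variable {M} {T : (Fin r ⊕ Fin r → ℕ) → (Y →. Y)}

/-- `ν` leaves the first coordinate of `φ` unchanged and `τ_m` has range `{n ≥ m}`; hence the domain
is visible in `φ` alone, and (DC) is immediate. -/
theorem IsSystem.mem_dom (hT : M.IsSystem T) {n : Fin r ⊕ Fin r → ℕ} {y : Y} :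
    y ∈ (T n).Dom ↔ ∀ j, (n (Sum.inl j) : ℕ∞) ≤ (M.φ y).1 j := by
  rw [PFun.mem_dom]
  constructor
  · rintro ⟨w, hw⟩ j
    have h := congrArg (fun y => (M.φ y).1 j) ((hT _ _ _).1 hw)
    simp only [M.φ_τ, M.φ_ν] at h
    rw [← h]
    exact le_add_self
  · intro h
    obtain ⟨w, hw⟩ := M.exists_τ (fun j => n (Sum.inl j)) (M.ν (fun j => n (Sum.inr j)) y)
      (by simpa only [M.φ_ν] using h)
    exact ⟨w, (hT _ _ _).2 hw⟩

theorem IsSystem.φ_eq (hT : M.IsSystem T) {n : Fin r ⊕ Fin r → ℕ} {y w : Y} (h : w ∈ T n y) :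
    (∀ j, (M.φ w).1 j + n (Sum.inl j) = (M.φ y).1 j) ∧
      (M.φ w).2 = (M.φ y).2.shift fun j => n (Sum.inr j) := by
  have h := congrArg M.φ ((hT _ _ _).1 h)
  rw [M.φ_τ, M.φ_ν] at h
  exact ⟨fun j => congrFun (congrArg Prod.fst h) j, congrArg Prod.snd h⟩

theorem IsSystem.domainCondition (hT : M.IsSystem T) : DomainCondition T := by
  rintro m n y ⟨h1, h2⟩
  rw [hT.mem_dom] at h1 h2 ⊢
  intro j
  rcases le_total (m (Sum.inl j)) (n (Sum.inl j)) with h | h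
  · rw [Pi.sup_apply, sup_eq_right.2 h]
    exact h2 j
  · rw [Pi.sup_apply, sup_eq_left.2 h]
    exact h1 j

theorem IsSystem.isPartialLocalHomeo [CompactSpace Y] [T2Space Y] (hT : M.IsSystem T)
    (n : Fin r ⊕ Fin r → ℕ) : IsPartialLocalHomeo (T n) := by
  have hdom : IsClopen (T n).Dom := by
    have h : (T n).Dom = ⋂ j, {y | (n (Sum.inl j) : ℕ∞) ≤ (M.φ y).1 j} := by
      ext y
      rw [hT.mem_dom]
      simp
    rw [h]
    exact isClopen_iInter_of_finite fun j => (ENat.isClopen_setOf_le _).preimage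
      ((continuous_apply j).comp (continuous_fst.comp M.continuous_φ))
  refine ⟨hdom.isOpen, fun y hy => ?_⟩
  let k : Fin r → ℕ := fun j => n (Sum.inr j)
  let m : Fin r → ℕ := fun j => n (Sum.inl j)
  let l := (M.φ y).2.init k
  have hl : Γ.σ l = k := InfPath.σ_init _ _
  -- On the part of the domain over one cylinder `l`, the map is a bijection onto the points over
  -- paths starting at `s(l)`. Its graph is closed, so compactness yields the homeomorphism.
  let S : Set Y := (T n).Dom ∩ {x | (M.φ x).2.init k ∈ ({l} : Set Λ)}
  let S' : Set Y := {x | (M.φ x).2.t ∈ ({Γ.s l} : Set V)}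
  have hS : IsClopen S := hdom.inter
    ((InfPath.isClopen_init k _).preimage (continuous_snd.comp M.continuous_φ))
  have hS' : IsClopen S' := by
    have h : IsLocallyConstant fun x => (M.φ x).2.t :=
      InfPath.isLocallyConstant_t.comp_continuous (continuous_snd.comp M.continuous_φ)
    exact ⟨⟨h {Γ.s l}ᶜ⟩, h {Γ.s l}⟩
  let R : Set (Y × Y) := {p | M.τ m p.2 = M.ν k p.1} ∩ S ×ˢ S'
  have hR : IsClosed R := (isClosed_eq ((M.continuous_τ m).comp continuous_snd)
    ((M.continuous_ν k).comp continuous_fst)).inter (hS.isClosed.prod hS'.isClosed)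
  have : Nonempty Y := ⟨y⟩
  suffices h : (∀ x ∈ S, ∃! w, (x, w) ∈ R) ∧ ∀ w ∈ S', ∃! x, (x, w) ∈ R by
    obtain ⟨e, he, he'⟩ := exists_openPartialHomeomorph_of_graph hR hS.isOpen hS'.isOpen
      (fun p hp => hp.2) h.1 h.2
    exact ⟨e, he ▸ ⟨hy, rfl⟩, fun x hx => (hT _ _ _).2 (he' x (he ▸ hx)).1⟩
  constructor
  · intro x hx
    obtain ⟨w, hw⟩ := (PFun.mem_dom _ _).1 hx.1
    refine ⟨w, ⟨(hT _ _ _).1 hw, hx, ?_⟩, fun w' hw' => ?_⟩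
    · change (M.φ w).2.t = Γ.s l
      rw [(hT.φ_eq hw).2, InfPath.t_shift]
      exact congrArg Γ.s hx.2
    · exact M.τ_injective m (hw'.1.trans ((hT _ _ _).1 hw).symm)
  · intro w hw
    obtain ⟨x, hx1, hx2⟩ := M.exists_ν l (M.τ m w) (by rw [M.φ_τ]; exact hw.symm)
    rw [hl] at hx1 hx2
    have hwx : w ∈ T n x := (hT _ _ _).2 hx2.symm
    refine ⟨x, ⟨hx2.symm, ⟨(PFun.mem_dom _ _).2 ⟨w, hwx⟩, hx1⟩, hw⟩, fun x' hx' => ?_⟩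
    exact M.ν_injective k _ _ (hx'.2.1.2.trans hx1.symm) (hx'.1.symm.trans hx2.symm)

theorem IsSystem.isMGDS [CompactSpace Y] [T2Space Y] (hT : M.IsSystem T) : IsMGDS T where
  zero := by
    refine PFun.ext fun y w => ?_
    rw [hT]
    have h1 : M.τ (fun j => (0 : Fin r ⊕ Fin r → ℕ) (Sum.inl j)) w = w := M.τ_zero w
    have h2 : M.ν (fun j => (0 : Fin r ⊕ Fin r → ℕ) (Sum.inr j)) y = y := M.ν_zero y
    rw [h1, h2]
    simp [eq_comm]
  add m n := by
    refine PFun.ext fun y w => ?_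
    rw [hT, PFun.comp_apply]
    refine Iff.trans ?_ Part.mem_bind_iff.symm
    have h1 := M.τ_add (fun j => n (Sum.inl j)) (fun j => m (Sum.inl j)) w
    have h2 := M.ν_add (fun j => m (Sum.inr j)) (fun j => n (Sum.inr j)) y
    rw [add_comm] at h1
    -- Injectivity of `τ_n` permits applying it to both sides; commutation with `ν` and the defining
    -- equation of `u` then turn the equation for `m` into the one for `m + n`.
    have key : ∀ u, M.τ (fun j => n (Sum.inl j)) u = M.ν (fun j => n (Sum.inr j)) y →
        (M.τ (fun j => (m + n) (Sum.inl j)) w = M.ν (fun j => (m + n) (Sum.inr j)) y ↔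
          M.τ (fun j => m (Sum.inl j)) w = M.ν (fun j => m (Sum.inr j)) u) := by
      intro u hu
      refine Iff.trans ?_ (M.τ_injective fun j => n (Sum.inl j)).eq_iff
      rw [M.τ_ν, hu, ← h1, ← h2]
      rfl
    constructor
    · intro h
      have hy : y ∈ (T n).Dom := by
        have hm : y ∈ (T (m + n)).Dom := (PFun.mem_dom _ _).2 ⟨w, (hT _ _ _).2 h⟩
        rw [hT.mem_dom] at hm ⊢
        refine fun j => le_trans ?_ (hm j)
        rw [Pi.add_apply]
        exact Nat.cast_le.2 le_add_self
      obtain ⟨u, hu⟩ := (PFun.mem_dom _ _).1 hy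
      exact ⟨u, hu, (hT _ _ _).2 ((key u ((hT _ _ _).1 hu)).1 h)⟩
    · rintro ⟨u, hu, hw⟩
      exact (key u ((hT _ _ _).1 hu)).2 ((hT _ _ _).1 hw)
  localHomeo := hT.isPartialLocalHomeo

/-! ### The morphism to the groupoid of `ℕ̄^r × Λ^∞` -/

theorem mem_systemNL {n : Fin r ⊕ Fin r → ℕ} {p q : Γ.SpaceNL} : q ∈ Γ.systemNL n p ↔
    (∀ j, q.1 j + n (Sum.inl j) = p.1 j) ∧ q.2 = p.2.shift fun j => n (Sum.inr j) := by
  constructor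
  · rintro ⟨h, rfl⟩
    exact ⟨fun j => tsub_add_cancel_of_le (h j), rfl⟩
  · rintro ⟨h1, h2⟩
    refine ⟨fun j => (h1 j).symm ▸ le_add_self, Prod.ext (funext fun j => ?_) h2.symm⟩
    change p.1 j - (n (Sum.inl j) : ℕ∞) = q.1 j
    refine ENat.add_left_injective_of_ne_top (ENat.natCast_ne_top (n (Sum.inl j))) ?_
    change p.1 j - (n (Sum.inl j) : ℕ∞) + n (Sum.inl j) = q.1 j + n (Sum.inl j)
    rw [h1 j, tsub_add_cancel_of_le (h1 j ▸ le_add_self)]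

variable (Γ) in
/-- The space `ℕ̄^r × Λ^∞` itself. -/
def base : Γ.ShiftModel Γ.SpaceNL where
  φ p := p
  τ m p := (fun j => p.1 j + m j, p.2)
  ν m p := (p.1, p.2.shift m)
  continuous_φ := continuous_id
  continuous_τ m := (continuous_pi fun j =>
    ((continuous_apply j).comp continuous_fst).add continuous_const).prodMk continuous_snd
  continuous_ν m := continuous_fst.prodMk ((InfPath.continuous_shift m).comp continuous_snd)
  τ_zero p := by simp
  ν_zero p := by rw [InfPath.shift_zero]
  τ_add m n p := Prod.ext (funext fun j => by
    simp only [Pi.add_apply, Nat.cast_add]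
    rw [add_assoc, add_comm (n j : ℕ∞)]) rfl
  ν_add m n p := by rw [InfPath.shift_shift, add_comm]
  τ_ν _ _ _ := rfl
  φ_τ _ _ := rfl
  φ_ν _ _ := rfl
  τ_injective m p q h := Prod.ext (funext fun j =>
    (ENat.add_left_injective_of_ne_top (ENat.natCast_ne_top (m j)))
      (congrFun (congrArg Prod.fst h) j)) (congrArg Prod.snd h :)
  exists_τ m p h := ⟨(fun j => p.1 j - m j, p.2),
    Prod.ext (funext fun j => tsub_add_cancel_of_le (h j)) rfl⟩
  ν_injective m p q h h' := Prod.ext (congrArg Prod.fst h' :)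
    (InfPath.eq_of_init_shift h (congrArg Prod.snd h'))
  exists_ν l p h := by
    obtain ⟨z, hz⟩ := InfPath.exists_isPrepend h
    exact ⟨(p.1, z), hz.1, Prod.ext rfl hz.2⟩

theorem isSystem_systemNL : (base Γ).IsSystem Γ.systemNL := by
  intro n p q
  rw [mem_systemNL, Prod.ext_iff]
  exact and_congr funext_iff.symm Iff.rfl

theorem IsSystem.map_mem (hT : M.IsSystem T) {n : Fin r ⊕ Fin r → ℕ} {y w : Y} (h : w ∈ T n y) :
    M.φ w ∈ Γ.systemNL n (M.φ y) :=
  mem_systemNL.2 (hT.φ_eq h)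

/-- The map of semidirect product groupoids over `φ`. -/
def mapGroupoid (hT : M.IsSystem T) (g : SemidirectGroupoid T) : SemidirectGroupoid Γ.systemNL :=
  ⟨(M.φ g.1.1, g.1.2.1, M.φ g.1.2.2), by
    obtain ⟨m, n, hk, w, h1, h2⟩ := g.2
    exact ⟨m, n, hk, _, hT.map_mem h1, hT.map_mem h2⟩⟩

theorem mapGroupoid_mem_repSet (hT : M.IsSystem T) {m n : Fin r ⊕ Fin r → ℕ}
    {g : SemidirectGroupoid T} (hg : g ∈ repSet T m n) :
    mapGroupoid hT g ∈ repSet Γ.systemNL m n := by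
  obtain ⟨hk, w, h1, h2⟩ := hg
  exact ⟨hk, _, hT.map_mem h1, hT.map_mem h2⟩

variable (hT : M.IsSystem T) (h₁ : IsMGDS T) (d₁ : DomainCondition T) (h₂ : IsMGDS Γ.systemNL)
  (d₂ : DomainCondition Γ.systemNL)

theorem isMorphism_mapGroupoid : GroupoidStr.IsMorphism (semidirectGroupoid h₁ d₁)
    (semidirectGroupoid h₂ d₂) (mapGroupoid hT) M.φ where
  continuous := by
    refine continuous_iff_continuousAt.2 fun g => ?_
    obtain ⟨m, n, hg⟩ := exists_mem_repSet g
    refine semidirect_tendsto h₂ d₂ (mapGroupoid_mem_repSet hT hg) ?_ ?_ ?_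
    · filter_upwards [(isOpen_repSet h₁ m n).mem_nhds hg] with g' hg'
      exact mapGroupoid_mem_repSet hT hg'
    · exact (M.continuous_φ.comp (continuous_range_source h₁).fst).tendsto g
    · exact (M.continuous_φ.comp (continuous_range_source h₁).snd).tendsto g
  r_map _ := rfl
  s_map _ := rfl
  map_mul _ _ _ := rfl

/-- Injectivity: if two elements agree in range, degree and image, then their sources lie over the
same point and have a common image under some `T^m`, which `ν_injective` forbids unless they are
equal. Surjectivity: `T^m y` is defined because domains are read off `φ`, and `exists_ν` lifts the
prescribed path from it. -/
theorem isRangeFibreBijective_mapGroupoid :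
    GroupoidStr.IsRangeFibreBijective (semidirectGroupoid h₁ d₁)
      (semidirectGroupoid h₂ d₂) (mapGroupoid hT) M.φ := by
  intro y
  refine ⟨fun g hg => congrArg M.φ hg, ?_, ?_⟩
  · rintro ⟨⟨x, k, y₁⟩, hg⟩ hx ⟨⟨x', k', y₂⟩, hg'⟩ hx' he
    obtain rfl : x = y := hx
    obtain rfl : x' = x := hx'
    have he' := congrArg Subtype.val he
    obtain rfl : k = k' := congrArg (fun p : Γ.SpaceNL × _ × Γ.SpaceNL => p.2.1) he'
    have hφ : M.φ y₁ = M.φ y₂ := congrArg (fun p : Γ.SpaceNL × _ × Γ.SpaceNL => p.2.2) he'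
    -- The quotient of the two elements has degree `0`, so it is represented by equal exponents.
    obtain ⟨m, n, hk, w, h1, h2⟩ := semidirect_mul_mem h₁ d₁
      ((semidirectGroupoid h₁ d₁).inv ⟨(x', k, y₁), hg⟩) ⟨(x', k, y₂), hg'⟩ rfl
    obtain rfl : m = n := funext fun j => by
      have := hk j
      simp only [semidirectGroupoid, neg_add_cancel, Pi.zero_apply] at this
      omega
    have h3 : y₁ = y₂ := M.ν_injective (fun j => m (Sum.inr j)) _ _ (by rw [hφ])
      (((hT _ _ _).1 h1).symm.trans ((hT _ _ _).1 h2))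
    subst h3
    rfl
  · rintro ⟨⟨p, k, q⟩, m, n, hk, w₀, h1, h2⟩ hp
    obtain rfl : p = M.φ y := hp
    have hy : y ∈ (T m).Dom := by
      rw [hT.mem_dom]
      intro j
      rw [← (mem_systemNL.1 h1).1 j]
      exact le_add_self
    obtain ⟨w, hw⟩ := (PFun.mem_dom _ _).1 hy
    obtain rfl := Part.mem_unique h1 (hT.map_mem hw)
    obtain ⟨h3, h4⟩ := mem_systemNL.1 h2
    obtain ⟨y', hy1, hy2⟩ := M.exists_ν (q.2.init fun j => n (Sum.inr j))
      (M.τ (fun j => n (Sum.inl j)) w) (by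
        rw [M.φ_τ, h4, InfPath.t_shift])
    rw [InfPath.σ_init] at hy1 hy2
    have hw' : w ∈ T n y' := (hT _ _ _).2 hy2.symm
    obtain ⟨h5, h6⟩ := hT.φ_eq hw'
    have hq : M.φ y' = q := Prod.ext (funext fun j => (h5 j).symm.trans (h3 j))
      (InfPath.eq_of_init_shift hy1 (h6.symm.trans h4))
    subst hq
    exact ⟨⟨(y, k, y'), m, n, hk, w, hw, hw'⟩, rfl, rfl⟩

end ShiftModel

/-! ### The system on `Z` -/

namespace SpaceZ

variable {Γ} (hΓ : Γ.FinitenessCondition)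

/-- The actions `τ` and `ν` on `Z`. -/
def shiftModel : Γ.ShiftModel Γ.SpaceZ where
  φ := phi hΓ
  τ := tau
  ν := nu hΓ
  continuous_φ := continuous_phi hΓ
  continuous_τ := continuous_tau
  continuous_ν := continuous_nu hΓ
  τ_zero := tau_zero
  ν_zero := forall_of_ofPath (C := {p | nu hΓ 0 p = p})
    (isClosed_eq (continuous_nu hΓ 0) continuous_id)
    fun n z => by rw [Set.mem_ofPred_eq, nu_ofPath, InfPath.shift_zero]
  τ_add m n := forall_of_ofPath (C := {p | tau (m + n) p = tau m (tau n p)})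
    (isClosed_eq (continuous_tau _) ((continuous_tau m).comp (continuous_tau n)))
    fun k z => by
      rw [Set.mem_ofPred_eq, tau_ofPath, tau_ofPath, tau_ofPath, add_assoc, add_comm m]
  ν_add m n := forall_of_ofPath (C := {p | nu hΓ (m + n) p = nu hΓ m (nu hΓ n p)})
    (isClosed_eq (continuous_nu hΓ _) ((continuous_nu hΓ m).comp (continuous_nu hΓ n)))
    fun k z => by
      rw [Set.mem_ofPred_eq, nu_ofPath, nu_ofPath, nu_ofPath, InfPath.shift_shift, add_comm]
  τ_ν m n := forall_of_ofPath (C := {p | tau m (nu hΓ n p) = nu hΓ n (tau m p)})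
    (isClosed_eq ((continuous_tau m).comp (continuous_nu hΓ n))
      ((continuous_nu hΓ n).comp (continuous_tau m)))
    fun k z => by
      rw [Set.mem_ofPred_eq, nu_ofPath, tau_ofPath, tau_ofPath, nu_ofPath]
  φ_τ m := forall_of_ofPath
    (C := {p | phi hΓ (tau m p) = (fun j => (phi hΓ p).1 j + m j, (phi hΓ p).2)})
    (isClosed_eq ((continuous_phi hΓ).comp (continuous_tau m))
      (((ShiftModel.base Γ).continuous_τ m).comp (continuous_phi hΓ)))
    fun k z => by
      rw [Set.mem_ofPred_eq, tau_ofPath, phi_ofPath, phi_ofPath]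
      simp only [Pi.add_apply, Nat.cast_add]
  φ_ν m := forall_of_ofPath
    (C := {p | phi hΓ (nu hΓ m p) = ((phi hΓ p).1, (phi hΓ p).2.shift m)})
    (isClosed_eq ((continuous_phi hΓ).comp (continuous_nu hΓ m))
      (((ShiftModel.base Γ).continuous_ν m).comp (continuous_phi hΓ)))
    fun k z => by
      rw [Set.mem_ofPred_eq, nu_ofPath, phi_ofPath, phi_ofPath]
  τ_injective := tau_injective
  -- The range of `tau m` is closed by compactness, and it contains the dense set of explicit points
  -- of the open set `{n ≥ m}`. The field `exists_ν` is handled in the same way.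
  exists_τ m y hy := by
    have := compactSpace_spaceZ hΓ
    refine denseRange_ofPath.isClopen_subset
      (U := ⋂ j, {y | (m j : ℕ∞) ≤ (phi hΓ y).1 j}) (W := Set.range (tau m))
      (isOpen_iInter_of_finite fun j => ((ENat.isClopen_setOf_le _).preimage
        ((continuous_apply j).comp (_root_.continuous_fst.comp (continuous_phi hΓ)))).isOpen)
      (isCompact_range (continuous_tau m)).isClosed ?_ (Set.mem_iInter.2 hy)
    rintro ⟨n, z⟩ hn
    have hmn : m ≤ n := fun j => by
      have h := Set.mem_iInter.1 hn j
      rw [Set.mem_ofPred_eq, phi_ofPath] at h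
      exact Nat.cast_le.1 h
    exact ⟨ofPath (n - m, z), by rw [tau_ofPath, tsub_add_cancel_of_le hmn]⟩
  ν_injective m y y' := nu_injective hΓ
  exists_ν l y hy := by
    have := compactSpace_spaceZ hΓ
    have hE : IsClosed {w : Γ.SpaceZ | (phi hΓ w).2.init (Γ.σ l) ∈ ({l} : Set Λ)} :=
      ((InfPath.isClopen_init _ _).preimage
        (_root_.continuous_snd.comp (continuous_phi hΓ))).isClosed
    have ht : IsLocallyConstant fun w : Γ.SpaceZ => (phi hΓ w).2.t :=
      InfPath.isLocallyConstant_t.comp_continuous (_root_.continuous_snd.comp (continuous_phi hΓ))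
    refine denseRange_ofPath.isClopen_subset (ht {Γ.s l})
      (hE.isCompact.image (continuous_nu hΓ (Γ.σ l))).isClosed ?_ (hy.symm :)
    rintro ⟨n, z⟩ hn
    have hn' : (phi hΓ (ofPath (n, z))).2.t = Γ.s l := hn
    rw [phi_ofPath] at hn'
    obtain ⟨z', hz⟩ := InfPath.exists_isPrepend hn'.symm
    refine ⟨ofPath (n, z'), ?_, ?_⟩
    · change (phi hΓ (ofPath (n, z'))).2.init (Γ.σ l) = l
      rw [phi_ofPath]
      exact hz.1
    · rw [nu_ofPath, hz.2]

theorem isSystem_systemZ : (shiftModel hΓ).IsSystem Γ.systemZ := fun _ _ _ => mem_systemZ hΓ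

end SpaceZ

end HigherRankGraph

/-! ### Homomorphisms on `𝒯^{⊗r} ⊗ C*(Λ)` -/

/-- The C⋆-identity, applied first to the projection `p` and then to `a`. It provides the norm
bounds required of models. -/
theorem norm_le_one_of_star_mul_self {B : Type*} [NonUnitalCStarAlgebra B] {a p : B}
    (h : star a * a = p) (hp : star p = p) (hpp : p * p = p) : ‖a‖ ≤ 1 := by
  have h1 : ‖p‖ ≤ 1 := by
    have h2 := CStarRing.norm_star_mul_self (x := p)
    rw [hp, hpp] at h2
    nlinarith [norm_nonneg p]
  have h3 := CStarRing.norm_star_mul_self (x := a)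
  rw [h] at h3
  nlinarith [norm_nonneg a]

theorem CStarPresentation.commute_lift_lift {X Y B : Type*} [CStarAlgebra B]
    {P : CStarPresentation X} {Q : CStarPresentation Y} {g : X → B} {h : Y → B}
    (hg : P.IsModel g) (hh : Q.IsModel h) (h1 : ∀ x y, Commute (g x) (h y))
    (h2 : ∀ x y, Commute (g x) (star (h y))) (a : P.Universal) (b : Q.Universal) :
    Commute (lift hg a) (lift hh b) := by
  refine commute_lift hh (fun y => ?_) (fun y => ?_) b
  · refine (commute_lift hg (fun x => (h1 x y).symm) (fun x => ?_) a).symm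
    have := (h2 x y).star_star
    rw [star_star] at this
    exact this.symm
  · refine (commute_lift hg (fun x => (h2 x y).symm) (fun x => ?_) a).symm
    exact ((h1 x y).star_star).symm

namespace HigherRankGraph

universe u v w

variable {r : ℕ} {V : Type v} {Λ : Type u} {Γ : HigherRankGraph r V Λ} {B : Type w} [CStarAlgebra B]

variable (Γ) in
/-- A family of elements satisfying the Cuntz–Krieger relations. -/
structure IsCuntzKrieger (s : Λ → B) : Prop where
  star_id : ∀ v, star (s (Γ.id v)) = s (Γ.id v)
  id_mul_id : ∀ v, s (Γ.id v) * s (Γ.id v) = s (Γ.id v)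
  id_mul_id_of_ne : ∀ v w, v ≠ w → s (Γ.id v) * s (Γ.id w) = 0
  comp : ∀ l m h, s (Γ.comp l m h) = s l * s m
  star_mul : ∀ l, star (s l) * s l = s (Γ.id (Γ.s l))
  sum : ∀ v n, s (Γ.id v) = ∑ᶠ l : {l : Λ // Γ.t l = v ∧ Γ.σ l = n}, s (l : Λ) * star (s (l : Λ))
  sum_id : 1 = ∑ᶠ v, s (Γ.id v)

theorem IsCuntzKrieger.isModel (hΓ : Γ.FinitenessCondition) {s : Λ → B} (h : Γ.IsCuntzKrieger s) :
    Γ.presentation.IsModel s where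
  rel a ha := by
    rcases ha with ⟨v, rfl⟩ | ⟨v, rfl⟩ | ⟨v, w, hne, rfl⟩ | ⟨l, m, e, rfl⟩ | ⟨l, rfl⟩ |
      ⟨v, n, rfl⟩ | rfl
    · simp only [map_sub, map_star, FreeStarAlg.lift_gen, h.star_id, sub_self]
    · simp only [map_sub, map_mul, FreeStarAlg.lift_gen, h.id_mul_id, sub_self]
    · simp only [map_mul, FreeStarAlg.lift_gen, h.id_mul_id_of_ne v w hne]
    · simp only [map_sub, map_mul, FreeStarAlg.lift_gen, h.comp, sub_self]
    · simp only [map_sub, map_mul, map_star, FreeStarAlg.lift_gen, h.star_mul, sub_self]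
    · have : Finite {l : Λ // Γ.t l = v ∧ Γ.σ l = n} :=
        ((hΓ.finite n).subset fun l hl => hl.2 : {l : Λ | Γ.t l = v ∧ Γ.σ l = n}.Finite)
      rw [map_sub, map_finsum _ (Set.toFinite _)]
      simp only [map_mul, map_star, FreeStarAlg.lift_gen]
      rw [← h.sum, sub_self]
    · have := hΓ.finite_objects
      rw [map_sub, map_finsum _ (Set.toFinite _), map_one]
      simp only [FreeStarAlg.lift_gen]
      rw [← h.sum_id, sub_self]
  norm_le l := by
    have := norm_le_one_of_star_mul_self (h.star_mul l) (h.star_id _) (h.id_mul_id _)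
    simpa [presentation] using this

theorem isModel_toeplitz {S : B} (h : star S * S = 1) :
    toeplitzPresentation.{u}.IsModel fun _ => S where
  rel a ha := by
    obtain rfl := ha
    simp only [map_sub, map_mul, map_star, map_one, FreeStarAlg.lift_gen, h, sub_self]
  norm_le _ := by
    have := norm_le_one_of_star_mul_self h (star_one _) (one_mul _)
    simpa [toeplitzPresentation] using this

/-- A Cuntz–Krieger family and isometries, all commuting in the sense of ⋆-algebras, define a
homomorphism on `𝒯^{⊗r} ⊗ C*(Λ)`. -/
theorem exists_hom_toeplitzTensor (hΓ : Γ.FinitenessCondition) {s : Λ → B} {S : Fin r → B}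
    (hs : Γ.IsCuntzKrieger s) (hS : ∀ j, star (S j) * S j = 1)
    (hSS : ∀ i j, i ≠ j → Commute (S i) (S j) ∧ Commute (S i) (star (S j)))
    (hsS : ∀ l j, Commute (s l) (S j) ∧ Commute (s l) (star (S j))) :
    ∃ Θ : Γ.ToeplitzTensor →⋆ₙₐ[ℂ] B, (∀ j, Θ (Γ.tensorS j) = S j) ∧
      ∀ l, Θ (Γ.tensorGen l) = s l := by
  have h1 := hs.isModel hΓ
  have h2 := fun j => isModel_toeplitz.{u} (hS j)
  let θ : ∀ i, Γ.tensorFactor i →⋆ₐ[ℂ] B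
    | none => CStarPresentation.lift h1
    | some j => CStarPresentation.lift (h2 j)
  -- Commutation on whole factors follows from commutation of the generators with generators and
  -- adjoints.
  have hcomm : ∀ i j, i ≠ j → ∀ a b, Commute (θ i a) (θ j b) := by
    rintro (_ | i) (_ | j) hij a b
    · exact (hij rfl).elim
    · exact CStarPresentation.commute_lift_lift h1 (h2 j) (fun l _ => (hsS l j).1)
        (fun l _ => (hsS l j).2) a b
    · exact (CStarPresentation.commute_lift_lift h1 (h2 i) (fun l _ => (hsS l i).1)
        (fun l _ => (hsS l i).2) b a).symm
    · have hne : i ≠ j := fun h => hij (congrArg some h)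
      exact CStarPresentation.commute_lift_lift (h2 i) (h2 j) (fun _ _ => (hSS i j hne).1)
        (fun _ _ => (hSS i j hne).2) a b
  have hθ : (tensorPresentation Γ.tensorFactor).IsModel fun a => θ a.1 a.2 :=
    { rel := fun a ha => by
        rcases ha with ⟨i, a, b, rfl⟩ | ⟨i, a, c, rfl⟩ | ⟨i, a, b, rfl⟩ | ⟨i, a, rfl⟩ | ⟨i, rfl⟩ |
          ⟨i, j, a, b, hij, rfl⟩
        · simp only [map_sub, map_add, FreeStarAlg.lift_gen, sub_self]
        · simp only [map_sub, map_smul, FreeStarAlg.lift_gen, sub_self]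
        · simp only [map_sub, map_mul, FreeStarAlg.lift_gen, sub_self]
        · simp only [map_sub, map_star, FreeStarAlg.lift_gen, sub_self]
        · simp only [map_sub, map_one, FreeStarAlg.lift_gen, sub_self]
        · simp only [map_sub, map_mul, FreeStarAlg.lift_gen]
          exact sub_eq_zero.2 (hcomm i j hij a b)
      norm_le := fun a => NonUnitalStarAlgHom.norm_apply_le (θ a.1) a.2 }
  refine ⟨(CStarPresentation.lift hθ : Γ.ToeplitzTensor →⋆ₐ[ℂ] B).toNonUnitalStarAlgHom,
    fun j => ?_, fun l => ?_⟩
  · refine (CStarPresentation.lift_ι hθ _).trans ?_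
    exact CStarPresentation.lift_ι (h2 j) PUnit.unit
  · refine (CStarPresentation.lift_ι hθ _).trans ?_
    exact CStarPresentation.lift_ι h1 l

end HigherRankGraph

namespace GroupoidStr

/-! ### Convolution of characteristic functions -/

variable {G X : Type*} {𝒢 : GroupoidStr G X}

/-- As `r` is injective on `A`, the convolution sum at `t` has at most one nonzero term, belonging
to the element of `A` with the range of `t`. -/
theorem conv_indicator {A B C : Set G} (hA : Set.InjOn 𝒢.r A)
    (hC : ∀ t, t ∈ C ↔ ∃ a ∈ A, ∃ b ∈ B, ∃ p, 𝒢.mul a b p = t) :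
    𝒢.conv (A.indicator 1) (B.indicator 1) = C.indicator 1 := by
  classical
  funext t
  unfold conv
  by_cases ht : ∃ a ∈ A, 𝒢.r a = 𝒢.r t
  · obtain ⟨a, ha, hat⟩ := ht
    rw [finsum_eq_single _ ⟨a, hat⟩]
    · have h : 𝒢.mul (𝒢.inv a) t ((𝒢.s_inv a).trans hat) ∈ B ↔ t ∈ C := by
        rw [hC]
        constructor
        · intro hb
          exact ⟨a, ha, _, hb, ((𝒢.r_mul _ _ _).trans (𝒢.r_inv a)).symm,
            𝒢.mul_inv_cancel_left _ _⟩
        · rintro ⟨a', ha', b, hb, p, rfl⟩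
          obtain rfl := hA ha' ha ((𝒢.r_mul _ _ _).symm.trans hat.symm)
          rwa [𝒢.inv_mul_cancel_left]
      by_cases htC : t ∈ C
      · simp [ha, htC, h.2 htC]
      · simp [ha, htC, mt h.1 htC]
    · rintro ⟨b, hb⟩ hne
      have : b ∉ A := fun hbA => hne (Subtype.ext (hA hbA ha (hb.trans hat.symm)))
      simp [this]
  · have htC : t ∉ C := by
      rw [hC]
      rintro ⟨a, ha, b, hb, p, rfl⟩
      exact ht ⟨a, ha, (𝒢.r_mul _ _ _).symm⟩
    rw [Set.indicator_of_notMem htC]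
    refine finsum_eq_zero_of_forall_eq_zero fun h => ?_
    have : h.1 ∉ A := fun hA => ht ⟨h.1, hA, h.2⟩
    simp [this]

theorem inv_unit (x : X) : 𝒢.inv (𝒢.unit x) = 𝒢.unit x := by
  refine (𝒢.eq_inv_of_mul ((𝒢.s_unit x).trans (𝒢.r_unit x).symm) ?_).symm
  rw [𝒢.unit_mul_of_eq, 𝒢.r_unit]

theorem conv_units_left {U : Set G} (hU : ∀ t, t ∈ U ↔ ∃ x, 𝒢.unit x = t) (f : G → ℂ) :
    𝒢.conv (U.indicator 1) f = f := by
  funext t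
  unfold conv
  rw [finsum_eq_single _ ⟨𝒢.unit (𝒢.r t), 𝒢.r_unit _⟩]
  · have h : 𝒢.unit (𝒢.r t) ∈ U := (hU _).2 ⟨_, rfl⟩
    rw [𝒢.mul_congr (𝒢.inv_unit _) rfl _ (𝒢.s_unit _), 𝒢.unit_mul, Set.indicator_of_mem h,
      Pi.one_apply, one_mul]
  · rintro ⟨h, hh⟩ hne
    have : h ∉ U := by
      rw [hU]
      rintro ⟨x, rfl⟩
      obtain rfl : x = 𝒢.r t := (𝒢.r_unit x).symm.trans hh
      exact hne rfl
    rw [Set.indicator_of_notMem this, zero_mul]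

theorem conv_units_right {U : Set G} (hU : ∀ t, t ∈ U ↔ ∃ x, 𝒢.unit x = t) (f : G → ℂ) :
    𝒢.conv f (U.indicator 1) = f := by
  funext t
  unfold conv
  rw [finsum_eq_single _ ⟨t, rfl⟩]
  · have h : 𝒢.mul (𝒢.inv t) t (𝒢.s_inv t) ∈ U := (hU _).2 ⟨_, (𝒢.inv_mul t).symm⟩
    rw [Set.indicator_of_mem h, Pi.one_apply, mul_one]
  · rintro ⟨h, hh⟩ hne
    have : 𝒢.mul (𝒢.inv h) t ((𝒢.s_inv h).trans hh) ∉ U := by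
      rw [hU]
      rintro ⟨x, hx⟩
      refine hne (Subtype.ext ?_)
      have h1 := 𝒢.mul_inv_cancel_left ((𝒢.s_inv h).trans hh)
        ((𝒢.r_inv h).symm.trans (𝒢.r_mul _ _ _).symm)
      rw [𝒢.mul_congr rfl hx.symm _ ((𝒢.r_inv h).symm.trans ((𝒢.r_mul _ _ _).symm.trans
        (congrArg 𝒢.r hx.symm))), 𝒢.mul_unit_of_eq] at h1
      exact h1
    rw [Set.indicator_of_notMem this, mul_zero]

variable [TopologicalSpace G]

theorem toFull_add (f g : C_c(G, ℂ)) : 𝒢.toFull (f + g) = 𝒢.toFull f + 𝒢.toFull g := by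
  refine Subtype.ext ?_
  have h := 𝒢.presentation.isModel_ι.rel _ (Or.inl ⟨f, g, rfl⟩)
  simp only [map_sub, map_add, FreeStarAlg.lift_gen] at h
  exact sub_eq_zero.1 h

theorem toFull_mul {f g h : C_c(G, ℂ)} (hh : ⇑h = 𝒢.conv f g) :
    𝒢.toFull f * 𝒢.toFull g = 𝒢.toFull h := by
  refine Subtype.ext ?_
  have h := 𝒢.presentation.isModel_ι.rel _ (Or.inr (Or.inr (Or.inl ⟨f, g, h, hh, rfl⟩)))
  simp only [map_sub, _root_.map_mul, FreeStarAlg.lift_gen] at h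
  exact (sub_eq_zero.1 h).symm

theorem toFull_star {f h : C_c(G, ℂ)} (hh : ⇑h = 𝒢.invol f) :
    star (𝒢.toFull f) = 𝒢.toFull h := by
  refine Subtype.ext ?_
  have h := 𝒢.presentation.isModel_ι.rel _ (Or.inr (Or.inr (Or.inr ⟨f, h, hh, rfl⟩)))
  simp only [map_sub, map_star, FreeStarAlg.lift_gen] at h
  exact (sub_eq_zero.1 h).symm

variable (𝒢) in
/-- The canonical map `C_c(G) → C*(G)` as an additive homomorphism. -/
def toFullHom : C_c(G, ℂ) →+ 𝒢.FullCStar := AddMonoidHom.mk' 𝒢.toFull toFull_add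

/-- The characteristic function of the unit space is a unit of `C*(G)`. -/
theorem toFull_units {U : Set G} (hU : ∀ t, t ∈ U ↔ ∃ x, 𝒢.unit x = t) {e : C_c(G, ℂ)}
    (he : ⇑e = U.indicator 1) (a : 𝒢.FullCStar) : 𝒢.toFull e * a = a ∧ a * 𝒢.toFull e = a := by
  have hinv : star (𝒢.toFull e) = 𝒢.toFull e := by
    refine toFull_star ?_
    classical
    funext t
    rw [invol, he]
    have h : 𝒢.inv t ∈ U ↔ t ∈ U := by
      rw [hU, hU]
      constructor
      · rintro ⟨x, hx⟩
        exact ⟨x, by rw [← 𝒢.inv_inv t, ← hx, 𝒢.inv_unit]⟩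
      · rintro ⟨x, rfl⟩
        exact ⟨x, (𝒢.inv_unit x).symm⟩
    by_cases ht : t ∈ U
    · simp [ht, h.2 ht]
    · simp [ht, mt h.1 ht]
  refine full_induction (p := fun a => 𝒢.toFull e * a = a ∧ a * 𝒢.toFull e = a)
    ?_ ?_ ?_ ?_ ?_ ?_ ?_ a
  · exact (isClosed_eq (continuous_const.mul continuous_id) continuous_id).inter
      (isClosed_eq (continuous_id.mul continuous_const) continuous_id)
  · intro f
    refine ⟨toFull_mul ?_, toFull_mul ?_⟩
    · rw [he, conv_units_left hU]
    · rw [he, conv_units_right hU]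
  · rw [mul_zero, zero_mul]
    exact ⟨rfl, rfl⟩
  · intro a b ha hb
    rw [mul_add, add_mul, ha.1, ha.2, hb.1, hb.2]
    exact ⟨rfl, rfl⟩
  · intro a b ha hb
    rw [← _root_.mul_assoc, _root_.mul_assoc a b, ha.1, hb.2]
    exact ⟨rfl, rfl⟩
  · intro c a ha
    rw [mul_smul_comm, smul_mul_assoc, ha.1, ha.2]
    exact ⟨rfl, rfl⟩
  · intro a ha
    have h1 := congrArg star ha.1
    have h2 := congrArg star ha.2
    rw [star_mul, hinv] at h1 h2
    exact ⟨h2, h1⟩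

end GroupoidStr

/-! ### Compact open bisections of semidirect product groupoids -/

section Bisection

open Filter Topology

variable {J X : Type*} [TopologicalSpace X]

/-- The set of the `(x, m - n, y)` with `T^m x = T^n y` and `(x, y) ∈ D`, for a given clopen set `D`
such that `y` is determined by `x`. -/
structure SemidirectBisection (T : (J → ℕ) → (X →. X)) where
  rel : X → X → Prop
  m : J → ℕ
  n : J → ℕ
  D : Set (X × X)
  isClopen : IsClopen D
  rel_iff : ∀ x y, rel x y ↔ (∃ w, w ∈ T m x ∧ w ∈ T n y) ∧ (x, y) ∈ D
  functional : ∀ x y y', rel x y → rel x y' → y = y'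

namespace SemidirectBisection

variable {T : (J → ℕ) → (X →. X)} (A B C : SemidirectBisection T)

/-- The degree `m - n`. -/
def deg (j : J) : ℤ := (A.m j : ℤ) - A.n j

/-- The bisection as a subset of the groupoid. -/
def carrier : Set (SemidirectGroupoid T) := {g | A.rel g.1.1 g.1.2.2 ∧ g.1.2.1 = A.deg}

theorem carrier_eq : A.carrier = repSet T A.m A.n ∩ {g | (g.1.1, g.1.2.2) ∈ A.D} := by
  ext g
  constructor
  · rintro ⟨h1, h2⟩
    obtain ⟨h3, h4⟩ := (A.rel_iff _ _).1 h1
    exact ⟨⟨fun j => congrFun h2 j, h3⟩, h4⟩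
  · rintro ⟨⟨h1, h2⟩, h3⟩
    exact ⟨(A.rel_iff _ _).2 ⟨h2, h3⟩, funext h1⟩

theorem carrier_congr {A B : SemidirectBisection T} (hdeg : A.deg = B.deg) (h : ∀ x y, A.rel x y ↔ B.rel x y) :
    A.carrier = B.carrier := by
  ext g
  simp only [carrier, Set.mem_ofPred_eq, hdeg, h]

/-- The element `(x, m - n, y)`. -/
def elem {x y : X} (h : A.rel x y) : SemidirectGroupoid T :=
  ⟨(x, A.deg, y), A.m, A.n, fun _ => rfl, ((A.rel_iff x y).1 h).1⟩

variable (hT : IsMGDS T) (hDC : DomainCondition T) (hK : ∀ m n, IsCompact (repSet T m n))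
  [T2Space (SemidirectGroupoid T)]

/-- The characteristic function of a bisection. -/
def char : C_c(SemidirectGroupoid T, ℂ) :=
  have hopen : IsOpen A.carrier := by
    rw [carrier_eq]
    exact (isOpen_repSet hT _ _).inter (A.isClopen.isOpen.preimage (continuous_range_source hT))
  have hcompact : IsCompact A.carrier := by
    rw [carrier_eq]
    exact (hK _ _).inter_right (A.isClopen.isClosed.preimage (continuous_range_source hT))
  { toFun := A.carrier.indicator 1
    continuous_toFun := continuous_const.indicator (IsClopen.frontier_eq
      ⟨hcompact.isClosed, hopen⟩ ▸ fun _ h => h.elim)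
    hasCompactSupport' := HasCompactSupport.intro' hcompact hcompact.isClosed
      fun _ h => Set.indicator_of_notMem h _ }

theorem char_apply (g : SemidirectGroupoid T) : A.char hT hK g = A.carrier.indicator 1 g := rfl

/-- The characteristic function of a bisection as an element of the groupoid C⋆-algebra. -/
def el : (semidirectGroupoid hT hDC).FullCStar :=
  (semidirectGroupoid hT hDC).toFull (A.char hT hK)

variable {A B C}

theorem el_congr (hdeg : A.deg = B.deg) (h : ∀ x y, A.rel x y ↔ B.rel x y) :
    A.el hT hDC hK = B.el hT hDC hK := by
  refine congrArg (semidirectGroupoid hT hDC).toFull (DFunLike.ext _ _ fun g => ?_)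
  rw [char_apply, char_apply, carrier_congr hdeg h]

/-- The degree is constant on a bisection, so multiplying bisections is composing the relations on
the unit space and adding the degrees. -/
theorem el_mul (hdeg : C.deg = A.deg + B.deg)
    (h : ∀ x z, C.rel x z ↔ ∃ y, A.rel x y ∧ B.rel y z) :
    A.el hT hDC hK * B.el hT hDC hK = C.el hT hDC hK := by
  refine GroupoidStr.toFull_mul (GroupoidStr.conv_indicator ?_ ?_).symm
  · rintro ⟨⟨x, k, y⟩, hg⟩ ⟨h1, h2⟩ ⟨⟨x', k', y'⟩, hg'⟩ ⟨h1', h2'⟩ (rfl : x = x')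
    obtain rfl : y = y' := A.functional _ _ _ h1 h1'
    obtain rfl : k = k' := h2.trans h2'.symm
    rfl
  · rintro ⟨⟨x, k, z⟩, ht⟩
    constructor
    · rintro ⟨h1, h2⟩
      obtain ⟨y, hA, hB⟩ := (h x z).1 h1
      refine ⟨A.elem hA, ⟨hA, rfl⟩, B.elem hB, ⟨hB, rfl⟩, rfl, Subtype.ext ?_⟩
      have h2' : k = C.deg := h2
      change (x, A.deg + B.deg, z) = (x, k, z)
      rw [h2', hdeg]
    · rintro ⟨⟨⟨x', k', y⟩, hg⟩, ⟨hA, hA'⟩, ⟨⟨y', k'', z'⟩, hg'⟩, ⟨hB, hB'⟩, p, he⟩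
      obtain rfl : y = y' := p
      have he' : (x', k' + k'', z') = (x, k, z) := congrArg Subtype.val he
      simp only [Prod.mk.injEq] at he'
      obtain ⟨rfl, rfl, rfl⟩ := he'
      refine ⟨(h _ _).2 ⟨y, hA, hB⟩, ?_⟩
      rw [hdeg, ← hA', ← hB']

theorem el_star (hdeg : C.deg = -A.deg) (h : ∀ x y, C.rel x y ↔ A.rel y x) :
    star (A.el hT hDC hK) = C.el hT hDC hK := by
  classical
  refine GroupoidStr.toFull_star (funext fun t => ?_)
  rw [GroupoidStr.invol, char_apply, char_apply]
  have ht : (semidirectGroupoid hT hDC).inv t ∈ A.carrier ↔ t ∈ C.carrier := by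
    refine and_congr (h _ _).symm ?_
    rw [hdeg]
    exact neg_eq_iff_eq_neg
  by_cases hC : t ∈ C.carrier
  · simp [hC, ht.2 hC]
  · simp [hC, mt ht.1 hC]

theorem el_eq_zero (h : ∀ x y, ¬ A.rel x y) : A.el hT hDC hK = 0 := by
  rw [← map_zero (semidirectGroupoid hT hDC).toFullHom]
  refine congrArg (semidirectGroupoid hT hDC).toFull (DFunLike.ext _ _ fun g => ?_)
  rw [char_apply, Set.indicator_of_notMem fun hg => h _ _ hg.1]
  rfl

/-- The characteristic function of a finite disjoint union of bisections of one degree is the sum of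
the characteristic functions. -/
theorem el_eq_finsum {ι : Type*} [Finite ι] {F : ι → SemidirectBisection T}
    (hdeg : ∀ i, (F i).deg = C.deg) (h : ∀ x y, C.rel x y ↔ ∃ i, (F i).rel x y)
    (hdis : ∀ i i' x y, (F i).rel x y → (F i').rel x y → i = i') :
    C.el hT hDC hK = ∑ᶠ i, (F i).el hT hDC hK := by
  classical
  have := Fintype.ofFinite ι
  rw [finsum_eq_sum_of_fintype]
  refine Eq.trans ?_ (map_sum (semidirectGroupoid hT hDC).toFullHom
    (fun i => (F i).char hT hK) Finset.univ)
  refine congrArg (semidirectGroupoid hT hDC).toFull (DFunLike.ext _ _ fun g => ?_)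
  rw [CompactlySupportedContinuousMap.sum_apply]
  simp only [char_apply]
  by_cases hg : g ∈ C.carrier
  · obtain ⟨i, hi⟩ := (h _ _).1 hg.1
    rw [Finset.sum_eq_single i]
    · have : g ∈ (F i).carrier := ⟨hi, hg.2.trans (hdeg i).symm⟩
      rw [Set.indicator_of_mem hg, Set.indicator_of_mem this]
    · intro i' _ hne
      refine Set.indicator_of_notMem (fun hg' => hne (hdis _ _ _ _ hg'.1 hi)) _
    · exact fun hi => (hi (Finset.mem_univ i)).elim
  · rw [Set.indicator_of_notMem hg, Finset.sum_eq_zero]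
    intro i _
    exact Set.indicator_of_notMem (fun hg' => hg ⟨(h _ _).2 ⟨i, hg'.1⟩, hg'.2.trans (hdeg i)⟩) _

theorem el_unit (hdeg : A.deg = 0) (h : ∀ x y, A.rel x y ↔ x = y)
    (a : (semidirectGroupoid hT hDC).FullCStar) :
    A.el hT hDC hK * a = a ∧ a * A.el hT hDC hK = a := by
  refine GroupoidStr.toFull_units (U := A.carrier) ?_ rfl a
  rintro ⟨⟨x, k, y⟩, ht⟩
  constructor
  · rintro ⟨h1, h2⟩
    obtain rfl : x = y := (h _ _).1 h1
    obtain rfl : k = 0 := h2.trans hdeg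
    exact ⟨x, rfl⟩
  · rintro ⟨x', he⟩
    have he' : (x', (0 : J → ℤ), x') = (x, k, y) := congrArg Subtype.val he
    simp only [Prod.mk.injEq] at he'
    obtain ⟨rfl, rfl, rfl⟩ := he'
    exact ⟨(h _ _).2 rfl, hdeg.symm⟩

end SemidirectBisection

end Bisection

/-- The pairs `(x, y)` with `T^m x = T^n y` form the projection of a closed set in a compact space,
and the groupoid topology for fixed exponents is that of the pairs. -/
theorem HigherRankGraph.ShiftModel.IsSystem.isCompact_repSet {r : ℕ} {V Λ Y : Type*}
    {Γ : HigherRankGraph r V Λ} [TopologicalSpace Y] [CompactSpace Y] [T2Space Y]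
    {M : Γ.ShiftModel Y} {T : (Fin r ⊕ Fin r → ℕ) → (Y →. Y)} (hT : M.IsSystem T)
    (m n : Fin r ⊕ Fin r → ℕ) : IsCompact (repSet T m n) := by
  let Q : Set (Y × Y) := {p | ∃ w, w ∈ T m p.1 ∧ w ∈ T n p.2}
  have hQ : IsCompact Q := by
    have h : Q = Prod.fst '' ({p : (Y × Y) × Y | M.τ (fun j => m (Sum.inl j)) p.2 =
        M.ν (fun j => m (Sum.inr j)) p.1.1} ∩ {p : (Y × Y) × Y | M.τ (fun j => n (Sum.inl j)) p.2 =
        M.ν (fun j => n (Sum.inr j)) p.1.2}) := by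
      ext p
      constructor
      · rintro ⟨w, h1, h2⟩
        exact ⟨(p, w), ⟨(hT _ _ _).1 h1, (hT _ _ _).1 h2⟩, rfl⟩
      · rintro ⟨⟨p, w⟩, ⟨h1, h2⟩, rfl⟩
        exact ⟨w, (hT _ _ _).2 h1, (hT _ _ _).2 h2⟩
    rw [h]
    refine (isClosedMap_fst_of_compactSpace _ (IsClosed.inter ?_ ?_)).isCompact
    · exact isClosed_eq ((M.continuous_τ _).comp continuous_snd)
        ((M.continuous_ν _).comp (continuous_fst.comp continuous_fst))
    · exact isClosed_eq ((M.continuous_τ _).comp continuous_snd)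
        ((M.continuous_ν _).comp (continuous_snd.comp continuous_fst))
  have : CompactSpace Q := isCompact_iff_compactSpace.1 hQ
  let f : Q → SemidirectGroupoid T := fun p =>
    ⟨(p.1.1, fun j => (m j : ℤ) - n j, p.1.2), m, n, fun _ => rfl, p.2⟩
  have hf : Continuous f := by
    refine continuous_iff_continuousAt.2 fun p => ?_
    refine semidirect_tendsto hT.isMGDS hT.domainCondition (m := m) (n := n)
      ⟨fun _ => rfl, p.2⟩ (Filter.Eventually.of_forall fun q => ⟨fun _ => rfl, q.2⟩) ?_ ?_
    · exact (continuous_fst.comp continuous_subtype_val).tendsto p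
    · exact (continuous_snd.comp continuous_subtype_val).tendsto p
  have hr : repSet T m n = Set.range f := by
    ext g
    constructor
    · rintro ⟨h1, h2⟩
      exact ⟨⟨(g.1.1, g.1.2.2), h2⟩, Subtype.ext (Prod.ext rfl (Prod.ext (funext fun j =>
        (h1 j).symm) rfl))⟩
    · rintro ⟨p, rfl⟩
      exact ⟨fun _ => rfl, p.2⟩
  rw [hr]
  exact isCompact_range hf

namespace HigherRankGraph

universe u v

variable {r : ℕ} {V : Type v} {Λ : Type u} {Γ : HigherRankGraph r V Λ}

/-! ### The generators of the groupoid C⋆-algebra of `ℕ̄^r × Λ^∞` -/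

namespace InfPath

theorem isPrepend_id {v : V} {y z : Γ.InfPath} : IsPrepend (Γ.id v) y z ↔ z = y ∧ y.t = v := by
  unfold IsPrepend
  rw [Γ.σ_id, shift_zero, init_zero]
  constructor
  · rintro ⟨h, rfl⟩
    exact ⟨rfl, id_injective h⟩
  · rintro ⟨rfl, rfl⟩
    exact ⟨rfl, rfl⟩

theorem isPrepend_comp {l m : Λ} (h : Γ.s l = Γ.t m) {y z : Γ.InfPath} :
    IsPrepend (Γ.comp l m h) y z ↔ ∃ u, IsPrepend m y u ∧ IsPrepend l u z := by
  constructor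
  · rintro ⟨h1, rfl⟩
    obtain ⟨e, he⟩ := z.comp_init_shift (Γ.σ l) (Γ.σ m)
    rw [Γ.σ_comp] at h1 ⊢
    rw [add_comm, h1] at he
    obtain ⟨h2, h3⟩ := comp_injective (σ_init _ _) he
    refine ⟨z.shift (Γ.σ l), ⟨h3, shift_shift _ _ _⟩, h2, rfl⟩
  · rintro ⟨u, ⟨h1, rfl⟩, h2, rfl⟩
    obtain ⟨e, he⟩ := z.comp_init_shift (Γ.σ l) (Γ.σ m)
    refine ⟨?_, ?_⟩
    · rw [Γ.σ_comp, add_comm, ← he]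
      exact comp_congr h2 h1 _ _
    · rw [Γ.σ_comp, shift_shift]

/-- `z = l y`, where `none` stands for the empty word. -/
def IsPrependOpt (o : Option Λ) (y z : Γ.InfPath) : Prop :=
  match o with
  | none => z = y
  | some l => IsPrepend l y z

end InfPath

open InfPath

variable (Γ) in
/-- The shape of a morphism, or `0` for the empty word. -/
def shapeOpt (o : Option Λ) : Fin r → ℕ := o.elim 0 Γ.σ

theorem isPrependOpt_iff {o : Option Λ} {y z : Γ.InfPath} : IsPrependOpt o y z ↔
    y = z.shift (Γ.shapeOpt o) ∧ ∀ l ∈ o, z.init (Γ.σ l) = l := by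
  cases o with
  | none =>
    change z = y ↔ y = z.shift 0 ∧ _
    rw [shift_zero]
    simp [eq_comm]
  | some l =>
    change IsPrepend l y z ↔ y = z.shift (Γ.σ l) ∧ _
    simp [IsPrepend, and_comm, eq_comm]

theorem InfPath.IsPrependOpt.unique {o : Option Λ} {y z z' : Γ.InfPath} (h : IsPrependOpt o y z)
    (h' : IsPrependOpt o y z') : z = z' := by
  cases o with
  | none => exact Eq.trans h (Eq.symm h')
  | some l => exact IsPrepend.unique h h'

theorem InfPath.IsPrependOpt.unique_left {o : Option Λ} {y y' z : Γ.InfPath} (h : IsPrependOpt o y z)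
    (h' : IsPrependOpt o y' z) : y = y' :=
  (isPrependOpt_iff.1 h).1.trans (isPrependOpt_iff.1 h').1.symm

theorem isClopen_isPrepend (o : Option Λ) :
    IsClopen {z : Γ.InfPath | ∀ l ∈ o, z.init (Γ.σ l) = l} := by
  cases o with
  | none => simpa using isClopen_univ
  | some l => simpa using isClopen_init (Γ := Γ) (Γ.σ l) {l}

theorem enat_add_cancel {a b : ℕ∞} {n : ℕ} (h : a + n = b + n) : a = b :=
  ENat.add_left_injective_of_ne_top (ENat.natCast_ne_top n) h

variable (Γ) in
/-- The bisection of `S^a S^{*b} s_p s_q^*`. -/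
def word (a b : Fin r → ℕ) (p q : Option Λ) : SemidirectBisection Γ.systemNL where
  rel x y := ∃ w : Γ.SpaceNL, ((∀ j, w.1 j + a j = x.1 j) ∧ IsPrependOpt p w.2 x.2) ∧
    (∀ j, w.1 j + b j = y.1 j) ∧ IsPrependOpt q w.2 y.2
  m := Sum.elim a (Γ.shapeOpt p)
  n := Sum.elim b (Γ.shapeOpt q)
  D := {x | (∀ l ∈ p, x.1.2.init (Γ.σ l) = l) ∧ ∀ l ∈ q, x.2.2.init (Γ.σ l) = l}
  isClopen := ((isClopen_isPrepend p).preimage (continuous_snd.comp continuous_fst)).inter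
    ((isClopen_isPrepend q).preimage (continuous_snd.comp continuous_snd))
  rel_iff x y := by
    simp only [isPrependOpt_iff, ShiftModel.mem_systemNL]
    constructor
    · rintro ⟨w, ⟨h1, h2, h3⟩, h4, h5, h6⟩
      exact ⟨⟨w, ⟨h1, h2⟩, h4, h5⟩, h3, h6⟩
    · rintro ⟨⟨w, ⟨h1, h2⟩, h4, h5⟩, h3, h6⟩
      exact ⟨w, ⟨h1, h2, h3⟩, h4, h5, h6⟩
  functional := by
    rintro x y y' ⟨w, ⟨h1, h2⟩, h3, h4⟩ ⟨w', ⟨h1', h2'⟩, h3', h4'⟩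
    obtain rfl : w = w' := Prod.ext
      (funext fun j => enat_add_cancel ((h1 j).trans (h1' j).symm)) (h2.unique_left h2')
    exact Prod.ext (funext fun j => (h3 j).symm.trans (h3' j)) (h4.unique h4')

theorem word_deg (a b : Fin r → ℕ) (p q : Option Λ) : (Γ.word a b p q).deg =
    Sum.elim (fun j => (a j : ℤ) - b j) fun j => (Γ.shapeOpt p j : ℤ) - Γ.shapeOpt q j := by
  funext j
  cases j <;> rfl

theorem word_rel_left {a : Fin r → ℕ} {p : Option Λ} {x y : Γ.SpaceNL} :
    (Γ.word a 0 p none).rel x y ↔ (∀ j, y.1 j + a j = x.1 j) ∧ IsPrependOpt p y.2 x.2 := by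
  constructor
  · rintro ⟨w, h, h1, h2⟩
    obtain rfl : y = w := Prod.ext (funext fun j => (h1 j).symm.trans (by simp)) h2
    exact h
  · intro h
    exact ⟨y, h, fun j => by simp, rfl⟩

theorem word_rel_swap {a b : Fin r → ℕ} {p q : Option Λ} {x y : Γ.SpaceNL} :
    (Γ.word a b p q).rel x y ↔ (Γ.word b a q p).rel y x :=
  exists_congr fun _ => and_comm

theorem word_rel_right {b : Fin r → ℕ} {q : Option Λ} {x y : Γ.SpaceNL} :
    (Γ.word 0 b none q).rel x y ↔ (∀ j, x.1 j + b j = y.1 j) ∧ IsPrependOpt q x.2 y.2 :=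
  word_rel_swap.trans word_rel_left

theorem shapeOpt_id (v : V) : Γ.shapeOpt (some (Γ.id v)) = Γ.shapeOpt none := Γ.σ_id v

theorem isPrependOpt_id {v : V} {y z : Γ.InfPath} :
    IsPrependOpt (some (Γ.id v)) y z ↔ z = y ∧ y.t = v := isPrepend_id

theorem isPrependOpt_none {y z : Γ.InfPath} : IsPrependOpt none y z ↔ z = y := Iff.rfl

theorem word_rel_zero {p q : Option Λ} {x y : Γ.SpaceNL} : (Γ.word 0 0 p q).rel x y ↔
    x.1 = y.1 ∧ ∃ u, IsPrependOpt p u x.2 ∧ IsPrependOpt q u y.2 := by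
  constructor
  · rintro ⟨w, ⟨h1, h2⟩, h3, h4⟩
    exact ⟨funext fun j => (h1 j).symm.trans (h3 j), w.2, h2, h4⟩
  · rintro ⟨h, u, h1, h2⟩
    exact ⟨(x.1, u), ⟨fun j => by simp, h1⟩, fun j => by simp [h], h2⟩

variable (hN : IsMGDS Γ.systemNL) (dN : DomainCondition Γ.systemNL)
  (hK : ∀ m n, IsCompact (repSet Γ.systemNL m n)) [T2Space (SemidirectGroupoid Γ.systemNL)]

/-- The element `S^a S^{*b} s_p s_q^*` of the groupoid C⋆-algebra. -/
def wordEl (a b : Fin r → ℕ) (p q : Option Λ) : (semidirectGroupoid hN dN).FullCStar :=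
  (Γ.word a b p q).el hN dN hK

theorem star_wordEl (a b : Fin r → ℕ) (p q : Option Λ) :
    star (wordEl hN dN hK a b p q) = wordEl hN dN hK b a q p := by
  refine SemidirectBisection.el_star hN dN hK ?_ fun x y => word_rel_swap
  rw [word_deg, word_deg]
  funext j
  cases j <;> simp

/-- A word factors into its creation part and its annihilation part, joined at the intermediate
point `w`. -/
theorem wordEl_mul_right (a b : Fin r → ℕ) (p q : Option Λ) :
    wordEl hN dN hK a 0 p none * wordEl hN dN hK 0 b none q = wordEl hN dN hK a b p q := by
  refine SemidirectBisection.el_mul hN dN hK ?_ fun x z => ?_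
  · simp only [word_deg]
    funext j
    cases j <;> simp [shapeOpt, sub_eq_add_neg]
  · simp only [word_rel_left, word_rel_right]
    rfl

theorem wordEl_mul_left {a a' : Fin r → ℕ} {p p' p'' : Option Λ}
    (hs : Γ.shapeOpt p'' = Γ.shapeOpt p + Γ.shapeOpt p')
    (hp : ∀ y z : Γ.InfPath, IsPrependOpt p'' y z ↔ ∃ u, IsPrependOpt p' y u ∧ IsPrependOpt p u z) :
    wordEl hN dN hK a 0 p none * wordEl hN dN hK a' 0 p' none =
      wordEl hN dN hK (a + a') 0 p'' none := by
  refine SemidirectBisection.el_mul hN dN hK ?_ fun x z => ?_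
  · simp only [word_deg, hs]
    funext j
    cases j <;> simp [shapeOpt]
  · simp only [word_rel_left, hp]
    constructor
    · rintro ⟨h1, u, h2, h3⟩
      refine ⟨(fun j => z.1 j + a' j, u), ⟨fun j => ?_, h3⟩, fun j => rfl, h2⟩
      rw [← h1 j, Pi.add_apply, Nat.cast_add, add_assoc, add_comm (a' j : ℕ∞)]
    · rintro ⟨y, ⟨h1, h2⟩, h3, h4⟩
      refine ⟨fun j => ?_, y.2, h4, h2⟩
      rw [← h1 j, ← h3 j, Pi.add_apply, Nat.cast_add, add_assoc, add_comm (a' j : ℕ∞)]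

theorem wordEl_star_mul_self {a : Fin r → ℕ} {p q : Option Λ} (hs : Γ.shapeOpt q = 0)
    (hq : ∀ y z : Γ.InfPath, IsPrependOpt q y z ↔ ∃ u, IsPrependOpt p z u ∧ IsPrependOpt p y u) :
    wordEl hN dN hK 0 a none p * wordEl hN dN hK a 0 p none =
      wordEl hN dN hK 0 0 q none := by
  refine SemidirectBisection.el_mul hN dN hK ?_ fun x z => ?_
  · simp only [word_deg, hs]
    funext j
    cases j <;> simp [shapeOpt]
  · simp only [word_rel_left, word_rel_right, hq]
    constructor
    · rintro ⟨h1, u, h2, h3⟩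
      refine ⟨(fun j => x.1 j + a j, u), ⟨fun j => rfl, h2⟩, fun j => ?_, h3⟩
      change z.1 j + a j = x.1 j + a j
      rw [← h1 j]
      simp
    · rintro ⟨y, ⟨h1, h2⟩, h3, h4⟩
      refine ⟨fun j => ?_, y.2, h2, h4⟩
      simpa using enat_add_cancel ((h3 j).trans (h1 j).symm)

/-- In general an annihilation followed by a creation in the same coordinate does not commute with
the reversed order; the hypothesis separates the coordinates of `a` and `b`. -/
theorem wordEl_star_mul {a b : Fin r → ℕ} {q : Option Λ} (hab : ∀ j, a j = 0 ∨ b j = 0) :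
    wordEl hN dN hK 0 b none q * wordEl hN dN hK a 0 none none = wordEl hN dN hK a b none q := by
  refine SemidirectBisection.el_mul hN dN hK ?_ fun x z => ?_
  · simp only [word_deg]
    funext j
    cases j <;> simp [shapeOpt, sub_eq_neg_add]
  · simp only [word_rel_left, word_rel_right]
    constructor
    · rintro ⟨w, ⟨h1, h2⟩, h3, h4⟩
      refine ⟨(fun j => x.1 j + b j, z.2), ⟨fun j => rfl, ?_⟩, fun j => ?_, rfl⟩
      · have h2' : x.2 = w.2 := h2
        rw [h2']
        exact h4
      · change z.1 j + a j = x.1 j + b j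
        rw [← h1 j, ← h3 j, add_right_comm]
    · rintro ⟨y, ⟨h1, h2⟩, h3, h4⟩
      obtain h4 : y.2 = z.2 := h4
      rw [h4] at h2
      -- The intermediate point needs `x - a`. In a coordinate with `b_j = 0` the two descriptions
      -- of `y` give `x_j = z_j + a_j`.
      have ha : ∀ j, (a j : ℕ∞) ≤ x.1 j := fun j => by
        rcases hab j with h | h
        · simp [h]
        · have h5 := (h1 j).trans (h3 j).symm
          rw [h, Nat.cast_zero, add_zero] at h5
          rw [h5]
          exact le_add_self
      refine ⟨(fun j => x.1 j - a j, x.2), ⟨fun j => tsub_add_cancel_of_le (ha j), rfl⟩,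
        fun j => enat_add_cancel (n := a j) ?_, h2⟩
      change x.1 j - a j + b j + a j = _
      rw [add_right_comm, tsub_add_cancel_of_le (ha j), h1 j, h3 j]

theorem commute_wordEl {a b : Fin r → ℕ} {q : Option Λ} (hab : ∀ j, a j = 0 ∨ b j = 0) :
    Commute (wordEl hN dN hK a 0 none none) (wordEl hN dN hK 0 b none q) :=
  (wordEl_mul_right hN dN hK a b none q).trans (wordEl_star_mul hN dN hK hab).symm

theorem wordEl_unit (a : (semidirectGroupoid hN dN).FullCStar) :
    wordEl hN dN hK 0 0 none none * a = a ∧ a * wordEl hN dN hK 0 0 none none = a := by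
  refine SemidirectBisection.el_unit hN dN hK ?_ (fun x y => ?_) a
  · rw [word_deg]
    funext j
    cases j <;> simp
  · rw [word_rel_left]
    constructor
    · rintro ⟨h1, h2⟩
      exact Prod.ext (funext fun j => (h1 j).symm.trans (by simp)) h2
    · rintro rfl
      exact ⟨fun j => by simp, rfl⟩

theorem wordEl_congr {p q p' q' : Option Λ} (hp : Γ.shapeOpt p = Γ.shapeOpt p')
    (hq : Γ.shapeOpt q = Γ.shapeOpt q')
    (h : ∀ x y : Γ.InfPath, (∃ u, IsPrependOpt p u x ∧ IsPrependOpt q u y) ↔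
      ∃ u, IsPrependOpt p' u x ∧ IsPrependOpt q' u y) :
    wordEl hN dN hK 0 0 p q = wordEl hN dN hK 0 0 p' q' := by
  refine SemidirectBisection.el_congr hN dN hK ?_ fun x y => ?_
  · rw [word_deg, word_deg, hp, hq]
  · rw [word_rel_zero, word_rel_zero, h]

theorem wordEl_id (v : V) :
    wordEl hN dN hK 0 0 none (some (Γ.id v)) = wordEl hN dN hK 0 0 (some (Γ.id v)) none := by
  refine wordEl_congr hN dN hK (shapeOpt_id v).symm (shapeOpt_id v) fun x y => ?_
  simp only [isPrependOpt_id, isPrependOpt_none]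
  constructor <;>
  · rintro ⟨u, h1, h2⟩
    aesop

theorem wordEl_id_mul (v w : V) :
    wordEl hN dN hK 0 0 (some (Γ.id v)) none * wordEl hN dN hK 0 0 (some (Γ.id w)) none =
      wordEl hN dN hK 0 0 (some (Γ.id v)) (some (Γ.id w)) := by
  rw [← wordEl_id hN dN hK w, wordEl_mul_right]

theorem wordEl_id_mul_self (v : V) :
    wordEl hN dN hK 0 0 (some (Γ.id v)) none * wordEl hN dN hK 0 0 (some (Γ.id v)) none =
      wordEl hN dN hK 0 0 (some (Γ.id v)) none := by
  rw [wordEl_id_mul]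
  refine wordEl_congr hN dN hK rfl (shapeOpt_id v) fun x y => ?_
  simp only [isPrependOpt_id, isPrependOpt_none]
  constructor <;>
  · rintro ⟨u, h1, h2⟩
    aesop

theorem wordEl_id_mul_of_ne {v w : V} (hvw : v ≠ w) :
    wordEl hN dN hK 0 0 (some (Γ.id v)) none * wordEl hN dN hK 0 0 (some (Γ.id w)) none = 0 := by
  rw [wordEl_id_mul]
  refine SemidirectBisection.el_eq_zero hN dN hK fun x y h => ?_
  obtain ⟨-, u, h1, h2⟩ := word_rel_zero.1 h
  exact hvw ((isPrependOpt_id.1 h1).2.symm.trans (isPrependOpt_id.1 h2).2)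

theorem wordEl_comp {l m : Λ} (h : Γ.s l = Γ.t m) :
    wordEl hN dN hK 0 0 (some (Γ.comp l m h)) none =
      wordEl hN dN hK 0 0 (some l) none * wordEl hN dN hK 0 0 (some m) none := by
  have h1 := wordEl_mul_left hN dN hK (a := 0) (a' := 0) (p := some l) (p' := some m)
    (p'' := some (Γ.comp l m h)) (Γ.σ_comp l m h) fun y z => isPrepend_comp h
  rw [h1, add_zero]

theorem wordEl_star_mul_gen (l : Λ) :
    wordEl hN dN hK 0 0 none (some l) * wordEl hN dN hK 0 0 (some l) none =
      wordEl hN dN hK 0 0 (some (Γ.id (Γ.s l))) none := by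
  refine wordEl_star_mul_self hN dN hK (shapeOpt_id _) fun y z => ?_
  rw [isPrependOpt_id]
  constructor
  · rintro ⟨rfl, h⟩
    obtain ⟨u, hu⟩ := exists_isPrepend h.symm
    exact ⟨u, hu, hu⟩
  · rintro ⟨u, h1, h2⟩
    exact ⟨h1.unique_left h2, (IsPrepend.s_eq h2).symm⟩

/-- Every path with terminal object `v` has exactly one initial segment of shape `n`, so the
bisections of the `s_l s_l^*` partition that of the vertex projection. -/
theorem wordEl_sum (hΓ : Γ.FinitenessCondition) (v : V) (n : Fin r → ℕ) :
    wordEl hN dN hK 0 0 (some (Γ.id v)) none =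
      ∑ᶠ l : {l : Λ // Γ.t l = v ∧ Γ.σ l = n},
        wordEl hN dN hK 0 0 (some l.1) none * wordEl hN dN hK 0 0 none (some l.1) := by
  have : Finite {l : Λ // Γ.t l = v ∧ Γ.σ l = n} :=
    ((hΓ.finite n).subset fun l hl => hl.2 : {l : Λ | Γ.t l = v ∧ Γ.σ l = n}.Finite)
  simp only [wordEl_mul_right]
  refine SemidirectBisection.el_eq_finsum hN dN hK (F := fun l : {l : Λ // Γ.t l = v ∧ Γ.σ l = n} =>
    Γ.word 0 0 (some l.1) (some l.1)) (fun l => ?_) (fun x y => ?_) ?_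
  · rw [word_deg, word_deg, shapeOpt_id]
    funext j
    cases j <;> simp
  · simp only [word_rel_zero, isPrependOpt_id, isPrependOpt_none]
    constructor
    · rintro ⟨h, u, ⟨h1, h2⟩, h3⟩
      have hyt : y.2.t = v := by rw [h3, h2]
      have hxy : x.2 = y.2 := h1.trans h3.symm
      refine ⟨⟨y.2.init n, (y.2.t_init n).trans hyt, y.2.σ_init n⟩, h, y.2.shift n, ?_,
        isPrepend_init _ _⟩
      rw [hxy]
      exact isPrepend_init _ _
    · rintro ⟨⟨l, hl, hl'⟩, h, u, h1, h2⟩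
      exact ⟨h, y.2, ⟨h1.unique h2, (IsPrepend.t_eq h2).trans hl⟩, rfl⟩
  · rintro ⟨l, hl, hl'⟩ ⟨m, hm, hm'⟩ x y h h'
    obtain ⟨-, u, h1, -⟩ := word_rel_zero.1 h
    obtain ⟨-, u', h1', -⟩ := word_rel_zero.1 h'
    have e1 : x.2.init (Γ.σ l) = l := h1.1
    have e2 : x.2.init (Γ.σ m) = m := h1'.1
    rw [hl'] at e1
    rw [hm'] at e2
    exact Subtype.ext (e1.symm.trans e2)

theorem wordEl_sum_id (hΓ : Γ.FinitenessCondition) : wordEl hN dN hK 0 0 none none =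
    ∑ᶠ v, wordEl hN dN hK 0 0 (some (Γ.id v)) none := by
  have := hΓ.finite_objects
  refine SemidirectBisection.el_eq_finsum hN dN hK (F := fun v : V =>
    Γ.word 0 0 (some (Γ.id v)) none) (fun v => ?_) (fun x y => ?_) ?_
  · rw [word_deg, word_deg, shapeOpt_id]
  · simp only [word_rel_zero, isPrependOpt_id, isPrependOpt_none]
    constructor
    · rintro ⟨h, u, h1, h2⟩
      exact ⟨_, h, u, ⟨h1, rfl⟩, h2⟩
    · rintro ⟨v, h, u, ⟨h1, -⟩, h2⟩
      exact ⟨h, u, h1, h2⟩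
  · intro v w x y h h'
    obtain ⟨-, u, h1, h2⟩ := word_rel_zero.1 h
    obtain ⟨-, u', h1', h2'⟩ := word_rel_zero.1 h'
    rw [isPrependOpt_id] at h1 h1'
    rw [isPrependOpt_none] at h2 h2'
    rw [← h1.2, ← h1'.2, ← h2, ← h2']

theorem commute_wordEl_gen (a : Fin r → ℕ) (p : Option Λ) :
    Commute (wordEl hN dN hK 0 0 p none) (wordEl hN dN hK a 0 none none) := by
  have h1 := wordEl_mul_left hN dN hK (a := 0) (a' := a) (p := p) (p' := none) (p'' := p)
    (add_zero _).symm fun y z => by simp [isPrependOpt_none]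
  have h2 := wordEl_mul_left hN dN hK (a := a) (a' := 0) (p := none) (p' := p) (p'' := p)
    (zero_add _).symm fun y z => by simp [isPrependOpt_none]
  exact h1.trans ((congrArg (fun b => wordEl hN dN hK b 0 p none) (add_comm 0 a)).trans h2.symm)

theorem commute_wordEl_shift (a b : Fin r → ℕ) :
    Commute (wordEl hN dN hK a 0 none none) (wordEl hN dN hK b 0 none none) := by
  have h : ∀ a b, wordEl hN dN hK a 0 none none * wordEl hN dN hK b 0 none none =
      wordEl hN dN hK (a + b) 0 none none := fun a b =>
    wordEl_mul_left hN dN hK (add_zero _).symm fun y z => by simp [isPrependOpt_none]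
  exact (h a b).trans ((congrArg (fun c => wordEl hN dN hK c 0 none none) (add_comm a b)).trans
    (h b a).symm)

/-- The homomorphism `𝒯^{⊗r} ⊗ C*(Λ) → C*(G(ℕ̄^r × Λ^∞, S × W))`. -/
theorem exists_theta (hΓ : Γ.FinitenessCondition) :
    ∃ Θ : Γ.ToeplitzTensor →⋆ₙₐ[ℂ] (semidirectGroupoid hN dN).FullCStar,
      (∀ j, Θ (Γ.tensorS j) = wordEl hN dN hK (Pi.single j 1) 0 none none) ∧
      ∀ l, Θ (Γ.tensorGen l) = wordEl hN dN hK 0 0 (some l) none := by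
  -- The unit space is compact and open, so its characteristic function is a unit, and the universal
  -- property for unital algebras becomes applicable.
  let _ : CStarAlgebra (semidirectGroupoid hN dN).FullCStar :=
    CStarAlgebra.ofUnit (wordEl hN dN hK 0 0 none none) (fun a => (wordEl_unit hN dN hK a).1)
      fun a => (wordEl_unit hN dN hK a).2
  have hcomm : ∀ i j : Fin r, i ≠ j → ∀ k,
      (Pi.single i 1 : Fin r → ℕ) k = 0 ∨ (Pi.single j 1 : Fin r → ℕ) k = 0 := by
    intro i j hij k
    by_cases hk : k = i
    · subst hk
      exact Or.inr (Pi.single_eq_of_ne hij 1)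
    · exact Or.inl (Pi.single_eq_of_ne hk 1)
  refine exists_hom_toeplitzTensor hΓ
    (s := fun l => wordEl hN dN hK 0 0 (some l) none)
    (S := fun j => wordEl hN dN hK (Pi.single j 1) 0 none none) ?_ (fun j => ?_)
    (fun i j hij => ⟨commute_wordEl_shift hN dN hK _ _, ?_⟩)
    (fun l j => ⟨commute_wordEl_gen hN dN hK _ _, ?_⟩)
  · exact
    { star_id := fun v => (star_wordEl hN dN hK _ _ _ _).trans (wordEl_id hN dN hK v)
      id_mul_id := wordEl_id_mul_self hN dN hK
      id_mul_id_of_ne := fun v w hvw => wordEl_id_mul_of_ne hN dN hK hvw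
      comp := fun l m h => wordEl_comp hN dN hK h
      star_mul := fun l => (congrArg (· * wordEl hN dN hK 0 0 (some l) none)
        (star_wordEl hN dN hK _ _ _ _)).trans (wordEl_star_mul_gen hN dN hK l)
      sum := fun v n => by
        refine (wordEl_sum hN dN hK hΓ v n).trans (finsum_congr fun l => ?_)
        exact congrArg (wordEl hN dN hK 0 0 (some l.1) none * ·)
          (star_wordEl hN dN hK _ _ _ _).symm
      sum_id := wordEl_sum_id hN dN hK hΓ }
  · refine (congrArg (· * wordEl hN dN hK (Pi.single j 1) 0 none none)
      (star_wordEl hN dN hK _ _ _ _)).trans ?_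
    exact wordEl_star_mul_self hN dN hK rfl fun y z => by
      simp [isPrependOpt_none, eq_comm]
  · have h := commute_wordEl hN dN hK (q := none) (hcomm i j hij)
    rw [← star_wordEl hN dN hK (Pi.single j 1) 0] at h
    exact h
  -- `S_j` commutes with `s_l^*`; taking adjoints gives that `S_j^*` commutes with `s_l`.
  · have h := (commute_wordEl hN dN hK (a := Pi.single j 1) (b := 0) (q := some l)
      fun _ => Or.inr rfl).star_star
    rw [star_wordEl hN dN hK 0 0] at h
    exact h.symm

end HigherRankGraph

/-! ### Identification of the bisections of the generators -/

namespace HigherRankGraph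

variable {r : ℕ} {V Λ : Type*} {Γ : HigherRankGraph r V Λ}

theorem carrier_word_shift (j : Fin r) :
    (Γ.word (Pi.single j 1) 0 none none).carrier = Γ.bisectionS j := by
  have h1 : ∀ i, (((Pi.single j 1 : Fin r → ℕ) i : ℕ) : ℕ∞) = (Pi.single j 1 : Fin r → ℕ∞) i := by
    intro i
    by_cases hi : i = j
    · subst hi
      simp
    · simp [hi]
  have h2 : (Γ.word (Pi.single j 1) 0 none none).deg = Pi.single (Sum.inl j) 1 := by
    rw [word_deg]
    funext i
    rcases i with i | i
    · by_cases hi : i = j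
      · subst hi
        simp
      · simp [hi]
    · simp
  ext g
  refine Iff.trans (and_congr word_rel_left (Eq.congr_right h2)) ?_
  rw [and_assoc]
  refine and_congr ?_ Iff.rfl
  rw [funext_iff]
  refine forall_congr' fun i => ?_
  rw [h1, eq_comm]
  rfl

theorem carrier_word_gen (l : Λ) :
    (Γ.word 0 0 (some l) none).carrier = Γ.bisectionGen l := by
  have h2 : (Γ.word 0 0 (some l) none).deg = Sum.elim (fun _ => 0) fun j => (Γ.σ l j : ℤ) := by
    rw [word_deg]
    funext i
    rcases i with i | i <;> simp [shapeOpt]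
  ext g
  refine Iff.trans (and_congr word_rel_left (Eq.congr_right h2)) ?_
  rw [and_assoc]
  refine and_congr ?_ Iff.rfl
  rw [funext_iff]
  refine forall_congr' fun i => ?_
  rw [eq_comm]
  simp

end HigherRankGraph

end

theorem mainTheorem5 :
    (∀ (G₁ : Type*) (X₁ : Type*) (G₂ : Type*) (X₂ : Type*)
      [TopologicalSpace G₁] [TopologicalSpace X₁] [TopologicalSpace G₂] [TopologicalSpace X₂]
      (𝒢₁ : GroupoidStr G₁ X₁) (𝒢₂ : GroupoidStr G₂ X₂), 𝒢₁.IsEtale → 𝒢₂.IsEtale →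
      ∀ (φ : G₁ → G₂) (φ₀ : X₁ → X₂), GroupoidStr.IsMorphism 𝒢₁ 𝒢₂ φ φ₀ →
      GroupoidStr.IsRangeFibreBijective 𝒢₁ 𝒢₂ φ φ₀ → IsProperMap φ₀ →
      IsProperMap φ ∧
      ∃ pull : C_c(G₂, ℂ) → C_c(G₁, ℂ), (∀ f g, pull f g = f (φ g)) ∧
        ∃! Φ : 𝒢₂.FullCStar →⋆ₙₐ[ℂ] 𝒢₁.ReducedCStar,
          ∀ f, (Φ (𝒢₂.toFull f)).IsImage (pull f)) ∧
    (∀ (r : ℕ) (V : Type*) (Λ : Type*) (Γ : HigherRankGraph r V Λ), Γ.FinitenessCondition →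
      ∃ (hZ : IsMGDS Γ.systemZ) (dZ : DomainCondition Γ.systemZ)
        (hN : IsMGDS Γ.systemNL) (dN : DomainCondition Γ.systemNL),
        (semidirectGroupoid hZ dZ).IsEtale ∧ (semidirectGroupoid hN dN).IsEtale ∧
        ∃ φ₀ : Γ.SpaceZ → Γ.SpaceNL, Γ.IsPhi φ₀ ∧
        ∃ φ : SemidirectGroupoid Γ.systemZ → SemidirectGroupoid Γ.systemNL,
          (∀ g, (φ g).1 = (φ₀ g.1.1, g.1.2.1, φ₀ g.1.2.2)) ∧
          GroupoidStr.IsMorphism (semidirectGroupoid hZ dZ) (semidirectGroupoid hN dN) φ φ₀ ∧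
          GroupoidStr.IsRangeFibreBijective (semidirectGroupoid hZ dZ) (semidirectGroupoid hN dN)
            φ φ₀ ∧
          IsProperMap φ₀ ∧ IsProperMap φ ∧
          ∃ pull : C_c(SemidirectGroupoid Γ.systemNL, ℂ) → C_c(SemidirectGroupoid Γ.systemZ, ℂ),
            (∀ f g, pull f g = f (φ g)) ∧
            (∃! Φr : (semidirectGroupoid hN dN).FullCStar →⋆ₙₐ[ℂ]
                (semidirectGroupoid hZ dZ).ReducedCStar,
              ∀ f, (Φr ((semidirectGroupoid hN dN).toFull f)).IsImage (pull f)) ∧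
            ∃ (χS : Fin r → C_c(SemidirectGroupoid Γ.systemNL, ℂ))
              (χL : Λ → C_c(SemidirectGroupoid Γ.systemNL, ℂ)),
              (∀ j g, χS j g = (Γ.bisectionS j).indicator 1 g) ∧
              (∀ l g, χL l g = (Γ.bisectionGen l).indicator 1 g) ∧
              ∃ (Φ : (semidirectGroupoid hN dN).FullCStar →⋆ₙₐ[ℂ]
                    (semidirectGroupoid hZ dZ).FullCStar)
                (Θ : Γ.ToeplitzTensor →⋆ₙₐ[ℂ] (semidirectGroupoid hN dN).FullCStar)
                (Ψ : Γ.ToeplitzTensor →⋆ₙₐ[ℂ] (semidirectGroupoid hZ dZ).FullCStar),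
                (∀ f, Φ ((semidirectGroupoid hN dN).toFull f) =
                  (semidirectGroupoid hZ dZ).toFull (pull f)) ∧
                (∀ j, Θ (Γ.tensorS j) = (semidirectGroupoid hN dN).toFull (χS j)) ∧
                (∀ l, Θ (Γ.tensorGen l) = (semidirectGroupoid hN dN).toFull (χL l)) ∧
                Ψ = Φ.comp Θ) := by
  refine ⟨?_, ?_⟩
  · intro G₁ X₁ G₂ X₂ _ _ _ _ 𝒢₁ 𝒢₂ h₁ h₂ φ φ₀ hφ hb hp
    have := h₂.t2
    have hproper := hφ.isProperMap h₁ h₂ hb hp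
    exact ⟨hproper, GroupoidStr.pullback hproper, fun _ _ => rfl,
      hφ.existsUnique_full_to_reduced h₁ h₂ hb hproper⟩
  · intro r V Λ Γ hΓ
    have := HigherRankGraph.InfPath.compactSpace hΓ
    have := HigherRankGraph.compactSpace_spaceZ hΓ
    have sZ := HigherRankGraph.SpaceZ.isSystem_systemZ hΓ
    have sN := HigherRankGraph.ShiftModel.isSystem_systemNL (Γ := Γ)
    have hZ := sZ.isMGDS
    have dZ := sZ.domainCondition
    have hN := sN.isMGDS
    have dN := sN.domainCondition
    have eZ := semidirectGroupoid_isEtale hZ dZ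
    have eN := semidirectGroupoid_isEtale hN dN
    have := eN.t2
    have hφ := HigherRankGraph.ShiftModel.isMorphism_mapGroupoid sZ hZ dZ hN dN
    have hb := HigherRankGraph.ShiftModel.isRangeFibreBijective_mapGroupoid sZ hZ dZ hN dN
    -- A continuous map from a compact space to a Hausdorff space is proper.
    have hp : IsProperMap (HigherRankGraph.SpaceZ.phi hΓ) := (HigherRankGraph.SpaceZ.continuous_phi hΓ).isProperMap
    have hproper := hφ.isProperMap eZ eN hb hp
    obtain ⟨Φ, hΦ⟩ := hφ.exists_full_to_full eN hb hproper
    obtain ⟨Θ, hΘ, hΘ'⟩ := HigherRankGraph.exists_theta hN dN sN.isCompact_repSet hΓ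
    refine ⟨hZ, dZ, hN, dN, eZ, eN, HigherRankGraph.SpaceZ.phi hΓ, HigherRankGraph.SpaceZ.isPhi_phi hΓ, HigherRankGraph.ShiftModel.mapGroupoid sZ,
      fun _ => rfl, hφ, hb, hp, hproper, GroupoidStr.pullback hproper, fun _ _ => rfl,
      hφ.existsUnique_full_to_reduced eZ eN hb hproper,
      fun j => (Γ.word (Pi.single j 1) 0 none none).char hN sN.isCompact_repSet,
      fun l => (Γ.word 0 0 (some l) none).char hN sN.isCompact_repSet,
      fun j g => ?_, fun l g => ?_, Φ, Θ, Φ.comp Θ, hΦ, hΘ, hΘ', rfl⟩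
    · rw [SemidirectBisection.char_apply, HigherRankGraph.carrier_word_shift]
    · rw [SemidirectBisection.char_apply, HigherRankGraph.carrier_word_gen]
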